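/- Let $n\in\{1,2,3\}$, let $0\le r\le q$ be integers and let $\sigma,\Lambda>0$. **Setting.** Let $\Omega\subset\mathbb R^n$ be a bounded open set (for instance a bounded Lipschitz domain) with a conforming triangulation $\mathcal T_H$ (the macro-mesh), so that $\overline\Omega=\bigcup_{T\in\mathcal T_H}\overline T$. Put $H_T=\operatorname{diam}T$ and $H=\max_T H_T$, and assume that $\mathcal T_H$ is shape regular with constant $\sigma$: every $T$ contains a ball of diameter $\rho_T>0$ with $H_T\le\sigma\rho_T$. Let $K:\Omega\to\mathbb R^{n\times n}$ be symmetric, $a(u,v)=\int_\Omega\nabla u^\top K\nabla v\,dx$ on $H^1_0(\Omega)$, and $|K|_{W^{r+1,\infty}(\mathcal T_H)}=\max_{T,a,b}|K_{ab}|_{W^{r+1,\infty}(T)}$. For $m\ge 0$ let $\mathcal S^m(\mathcal T_H)$ be the mesh obtained by $m$ uniform refinements of every macro-element (bisection for $n=1$, four triangles for $n=2$, Bey's eight tetrahedra for $n=3$), with vertices $x_i$ and hat functions $\phi_i$. Let $T_m$ be the set of vertices in $\overline T$, $\mathring T_m=T_m\cap T$, $\partial T_m=T_m\setminus\mathring T_m$,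 $\partial\mathbb X_m=\bigcup_T\partial T_m$, and $V_h=\{v\in H^1_0(\Omega): v|_t\in\mathcal P_1(t)\ \forall t\in\mathcal S^m(\mathcal T_H)\}$. Set $\mathsf A_{ij}=\int_\Omega\nabla\phi_j^\top K\nabla\phi_i\,dx$ for all vertices $x_i,x_j$, including those on $\partial\Omega$. For $T\in\mathcal T_H$ let $\phi(y)=\phi_i(y+x_i)$ with $x_i\in\mathring T_m$ (independent of $i$), and let $\mathscr D(\mathring T_m)$ be the set of all $\delta=x_j-x_i$ with $x_i\in\mathring T_m$, $x_j\in T_m$ and $\{\phi_i\ne0\}\cap\{\phi_j\ne0\}\ne\emptyset$. For such $\delta$ put $\phi_\delta(y)=\phi(y-\delta)$, $\Omega_\delta=\{\phi\neq0\}\cap\{\phi_\delta\ne0\}$, $T_\delta=\{x\in T: x+y\in T\ \forall y\in\Omega_\delta\}$ and $$\Phi^\delta_T(x)=\int_{\Omega_\delta}\nabla\phi_\delta(y)^\top K(x+y)\nabla\phi(y)\,dy,\qquad x\in\overline{T_\delta}.$$ Let $\Pi^\delta_T:C^0(\overline{T_\delta})\to\mathcal P_q(T_\delta)$ be linear projections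 onto the polynomials of degree at most $q$ with $\|\Pi^\delta_Tf\|_{L^\infty(T_\delta)}\le\Lambda\|f\|_{L^\infty(T_\delta)}$ which are related for opposite directions by $(\Pi^\delta_T\Phi^\delta_T)(x)=(\Pi^{-\delta}_T\Phi^{-\delta}_T)(x+\delta)$ on $\overline{T_\delta}$. The surrogate stiffness matrix is defined, for $i\neq j$, by $$\tilde{\mathsf A}_{ij}=\begin{cases}\mathsf A_{ij},& x_i,x_j\in\partial\mathbb X_m,\\ (\Pi^\delta_T\Phi^\delta_T)(x_i),&\delta=x_j-x_i\in\mathscr D(\mathring T_m)\text{ and }x_i\text{ or }x_j\in\mathring T_m\text{ for some }T\in\mathcal T_H,\\0,&\text{otherwise,}\end{cases}$$ and its diagonal is fixed by the zero row sum property $$\tilde{\mathsf A}_{ii}=-\sum_{x_j\in\Omega,\,j\ne i}\tilde{\mathsf A}_{ij}-\sum_{x_j\in\partial\Omega}\mathsf A_{ij}.$$ The surrogate bilinear form is $\tilde a(v,w)=\sum_{x_i,x_j\in\Omega}\tilde{\mathsf A}_{ij}\,v(x_j)\,w(x_i)$ on $V_h$. **Theorem.** There is a constant $C>0$ depending only on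 $n,q,r,\sigma,\Lambda$ such that the following holds for all $\Omega$ and all $K$ as above. 1. For every $\mathcal T_H$ as above with $K\in[W^{r+1,\infty}(\mathcal T_H)]^{n\times n}$, every $m\ge0$, every admissible family of projections and every $v\in V_h$, $$|a(v,v)-\tilde a(v,v)|\le C\,H^{r+1}\,|K|_{W^{r+1,\infty}(\mathcal T_H)}\,\|\nabla v\|_{L^2(\Omega)}^2 .$$ 2. If $a$ is coercive on $H^1_0(\Omega)$, i.e. $a(u,u)\ge\alpha\|u\|_{H^1(\Omega)}^2$ for some $\alpha>0$ and all $u\in H^1_0(\Omega)$, then $\tilde a$ is coercive on $V_h$ for every sufficiently fine macro-mesh: there are $H_0>0$ and $\tilde\alpha>0$ such that, for every $\mathcal T_H$ as above with $K\in[W^{r+1,\infty}(\mathcal T_H)]^{n\times n}$ and $H<H_0$, every $m\ge0$ and every admissible family of projections, $$\tilde a(v,v)\ge\tilde\alpha\,\|v\|_{H^1(\Omega)}^2\qquad\text{for all }v\in V_h .$$ -/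

import Mathlib

open MeasureTheory Set
open scoped ContDiff ENNReal

namespace Surrogate

/-- `ℝⁿ` with the Euclidean norm. -/
abbrev E (n : ℕ) := EuclideanSpace ℝ (Fin n)

/-! ### Sobolev spaces -/

/-- Smooth test functions with compact support inside `U`. -/
def IsTestFunction {n : ℕ} (U : Set (E n)) (φ : E n → ℝ) : Prop :=
  ContDiff ℝ ∞ φ ∧ HasCompactSupport φ ∧ tsupport φ ⊆ U

/-- `g` is the weak partial derivative `∂_{ι 0} ⋯ ∂_{ι (k-1)} f` on the open set `U`. -/
def IsWeakDeriv {n k : ℕ} (U : Set (E n)) (ι : Fin k → Fin n) (f g : E n → ℝ) : Prop :=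
  LocallyIntegrableOn f U ∧ LocallyIntegrableOn g U ∧
  ∀ φ : E n → ℝ, IsTestFunction U φ →
    ∫ x in U, f x * iteratedFDeriv ℝ k φ x (fun i => EuclideanSpace.single (ι i) (1 : ℝ)) =
      (-1 : ℝ) ^ k * ∫ x in U, g x * φ x

/-- `f ∈ W^{k,∞}(U)`. -/
def MemSobolevInf {n : ℕ} (U : Set (E n)) (k : ℕ) (f : E n → ℝ) : Prop :=
  MemLp f ∞ (volume.restrict U) ∧
  ∀ j ≤ k, ∀ ι : Fin j → Fin n,
    ∃ g : E n → ℝ, IsWeakDeriv U ι f g ∧ MemLp g ∞ (volume.restrict U)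

/-- The seminorm `|f|_{W^{k,∞}(U)}`: the largest `L^∞(U)`-norm of a weak derivative of order `k`.
The weak derivative is unique almost everywhere, so the infimum only selects it. -/
noncomputable def sobolevInfSeminorm {n : ℕ} (U : Set (E n)) (k : ℕ) (f : E n → ℝ) : ℝ≥0∞ :=
  ⨆ ι : Fin k → Fin n, ⨅ (g : E n → ℝ) (_ : IsWeakDeriv U ι f g),
    eLpNorm g ∞ (volume.restrict U)

/-- `u ∈ H¹₀(Ω)` with weak gradient `g`: both are square integrable, `g` is the weak gradient of
`u`, and `u` is a limit of test functions in the `H¹(Ω)`-norm. -/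
structure IsH10 {n : ℕ} (Ω : Set (E n)) (u : E n → ℝ) (g : E n → E n) : Prop where
  memLp : MemLp u 2 (volume.restrict Ω)
  memLp_grad : MemLp g 2 (volume.restrict Ω)
  weak_grad : ∀ a : Fin n, IsWeakDeriv Ω (fun _ : Fin 1 => a) u (fun x => g x a)
  approx : ∀ ε : ℝ, 0 < ε → ∃ φ : E n → ℝ, IsTestFunction Ω φ ∧
    (∫ x in Ω, (u x - φ x) ^ 2) + (∫ x in Ω, ‖g x - gradient φ x‖ ^ 2) < ε

/-- The squared norm `‖u‖₁²` of `H¹(Ω)`, where `g` is the weak gradient of `u`. -/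
noncomputable def h1NormSq {n : ℕ} (Ω : Set (E n)) (u : E n → ℝ) (g : E n → E n) : ℝ :=
  (∫ x in Ω, u x ^ 2) + ∫ x in Ω, ‖g x‖ ^ 2

/-! ### The bilinear form of the variable coefficient Poisson equation -/

/-- `a(u, v) = ∫_Ω ∇uᵀ K ∇v`, as a function of the gradients `g` of `u` and `g'` of `v`. -/
noncomputable def poissonForm {n : ℕ} (Ω : Set (E n)) (K : E n → Matrix (Fin n) (Fin n) ℝ)
    (g g' : E n → E n) : ℝ :=
  ∫ x in Ω, ∑ a, ∑ b, g x a * K x a b * g' x b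

/-- `a` is coercive on `H¹₀(Ω)`. -/
def PoissonCoercive {n : ℕ} (Ω : Set (E n)) (K : E n → Matrix (Fin n) (Fin n) ℝ) : Prop :=
  ∃ α : ℝ, 0 < α ∧ ∀ (u : E n → ℝ) (g : E n → E n), IsH10 Ω u g →
    α * h1NormSq Ω u g ≤ poissonForm Ω K g g

/-! ### Macro-meshes and their uniform refinements -/

/-- A simplex, given by the ordered list of its vertices. -/
abbrev Simplex (n : ℕ) := Fin (n + 1) → E n

/-- The closed simplex. -/
def closedSimplex {n : ℕ} (y : Simplex n) : Set (E n) := convexHull ℝ (range y)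

/-- The open simplex. -/
def openSimplex {n : ℕ} (y : Simplex n) : Set (E n) := interior (closedSimplex y)

/-- `𝒯` is a conforming triangulation of `Ω` by nondegenerate simplices. -/
structure IsMacroMesh {n : ℕ} (Ω : Set (E n)) (𝒯 : Finset (Simplex n)) : Prop where
  nondegenerate : ∀ y ∈ 𝒯, AffineIndependent ℝ y
  subset : ∀ y ∈ 𝒯, openSimplex y ⊆ Ω
  cover : closure Ω = ⋃ y ∈ 𝒯, closedSimplex y
  disjoint : ∀ y ∈ 𝒯, ∀ z ∈ 𝒯, y ≠ z → Disjoint (openSimplex y) (openSimplex z)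
  conforming : ∀ y ∈ 𝒯, ∀ z ∈ 𝒯, y ≠ z →
    closedSimplex y ∩ closedSimplex z = convexHull ℝ (range y ∩ range z)

/-- Shape regularity with constant `σ`: every `T` contains a ball of diameter `ρ` with
`diam T ≤ σ ρ`. -/
def ShapeRegular {n : ℕ} (σ : ℝ) (𝒯 : Finset (Simplex n)) : Prop :=
  ∀ y ∈ 𝒯, ∃ (c : E n) (ρ : ℝ), 0 < ρ ∧ Metric.ball c (ρ / 2) ⊆ closedSimplex y ∧
    Metric.diam (closedSimplex y) ≤ σ * ρ

/-- The mesh size `H = max_T diam T`. -/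
noncomputable def meshSize {n : ℕ} (𝒯 : Finset (Simplex n)) : ℝ :=
  ⨆ y : 𝒯, Metric.diam (closedSimplex y.1)

/-- The children of a simplex `[y₀, …, yₙ]` under uniform refinement, in dimensions 1, 2 and 3
(bisection, the four-triangle subdivision, and Bey's subdivision into eight tetrahedra).
A pair `(i, j)` stands for the point `(yᵢ + yⱼ) / 2`. -/
def children : (n : ℕ) → List (Fin (n + 1) → Fin (n + 1) × Fin (n + 1))
  | 1 => [![(0, 0), (0, 1)], ![(0, 1), (1, 1)]]
  | 2 => [![(0, 0), (0, 1), (0, 2)], ![(0, 1), (1, 1), (1, 2)],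
          ![(0, 2), (1, 2), (2, 2)], ![(0, 1), (1, 2), (0, 2)]]
  | 3 => [![(0, 0), (0, 1), (0, 2), (0, 3)], ![(0, 1), (1, 1), (1, 2), (1, 3)],
          ![(0, 2), (1, 2), (2, 2), (2, 3)], ![(0, 3), (1, 3), (2, 3), (3, 3)],
          ![(0, 1), (0, 2), (0, 3), (1, 3)], ![(0, 1), (0, 2), (1, 2), (1, 3)],
          ![(0, 2), (0, 3), (1, 3), (2, 3)], ![(0, 2), (1, 2), (1, 3), (2, 3)]]
  | _ => []

open scoped Classical in
/-- `𝒮(T)`. -/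
noncomputable def subdivide {n : ℕ} (y : Simplex n) : Finset (Simplex n) :=
  ((children n).map fun c k => midpoint ℝ (y (c k).1) (y (c k).2)).toFinset

open scoped Classical in
/-- `𝒮^m(T)`. -/
noncomputable def iterSubdivide {n : ℕ} (y : Simplex n) : ℕ → Finset (Simplex n)
  | 0 => {y}
  | m + 1 => (iterSubdivide y m).biUnion subdivide

open scoped Classical in
/-- The fine mesh `𝒮^m(𝒯)`. -/
noncomputable def fineMesh {n : ℕ} (𝒯 : Finset (Simplex n)) (m : ℕ) : Finset (Simplex n) :=
  𝒯.biUnion fun y => iterSubdivide y m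

open scoped Classical in
/-- The lattice `T_m`: the points of `T` with barycentric coordinates in `2^{-m} ℤ`. -/
noncomputable def lattice {n : ℕ} (y : Simplex n) (m : ℕ) : Finset (E n) :=
  (Finset.univ.piAntidiag (2 ^ m)).image
    fun c : Fin (n + 1) → ℕ => ∑ k, ((c k : ℝ) / 2 ^ m) • y k

open scoped Classical in
/-- The interior lattice points of `T_m`. -/
noncomputable def interiorLattice {n : ℕ} (y : Simplex n) (m : ℕ) : Finset (E n) :=
  (lattice y m).filter (· ∈ openSimplex y)

open scoped Classical in
/-- The boundary lattice points `∂T_m`. -/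
noncomputable def boundaryLattice {n : ℕ} (y : Simplex n) (m : ℕ) : Finset (E n) :=
  lattice y m \ interiorLattice y m

open scoped Classical in
/-- The set `𝕏_m` of all vertices of the fine mesh. -/
noncomputable def vertices {n : ℕ} (𝒯 : Finset (Simplex n)) (m : ℕ) : Finset (E n) :=
  𝒯.biUnion fun y => lattice y m

open scoped Classical in
/-- The set `∂𝕏_m` of all vertices on macro-element boundaries. -/
noncomputable def interfaceVertices {n : ℕ} (𝒯 : Finset (Simplex n)) (m : ℕ) : Finset (E n) :=
  𝒯.biUnion fun y => boundaryLattice y m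

open scoped Classical in
/-- The vertices inside `Ω`: the degrees of freedom under homogeneous Dirichlet conditions. -/
noncomputable def dofs {n : ℕ} (Ω : Set (E n)) (𝒯 : Finset (Simplex n)) (m : ℕ) : Finset (E n) :=
  (vertices 𝒯 m).filter (· ∈ Ω)

/-! ### The finite element space and the true stiffness matrix -/

/-- `w` are barycentric coordinates of the point `x` of the closed simplex `t`. -/
def IsBarycentric {n : ℕ} (t : Simplex n) (x : E n) (w : Fin (n + 1) → ℝ) : Prop :=
  (∀ k, 0 ≤ w k) ∧ ∑ k, w k = 1 ∧ ∑ k, w k • t k = x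

open scoped Classical in
/-- The vertex (hat) function `φ_p` of the mesh `𝒮` at the vertex `p`: on each `t ∈ 𝒮` the
barycentric coordinate belonging to `p`, which is zero if `p` is not a vertex of `t`.
It vanishes off the mesh. On a conforming mesh the choice of `t` and `w` is immaterial. -/
noncomputable def vertexFun {n : ℕ} (𝒮 : Finset (Simplex n)) (p : E n) (x : E n) : ℝ :=
  if h : ∃ tw : Simplex n × (Fin (n + 1) → ℝ), tw.1 ∈ 𝒮 ∧ IsBarycentric tw.1 x tw.2 then
    ∑ k with h.choose.1 k = p, h.choose.2 k
  else 0

/-- `V_h = {v ∈ H¹₀(Ω) : v|_t ∈ 𝒫₁(t) for all t ∈ 𝒮}`, every element being represented by its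
continuous representative, extended by zero. -/
def feSpace {n : ℕ} (Ω : Set (E n)) (𝒮 : Finset (Simplex n)) : Set (E n → ℝ) :=
  {v | Continuous v ∧ (∀ x, x ∉ Ω → v x = 0) ∧ (∃ g : E n → E n, IsH10 Ω v g) ∧
    ∀ t ∈ 𝒮, ∃ f : E n →ᵃ[ℝ] ℝ, EqOn v f (closedSimplex t)}

/-- The entry `a(φ_q, φ_p)` in row `p` and column `q` of the (extended) stiffness matrix. Vertex
functions are affine on each fine simplex: their gradients exist off the faces. -/
noncomputable def stiffness {n : ℕ} (Ω : Set (E n)) (K : E n → Matrix (Fin n) (Fin n) ℝ)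
    (𝒯 : Finset (Simplex n)) (m : ℕ) (p q : E n) : ℝ :=
  poissonForm Ω K (gradient (vertexFun (fineMesh 𝒯 m) q)) (gradient (vertexFun (fineMesh 𝒯 m) p))

/-! ### Stencil functions -/

open scoped Classical in
/-- The test function `φ(y) = φ_i(y + x_i)` of the macro-element `T`, for an arbitrary
`x_i ∈ T̊_m`; all of them give the same `φ`. -/
noncomputable def refFun {n : ℕ} (𝒯 : Finset (Simplex n)) (m : ℕ) (T : Simplex n) (y : E n) : ℝ :=
  if h : (interiorLattice T m).Nonempty then
    vertexFun (fineMesh 𝒯 m) h.choose (y + h.choose)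
  else 0

/-- `φ_δ(y) = φ(y - δ)`. -/
noncomputable def refFunShift {n : ℕ} (𝒯 : Finset (Simplex n)) (m : ℕ) (T : Simplex n) (δ : E n)
    (y : E n) : ℝ :=
  refFun 𝒯 m T (y - δ)

/-- `Ω_δ = supp φ ∩ supp φ_δ`. -/
def overlap {n : ℕ} (𝒯 : Finset (Simplex n)) (m : ℕ) (T : Simplex n) (δ : E n) : Set (E n) :=
  Function.support (refFun 𝒯 m T) ∩ Function.support (refFunShift 𝒯 m T δ)

/-- The closure of `T_δ = {x ∈ T : x + y ∈ T for all y ∈ Ω_δ}`. -/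
def stencilDomain {n : ℕ} (𝒯 : Finset (Simplex n)) (m : ℕ) (T : Simplex n) (δ : E n) :
    Set (E n) :=
  closure {x | x ∈ openSimplex T ∧ ∀ y ∈ overlap 𝒯 m T δ, x + y ∈ openSimplex T}

/-- The translations `x_j - x_i`, `x_i ∈ T̊_m`, `x_j ∈ T_m`, between vertices whose vertex
functions interact. -/
def directions {n : ℕ} (𝒯 : Finset (Simplex n)) (m : ℕ) (T : Simplex n) : Set (E n) :=
  {δ | ∃ p ∈ interiorLattice T m, ∃ q ∈ lattice T m, δ = q - p ∧
    (Function.support (vertexFun (fineMesh 𝒯 m) p) ∩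
      Function.support (vertexFun (fineMesh 𝒯 m) q)).Nonempty}

/-- The local stencil function `Φ^δ_T(x) = ∫_{Ω_δ} ∇φ_δ(y)ᵀ K(x + y) ∇φ(y) dy`. -/
noncomputable def stencil {n : ℕ} (K : E n → Matrix (Fin n) (Fin n) ℝ)
    (𝒯 : Finset (Simplex n)) (m : ℕ) (T : Simplex n) (δ x : E n) : ℝ :=
  ∫ y in overlap 𝒯 m T δ, ∑ a, ∑ b,
    gradient (refFunShift 𝒯 m T δ) y a * K (x + y) a b * gradient (refFun 𝒯 m T) y b

/-- `P` is a linear projection of `C⁰(S)` onto the polynomials of degree at most `q` on `S` whose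
norm with respect to the maximum norm on `S` is at most `Λ`. Elements of `C⁰(S)` are represented
by functions on `ℝⁿ`, of which only the values on `S` matter. -/
structure IsPolyProjection {n : ℕ} (S : Set (E n)) (q : ℕ) (Λ : ℝ)
    (P : (E n → ℝ) → E n → ℝ) : Prop where
  map_add : ∀ f g : E n → ℝ, ContinuousOn f S → ContinuousOn g S →
    EqOn (P (f + g)) (P f + P g) S
  map_smul : ∀ (c : ℝ) (f : E n → ℝ), ContinuousOn f S → EqOn (P (c • f)) (c • P f) S
  range_poly : ∀ f : E n → ℝ, ContinuousOn f S → ∃ p : MvPolynomial (Fin n) ℝ,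
    p.totalDegree ≤ q ∧ EqOn (P f) (fun x => MvPolynomial.eval (fun a => x a) p) S
  apply_poly : ∀ p : MvPolynomial (Fin n) ℝ, p.totalDegree ≤ q →
    EqOn (P fun x => MvPolynomial.eval (fun a => x a) p)
      (fun x => MvPolynomial.eval (fun a => x a) p) S
  bound : ∀ (f : E n → ℝ) (B : ℝ), ContinuousOn f S → (∀ x ∈ S, |f x| ≤ B) →
    ∀ x ∈ S, |P f x| ≤ Λ * B

/-- `Π` is an admissible family of stencil projections: `Π T δ` is a projection onto polynomials
of degree at most `q` on the domain of `Φ^δ_T`, with norm at most `Λ`, and the projections for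
opposite directions are related by `(Π^δ_T Φ^δ_T)(x) = (Π^{-δ}_T Φ^{-δ}_T)(x + δ)`. -/
structure IsProjectionFamily {n : ℕ} (K : E n → Matrix (Fin n) (Fin n) ℝ)
    (𝒯 : Finset (Simplex n)) (m q : ℕ) (Λ : ℝ)
    (P : Simplex n → E n → (E n → ℝ) → E n → ℝ) : Prop where
  proj : ∀ T ∈ 𝒯, ∀ δ ∈ directions 𝒯 m T,
    IsPolyProjection (stencilDomain 𝒯 m T δ) q Λ (P T δ)
  related : ∀ T ∈ 𝒯, ∀ δ ∈ directions 𝒯 m T, ∀ x ∈ stencilDomain 𝒯 m T δ,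
    P T δ (stencil K 𝒯 m T δ) x = P T (-δ) (stencil K 𝒯 m T (-δ)) (x + δ)

/-! ### The surrogate stiffness matrix and the surrogate bilinear form -/

open scoped Classical in
/-- The off-diagonal surrogate entries: the true entry if both vertices lie on macro-element
boundaries, `(Π^δ_T Φ^δ_T)(p)` with `δ = q - p` if `δ ∈ 𝒟(T̊_m)` and `p` or `q` lies in `T̊_m`
(at most one `T` qualifies), and zero otherwise. -/
noncomputable def surrogateOffDiag {n : ℕ} (Ω : Set (E n)) (K : E n → Matrix (Fin n) (Fin n) ℝ)
    (𝒯 : Finset (Simplex n)) (m : ℕ) (P : Simplex n → E n → (E n → ℝ) → E n → ℝ)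
    (p q : E n) : ℝ :=
  if p ∈ interfaceVertices 𝒯 m ∧ q ∈ interfaceVertices 𝒯 m then stiffness Ω K 𝒯 m p q
  else ∑ T ∈ 𝒯,
    if q - p ∈ directions 𝒯 m T ∧ (p ∈ interiorLattice T m ∨ q ∈ interiorLattice T m) then
      P T (q - p) (stencil K 𝒯 m T (q - p)) p
    else 0

open scoped Classical in
/-- The surrogate stiffness matrix. Its diagonal is fixed by the zero row sum property of the
extended matrix, whose columns for vertices on `∂Ω` carry the true entries. -/
noncomputable def surrogateStiffness {n : ℕ} (Ω : Set (E n))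
    (K : E n → Matrix (Fin n) (Fin n) ℝ) (𝒯 : Finset (Simplex n)) (m : ℕ)
    (P : Simplex n → E n → (E n → ℝ) → E n → ℝ) (p q : E n) : ℝ :=
  if p = q then
    -((∑ z ∈ (dofs Ω 𝒯 m).erase p, surrogateOffDiag Ω K 𝒯 m P p z) +
      ∑ z ∈ vertices 𝒯 m \ dofs Ω 𝒯 m, stiffness Ω K 𝒯 m p z)
  else surrogateOffDiag Ω K 𝒯 m P p q

/-- The surrogate bilinear form `ã(v, w) = ∑_{i,j} Ã_{ij} v(x_j) w(x_i)` on `V_h`. -/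
noncomputable def surrogateForm {n : ℕ} (Ω : Set (E n)) (K : E n → Matrix (Fin n) (Fin n) ℝ)
    (𝒯 : Finset (Simplex n)) (m : ℕ) (P : Simplex n → E n → (E n → ℝ) → E n → ℝ)
    (v w : E n → ℝ) : ℝ :=
  ∑ p ∈ dofs Ω 𝒯 m, ∑ q ∈ dofs Ω 𝒯 m, surrogateStiffness Ω K 𝒯 m P p q * v q * w p

/-- `K ∈ [W^{k,∞}(𝒯)]^{n × n}`. -/
def MemBrokenSobolev {n : ℕ} (K : E n → Matrix (Fin n) (Fin n) ℝ) (𝒯 : Finset (Simplex n))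
    (k : ℕ) : Prop :=
  ∀ T ∈ 𝒯, ∀ a b : Fin n, MemSobolevInf (openSimplex T) k (fun x => K x a b)

/-- `|K|_{W^{k,∞}(𝒯)}`, the maximum over all macro-elements and all components of `K`. -/
noncomputable def brokenSeminorm {n : ℕ} (K : E n → Matrix (Fin n) (Fin n) ℝ)
    (𝒯 : Finset (Simplex n)) (k : ℕ) : ℝ≥0∞ :=
  ⨆ T ∈ 𝒯, ⨆ (a : Fin n) (b : Fin n), sobolevInfSeminorm (openSimplex T) k (fun x => K x a b)

end Surrogate

/-!
The error matrix `M = A - Ã` has zero row sums and is symmetric (because `K` is symmetric and the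
projections for opposite directions are related), so
`a(v, v) - ã(v, v) = -½ ∑ M_pz (v z - v p)²`, the sum running over the interior vertices.

An entry of `M` is nonzero only if `p` or `z` lies inside a macro-element `T`. There `A_pz` is a
value of the stencil function `Φ`, an average of translates of `K` weighted by gradients of hat
functions. By Taylor's formula for the mollified coefficient, `K` is on the convex set `T` within
`O(H^(r+1) |K|)` of a polynomial of degree `r ≤ q`, so `Φ` is within that distance, times
`|Ω_δ| ‖∇φ‖²_∞`, of a polynomial, and the projection loses only a factor `1 + Λ`.

On the common support of two neighbouring hat functions, of measure `|Ω_δ|`, the directional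
derivative of `v` along `δ = z - p` equals `v z - v p`. Hence `|Ω_δ| (v z - v p)²` is at most `|δ|²`
times the energy of `v` on that support. The factors `‖∇φ‖²_∞ ≲ 4^m / ρ_T²` and
`|δ|² ≲ H_T² / 4^m` cancel up to shape regularity, uniformly in `m`, and the common supports cover
almost every point at most `(n + 1)²` times.

Coercivity follows by absorption: the broken seminorm of `K` is the same for all macro-meshes on
which it is finite, so the error is at most half of the coercivity constant once `H` is small.
-/

namespace Surrogate

/-! ### Hat functions of the Kuhn triangulation -/

/-- The largest difference of two entries of a vector. It is the gauge of the star of `0` in the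
Kuhn triangulation, when the vector lists the cumulative barycentric coordinates of a point. -/
noncomputable def spread {ι : Type*} (z : ι → ℝ) : ℝ := ⨆ ij : ι × ι, (z ij.1 - z ij.2)

section Spread

variable {ι κ : Type*}

lemma spread_le [Nonempty ι] {z : ι → ℝ} {c : ℝ} (h : ∀ i j, z i - z j ≤ c) : spread z ≤ c :=
  ciSup_le fun ij => h ij.1 ij.2

lemma sub_le_spread [Finite ι] (z : ι → ℝ) (i j : ι) : z i - z j ≤ spread z :=
  le_ciSup (f := fun ij : ι × ι => z ij.1 - z ij.2) (Set.finite_range _).bddAbove (i, j)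

lemma abs_sub_le_spread [Finite ι] (z : ι → ℝ) (i j : ι) : |z i - z j| ≤ spread z :=
  abs_sub_le_iff.mpr ⟨sub_le_spread z i j, sub_le_spread z j i⟩

lemma spread_eq_sub_of_forall_le [Finite ι] {z : ι → ℝ} {i j : ι} (hi : ∀ k, z k ≤ z i)
    (hj : ∀ k, z j ≤ z k) : spread z = z i - z j :=
  have : Nonempty ι := ⟨i⟩
  le_antisymm (spread_le fun k l => sub_le_sub (hi k) (hj l)) (sub_le_spread z i j)

lemma spread_neg (z : ι → ℝ) : spread (-z) = spread z :=
  (Equiv.prodComm ι ι).iSup_congr fun ij => (neg_sub_neg (z ij.1) (z ij.2)).symm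

lemma exists_common_argmax [Finite ι] [Nonempty ι] [Finite κ] (z : κ → ι → ℤ)
    (hz : ∀ k l i j, (z k i - z l i) - (z k j - z l j) ≤ 1) : ∃ i, ∀ k j, z k j ≤ z k i := by
  cases nonempty_fintype κ
  obtain ⟨i, hi⟩ := Finite.exists_max fun i => ∑ k, z k i
  refine ⟨i, fun k j => ?_⟩
  by_contra! h
  have : ∑ l, z l i < ∑ l, z l j :=
    Finset.sum_lt_sum (fun l _ => by linarith [hz k l j i]) ⟨k, Finset.mem_univ k, h⟩
  exact (hi j).not_gt this

lemma exists_common_argmin [Finite ι] [Nonempty ι] [Finite κ] (z : κ → ι → ℤ)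
    (hz : ∀ k l i j, (z k i - z l i) - (z k j - z l j) ≤ 1) : ∃ i, ∀ k j, z k i ≤ z k j := by
  obtain ⟨i, hi⟩ := exists_common_argmax (-z) fun k l i j => by
    simp only [Pi.neg_apply]
    linarith [hz l k i j]
  exact ⟨i, fun k j => neg_le_neg_iff.mp (hi k j)⟩

lemma max_zero_one_sub_sum_mul [Fintype κ] {d : κ → ℤ} (hd0 : ∀ k, 0 ≤ d k)
    (hd : ∀ k l, d k - d l ≤ 1) {w : κ → ℝ} (hw : ∀ k, 0 ≤ w k) (hw1 : ∑ k, w k = 1) :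
    max 0 (1 - ∑ k, w k * (d k : ℝ)) = ∑ k, if d k = 0 then w k else 0 := by
  by_cases hex : ∃ k, d k = 0
  · obtain ⟨k₀, hk₀⟩ := hex
    have hsum : ∑ k, (if d k = 0 then w k else 0) = 1 - ∑ k, w k * (d k : ℝ) := by
      rw [← hw1, ← Finset.sum_sub_distrib]
      refine Finset.sum_congr rfl fun k _ => ?_
      obtain h | h : d k = 0 ∨ d k = 1 := by have := hd0 k; have := hd k k₀; omega
      all_goals simp [h]
    rw [← hsum]
    exact max_eq_right (Finset.sum_nonneg fun k _ => by split_ifs; exacts [hw k, le_rfl])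
  · push Not at hex
    have hd1 : ∀ k, (1 : ℝ) ≤ d k := fun k => by
      exact_mod_cast Int.add_one_le_of_lt ((hd0 k).lt_of_ne' (hex k))
    have hsum : 1 ≤ ∑ k, w k * (d k : ℝ) :=
      hw1 ▸ Finset.sum_le_sum fun k _ => le_mul_of_one_le_right (hw k) (hd1 k)
    rw [max_eq_left (by linarith)]
    exact (Finset.sum_eq_zero fun k _ => if_neg (hex k)).symm

lemma max_zero_one_sub_spread_sum [Finite ι] [Fintype κ] (z : κ → ι → ℤ) (i₀ : ι)
    (h0 : ∀ k, z k i₀ = 0) (hz : ∀ k l i j, (z k i - z l i) - (z k j - z l j) ≤ 1)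
    {w : κ → ℝ} (hw : ∀ k, 0 ≤ w k) (hw1 : ∑ k, w k = 1) [∀ k, Decidable (z k = 0)] :
    max 0 (1 - spread fun i => ∑ k, w k * (z k i : ℝ)) = ∑ k, if z k = 0 then w k else 0 := by
  have : Nonempty ι := ⟨i₀⟩
  -- A common argmax `i` and a common argmin `j` make `spread` linear on the hull of the `z k`.
  obtain ⟨i, hi⟩ := exists_common_argmax z hz
  obtain ⟨j, hj⟩ := exists_common_argmin z hz
  have hspread : spread (fun i => ∑ k, w k * (z k i : ℝ)) =
      ∑ k, w k * ((z k i - z k j : ℤ) : ℝ) := by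
    simp_rw [Int.cast_sub, mul_sub, Finset.sum_sub_distrib]
    exact spread_eq_sub_of_forall_le
      (fun l => Finset.sum_le_sum fun k _ =>
        mul_le_mul_of_nonneg_left (Int.cast_le.mpr (hi k l)) (hw k))
      (fun l => Finset.sum_le_sum fun k _ =>
        mul_le_mul_of_nonneg_left (Int.cast_le.mpr (hj k l)) (hw k))
  have hzero : ∀ k, z k i - z k j = 0 ↔ z k = 0 := fun k => by
    refine ⟨fun h => funext fun l => ?_, fun h => by simp [h]⟩
    have := hi k l
    have := hj k l
    have := hi k i₀
    have := hj k i₀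
    have := h0 k
    simp only [Pi.zero_apply]
    omega
  rw [hspread, max_zero_one_sub_sum_mul (fun k => sub_nonneg.mpr (hj k i)) (fun k l => ?_) hw hw1]
  · simp only [hzero]
  · linarith [hz k l i j]

end Spread

section CumulativeCoordinates

variable {n : ℕ} {V : Type*} [AddCommGroup V] [Module ℝ V] (b : AffineBasis (Fin (n + 1)) ℝ V)

lemma linear_coord_sub (k : Fin (n + 1)) (x y : V) :
    (b.coord k).linear (x - y) = b.coord k x - b.coord k y :=
  (b.coord k).linearMap_vsub x y

/-- The linear parts of the cumulative barycentric coordinates `∑_{k ≥ i} λ_k`, scaled so as to be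
integers on differences of points whose barycentric coordinates lie in `2^{-m} ℤ`. -/
noncomputable def cumCoord (m : ℕ) (i : Fin (n + 1)) : V →ₗ[ℝ] ℝ :=
  (2 : ℝ) ^ m • ∑ k with i ≤ k, (b.coord k).linear

lemma cumCoord_sub (m : ℕ) (i : Fin (n + 1)) (x y : V) :
    cumCoord b m i (x - y) = 2 ^ m * ∑ k with i ≤ k, (b.coord k x - b.coord k y) := by
  simp only [cumCoord, LinearMap.smul_apply, LinearMap.sum_apply, smul_eq_mul, linear_coord_sub]

lemma cumCoord_zero (m : ℕ) (u : V) : cumCoord b m 0 u = 0 := by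
  rw [← sub_zero u, cumCoord_sub]
  simp [b.sum_coord_apply_eq_one]

lemma cumCoord_succ (m : ℕ) (i : Fin (n + 1)) (u : V) :
    cumCoord b (m + 1) i u = 2 * cumCoord b m i u := by
  simp only [cumCoord, LinearMap.smul_apply, smul_eq_mul, pow_succ]
  ring

lemma cumCoord_succ_midpoint (m : ℕ) (i : Fin (n + 1)) (x y : V) :
    cumCoord b (m + 1) i (midpoint ℝ x y) = cumCoord b m i x + cumCoord b m i y := by
  rw [cumCoord_succ, midpoint_eq_smul_add, map_smul, map_add, invOf_eq_inv, smul_eq_mul]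
  ring

lemma cumCoord_basis_sub (i k l : Fin (n + 1)) :
    cumCoord b 0 i (b k - b l) = (if i ≤ k then 1 else 0) - if i ≤ l then 1 else 0 := by
  rw [cumCoord_sub]
  simp [AffineBasis.coord_apply, Finset.sum_sub_distrib]

lemma exists_linear_coord_eq_cumCoord_sub (m : ℕ) (k : Fin (n + 1)) :
    ∃ i j, ∀ u, 2 ^ m * (b.coord k).linear u = cumCoord b m i u - cumCoord b m j u := by
  induction k using Fin.lastCases with
  | last =>
    refine ⟨Fin.last n, 0, fun u => ?_⟩
    have hlast : ({j | Fin.last n ≤ j} : Finset (Fin (n + 1))) = {Fin.last n} := by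
      ext j
      simp [Fin.last_le_iff]
    rw [cumCoord_zero]
    simp only [cumCoord, hlast, LinearMap.smul_apply, Finset.sum_singleton, smul_eq_mul, sub_zero]
  | cast k =>
    refine ⟨k.castSucc, k.succ, fun u => ?_⟩
    have hinsert : ({j | k.castSucc ≤ j} : Finset (Fin (n + 1))) =
        insert k.castSucc ({j | k.succ ≤ j} : Finset (Fin (n + 1))) := by
      ext j
      simp only [Finset.mem_filter, Finset.mem_univ, true_and, Finset.mem_insert, Fin.le_def,
        Fin.ext_iff, Fin.val_castSucc, Fin.val_succ]
      omega
    simp only [cumCoord, hinsert]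
    rw [Finset.sum_insert (by simp)]
    simp only [LinearMap.smul_apply, LinearMap.add_apply, smul_eq_mul]
    ring

lemma eq_zero_of_cumCoord_eq_zero {m : ℕ} {u : V} (h : ∀ i, cumCoord b m i u = 0) : u = 0 := by
  refine b.ext_elem fun k => ?_
  obtain ⟨i, j, hij⟩ := exists_linear_coord_eq_cumCoord_sub b m k
  have hlin := hij u
  rw [h, h, sub_self, mul_eq_zero_iff_left (by positivity), ← sub_zero u,
    linear_coord_sub, sub_eq_zero] at hlin
  exact hlin

/-- The hat function, at the lattice point `0`, of the Kuhn triangulation with mesh width `2^{-m}`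
belonging to an ordered affine basis. -/
noncomputable def kuhnHat (m : ℕ) (u : V) : ℝ :=
  max 0 (1 - spread fun i => cumCoord b m i u)

lemma kuhnHat_ne_zero_iff (m : ℕ) (u : V) :
    kuhnHat b m u ≠ 0 ↔ spread (fun i => cumCoord b m i u) < 1 := by
  rw [kuhnHat, Ne, max_eq_left_iff, not_le, sub_pos]

end CumulativeCoordinates

/-! ### Simplices and their lattices -/

section Simplices

variable {n : ℕ}

lemma mem_closedSimplex_iff {t : Simplex n} {x : E n} :
    x ∈ closedSimplex t ↔ ∃ w, IsBarycentric t x w := by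
  have himage : closedSimplex t = Fintype.linearCombination ℝ t '' stdSimplex ℝ (Fin (n + 1)) := by
    rw [← convexHull_rangle_single_eq_stdSimplex, LinearMap.image_convexHull, ← range_comp]
    simp [Function.comp_def, closedSimplex, Fintype.linearCombination_apply_single]
  simp only [himage, mem_image, stdSimplex, mem_ofPred_eq, Fintype.linearCombination_apply,
    IsBarycentric, and_assoc]

lemma exists_affineBasis {t : Simplex n} (ht : AffineIndependent ℝ t) :
    ∃ b : AffineBasis (Fin (n + 1)) ℝ (E n), ⇑b = t :=
  ⟨⟨t, ht, by rw [ht.affineSpan_eq_top_iff_card_eq_finrank_add_one]; simp⟩, rfl⟩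

lemma exists_affineBasis_of_openSimplex_nonempty {t : Simplex n} (ht : (openSimplex t).Nonempty) :
    ∃ b : AffineBasis (Fin (n + 1)) ℝ (E n), ⇑b = t := by
  refine exists_affineBasis ?_
  rw [affineIndependent_iff_le_finrank_vectorSpan ℝ t (n := n) (by simp), ← direction_affineSpan,
    interior_convexHull_nonempty_iff_affineSpan_eq_top.mp ht, AffineSubspace.direction_top,
    finrank_top]
  simp

lemma isCompact_closedSimplex (t : Simplex n) : IsCompact (closedSimplex t) :=
  (finite_range t).isCompact_convexHull ℝ

lemma convex_closedSimplex (t : Simplex n) : Convex ℝ (closedSimplex t) := convex_convexHull ℝ _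

lemma isOpen_openSimplex (t : Simplex n) : IsOpen (openSimplex t) := isOpen_interior

lemma convex_openSimplex (t : Simplex n) : Convex ℝ (openSimplex t) :=
  (convex_closedSimplex t).interior

lemma openSimplex_subset (t : Simplex n) : openSimplex t ⊆ closedSimplex t := interior_subset

lemma volume_closedSimplex_diff_openSimplex (t : Simplex n) :
    volume (closedSimplex t \ openSimplex t) = 0 :=
  measure_mono_null (sdiff_subset_sdiff_left subset_closure)
    ((convex_closedSimplex t).addHaar_frontier volume)

lemma affineMap_sum_smul {κ V W : Type*} [Fintype κ] [AddCommGroup V] [Module ℝ V]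
    [AddCommGroup W] [Module ℝ W] (f : V →ᵃ[ℝ] W) {w : κ → ℝ} (hw : ∑ j, w j = 1) (t : κ → V) :
    f (∑ j, w j • t j) = ∑ j, w j • f (t j) := by
  rw [← Finset.affineCombination_eq_linear_combination _ _ _ hw,
    Finset.map_affineCombination _ _ _ hw, Finset.affineCombination_eq_linear_combination _ _ _ hw]
  rfl

variable (b : AffineBasis (Fin (n + 1)) ℝ (E n))

lemma coord_eq_of_isBarycentric {x : E n} {w : Fin (n + 1) → ℝ} (h : IsBarycentric b x w)
    (k : Fin (n + 1)) : b.coord k x = w k := by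
  obtain ⟨-, h1, rfl⟩ := h
  rw [affineMap_sum_smul _ h1]
  simp [AffineBasis.coord_apply]

lemma mem_closedSimplex_basis_iff {x : E n} : x ∈ closedSimplex b ↔ ∀ k, 0 ≤ b.coord k x := by
  rw [closedSimplex, AffineBasis.convexHull_eq_nonneg_coord, mem_ofPred_eq]

lemma mem_openSimplex_basis_iff {x : E n} : x ∈ openSimplex b ↔ ∀ k, 0 < b.coord k x := by
  rw [openSimplex, closedSimplex, AffineBasis.interior_convexHull, mem_ofPred_eq]

lemma openSimplex_basis_nonempty : (openSimplex b).Nonempty :=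
  ⟨_, b.centroid_mem_interior_convexHull⟩

lemma mem_lattice_iff {m : ℕ} {p : E n} :
    p ∈ lattice b m ↔ ∀ k, ∃ c : ℕ, 2 ^ m * b.coord k p = c := by
  have hpow : (2 : ℝ) ^ m ≠ 0 := by positivity
  simp only [lattice, Finset.mem_image, Finset.mem_piAntidiag]
  constructor
  · rintro ⟨c, ⟨hc, -⟩, rfl⟩ k
    have hw : ∑ k, (c k : ℝ) / 2 ^ m = 1 := by
      rw [← Finset.sum_div, ← Nat.cast_sum, hc, Nat.cast_pow, Nat.cast_ofNat, div_self hpow]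
    refine ⟨c k, ?_⟩
    rw [affineMap_sum_smul _ hw]
    simp [AffineBasis.coord_apply, mul_div_cancel₀ _ hpow]
  · intro h
    choose c hc using h
    refine ⟨c, ⟨?_, fun _ _ => Finset.mem_univ _⟩, ?_⟩
    · have : ∑ k, (c k : ℝ) = 2 ^ m := by
        simp_rw [← hc, ← Finset.mul_sum, b.sum_coord_apply_eq_one, mul_one]
      exact_mod_cast this
    · simp_rw [← hc, mul_div_cancel_left₀ _ hpow, b.linear_combination_coord_eq_self]

lemma mem_closedSimplex_of_mem_lattice {m : ℕ} {p : E n} (hp : p ∈ lattice b m) :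
    p ∈ closedSimplex b := by
  rw [mem_closedSimplex_basis_iff]
  intro k
  obtain ⟨c, hc⟩ := (mem_lattice_iff b).mp hp k
  have : 0 ≤ 2 ^ m * b.coord k p := hc ▸ c.cast_nonneg
  exact nonneg_of_mul_nonneg_right this (by positivity)

lemma mem_interiorLattice_iff {m : ℕ} {y : Simplex n} {p : E n} :
    p ∈ interiorLattice y m ↔ p ∈ lattice y m ∧ p ∈ openSimplex y := by
  simp [interiorLattice]

lemma basis_mem_lattice_zero (k : Fin (n + 1)) : b k ∈ lattice b 0 :=
  (mem_lattice_iff b).mpr fun j => ⟨if j = k then 1 else 0, by simp [AffineBasis.coord_apply]⟩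

lemma midpoint_mem_lattice {m : ℕ} {p q : E n} (hp : p ∈ lattice b m) (hq : q ∈ lattice b m) :
    midpoint ℝ p q ∈ lattice b (m + 1) := by
  rw [mem_lattice_iff] at *
  intro k
  obtain ⟨c, hc⟩ := hp k
  obtain ⟨d, hd⟩ := hq k
  refine ⟨c + d, ?_⟩
  rw [AffineMap.map_midpoint, midpoint_eq_smul_add, invOf_eq_inv, smul_eq_mul, Nat.cast_add,
    ← hc, ← hd]
  ring

lemma exists_int_cumCoord_sub {m : ℕ} {p q : E n} (hp : p ∈ lattice b m) (hq : q ∈ lattice b m)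
    (i : Fin (n + 1)) : ∃ c : ℤ, cumCoord b m i (p - q) = c := by
  choose c hc using (mem_lattice_iff b).mp hp
  choose d hd using (mem_lattice_iff b).mp hq
  refine ⟨∑ k with i ≤ k, ((c k : ℤ) - d k), ?_⟩
  rw [cumCoord_sub, Finset.mul_sum]
  push_cast
  exact Finset.sum_congr rfl fun k _ => by rw [← hc, ← hd]; ring

end Simplices

/-! ### Uniform refinement -/

section Refinement

variable {n : ℕ}

lemma mem_subdivide_iff {y t : Simplex n} :
    t ∈ subdivide y ↔ ∃ c ∈ children n, t = fun k => midpoint ℝ (y (c k).1) (y (c k).2) := by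
  simp only [subdivide, List.mem_toFinset, List.mem_map, eq_comm]

lemma mem_iterSubdivide_succ {y t : Simplex n} {m : ℕ} :
    t ∈ iterSubdivide y (m + 1) ↔ ∃ s ∈ iterSubdivide y m, t ∈ subdivide s := by
  simp [iterSubdivide]

/-- The column `k` of `L` stands for the cumulative coordinates of the vertex `k` of a simplex.
In a Kuhn family the difference of any two columns has spread at most one: in the gauge `spread`,
the simplex lies in the star of each of its vertices. -/
def IsKuhnFamily (L : Fin (n + 1) → Fin (n + 1) → ℝ) : Prop :=
  ∀ k l i j, (L i k - L i l) - (L j k - L j l) ≤ 1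

/-- The rows of `L` are increasing, by at most one altogether: the vertices are listed along a
monotone path through a unit cube, as in Kuhn's subdivision of the cube. -/
def IsKuhnChain (L : Fin (n + 1) → Fin (n + 1) → ℝ) : Prop :=
  ∀ i, Monotone (L i) ∧ L i (Fin.last n) ≤ L i 0 + 1

lemma IsKuhnChain.isKuhnFamily {L : Fin (n + 1) → Fin (n + 1) → ℝ} (h : IsKuhnChain L) :
    IsKuhnFamily L := by
  intro k l i j
  wlog hkl : k ≤ l generalizing k l i j
  · linarith [this l k j i (le_of_not_ge hkl)]
  linarith [(h i).1 hkl, (h j).1 (Fin.zero_le k), (h j).1 (Fin.le_last l), (h j).2]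

lemma isKuhnChain_fin_four_iff {L : Fin 4 → Fin 4 → ℝ} :
    IsKuhnChain (n := 3) L ↔
      ∀ i, L i 0 ≤ L i 1 ∧ L i 1 ≤ L i 2 ∧ L i 2 ≤ L i 3 ∧ L i 3 ≤ L i 0 + 1 := by
  simp only [IsKuhnChain, Fin.monotone_iff_le_succ, Fin.forall_fin_succ]
  simp [Fin.last, and_assoc]

lemma IsKuhnFamily.children_one {L : Fin 2 → Fin 2 → ℝ} (h : IsKuhnFamily (n := 1) L)
    {c : Fin 2 → Fin 2 × Fin 2} (hc : c ∈ children 1) :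
    IsKuhnFamily (n := 1) fun i k => L i (c k).1 + L i (c k).2 := by
  intro k l i j
  have h01 := h 0 1 i j
  have h10 := h 1 0 i j
  simp only [children, List.mem_cons, List.not_mem_nil, or_false] at hc
  rcases hc with rfl | rfl <;> fin_cases k <;> fin_cases l <;> simp <;> linarith

lemma IsKuhnFamily.children_two {L : Fin 3 → Fin 3 → ℝ} (h : IsKuhnFamily (n := 2) L)
    {c : Fin 3 → Fin 3 × Fin 3} (hc : c ∈ children 2) :
    IsKuhnFamily (n := 2) fun i k => L i (c k).1 + L i (c k).2 := by
  intro k l i j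
  have h01 := h 0 1 i j
  have h10 := h 1 0 i j
  have h02 := h 0 2 i j
  have h20 := h 2 0 i j
  have h12 := h 1 2 i j
  have h21 := h 2 1 i j
  simp only [children, List.mem_cons, List.not_mem_nil, or_false] at hc
  rcases hc with rfl | rfl | rfl | rfl <;> fin_cases k <;> fin_cases l <;> simp <;> linarith

lemma IsKuhnChain.children_three {L : Fin 4 → Fin 4 → ℝ} (h : IsKuhnChain (n := 3) L)
    {c : Fin 4 → Fin 4 × Fin 4} (hc : c ∈ children 3) :
    IsKuhnChain (n := 3) fun i k => L i (c k).1 + L i (c k).2 := by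
  rw [isKuhnChain_fin_four_iff] at *
  intro i
  obtain ⟨h01, h12, h23, h30⟩ := h i
  simp only [children, List.mem_cons, List.not_mem_nil, or_false] at hc
  rcases hc with rfl | rfl | rfl | rfl | rfl | rfl | rfl | rfl <;> simp <;> grind

variable (b : AffineBasis (Fin (n + 1)) ℝ (E n))

lemma isKuhnChain_basis : IsKuhnChain fun i k => cumCoord b 0 i (b k) := by
  intro i
  constructor
  · intro k l hkl
    rw [← sub_nonneg, ← map_sub, cumCoord_basis_sub]
    split_ifs <;> grind
  · rw [← sub_le_iff_le_add', ← map_sub, cumCoord_basis_sub]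
    split_ifs <;> norm_num

variable {b}

lemma mem_lattice_of_mem_iterSubdivide {m : ℕ} {t : Simplex n} (ht : t ∈ iterSubdivide b m)
    (k : Fin (n + 1)) : t k ∈ lattice b m := by
  induction m generalizing t k with
  | zero =>
    rw [Finset.mem_singleton.mp ht]
    exact basis_mem_lattice_zero b k
  | succ m ih =>
    obtain ⟨s, hs, hts⟩ := mem_iterSubdivide_succ.mp ht
    obtain ⟨c, -, rfl⟩ := mem_subdivide_iff.mp hts
    exact midpoint_mem_lattice b (ih hs _) (ih hs _)

lemma cumCoord_vertices_induction {motive : (Fin (n + 1) → Fin (n + 1) → ℝ) → Prop}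
    (basis : motive fun i k => cumCoord b 0 i (b k))
    (child : ∀ L, motive L → ∀ c ∈ children n, motive fun i k => L i (c k).1 + L i (c k).2)
    {m : ℕ} {t : Simplex n} (ht : t ∈ iterSubdivide b m) :
    motive fun i k => cumCoord b m i (t k) := by
  induction m generalizing t with
  | zero =>
    rw [Finset.mem_singleton.mp ht]
    exact basis
  | succ m ih =>
    obtain ⟨s, hs, hts⟩ := mem_iterSubdivide_succ.mp ht
    obtain ⟨c, hc, rfl⟩ := mem_subdivide_iff.mp hts
    simp_rw [cumCoord_succ_midpoint]
    exact child _ (ih hs) c hc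

/-- In three dimensions the inductive step needs the order of the vertices that Bey's subdivision
maintains; the middle triangle of the subdivision of a triangle does not maintain it. -/
lemma isKuhnFamily_of_mem_iterSubdivide (hn : n = 1 ∨ n = 2 ∨ n = 3) {m : ℕ} {t : Simplex n}
    (ht : t ∈ iterSubdivide b m) : IsKuhnFamily fun i k => cumCoord b m i (t k) := by
  have hb := isKuhnChain_basis b
  rcases hn with rfl | rfl | rfl
  · exact cumCoord_vertices_induction hb.isKuhnFamily (fun _ h _ hc => h.children_one hc) ht
  · exact cumCoord_vertices_induction hb.isKuhnFamily (fun _ h _ hc => h.children_two hc) ht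
  · exact (cumCoord_vertices_induction hb (fun _ h _ hc => h.children_three hc) ht).isKuhnFamily

lemma sum_weights_eq_kuhnHat_of_isKuhnFamily {m : ℕ} {t : Simplex n} {p : E n}
    (hint : ∀ k i, ∃ c : ℤ, cumCoord b m i (t k - p) = c)
    (hfam : IsKuhnFamily fun i k => cumCoord b m i (t k)) {x : E n} {w : Fin (n + 1) → ℝ}
    (hw : IsBarycentric t x w) [∀ k, Decidable (t k = p)] :
    ∑ k with t k = p, w k = kuhnHat b m (x - p) := by
  classical
  choose z hz using hint
  obtain ⟨hw0, hw1, rfl⟩ := hw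
  have hcum : (fun i => cumCoord b m i (∑ k, w k • t k - p)) =
      fun i => ∑ k, w k * (z k i : ℝ) := by
    ext i
    simp_rw [← hz, map_sub, mul_sub, Finset.sum_sub_distrib, ← Finset.sum_mul, hw1, one_mul,
      map_sum, map_smul, smul_eq_mul]
  have hz0 : ∀ k, z k 0 = 0 := fun k => by exact_mod_cast (hz k 0).symm.trans (cumCoord_zero b m _)
  have hzfam : ∀ k l i j, (z k i - z l i) - (z k j - z l j) ≤ 1 := fun k l i j => by
    have := hfam k l i j
    simp only [map_sub, sub_eq_iff_eq_add] at hz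
    simp only [hz] at this
    have : ((z k i : ℝ) - z l i) - (z k j - z l j) ≤ 1 := by linarith
    exact_mod_cast this
  have hvertex : ∀ k, z k = 0 ↔ t k = p := fun k => by
    rw [← sub_eq_zero (a := t k)]
    constructor
    · intro h
      exact eq_zero_of_cumCoord_eq_zero b (m := m) fun i => by simp [hz, h]
    · intro h
      refine funext fun i => Int.cast_injective (α := ℝ) ?_
      rw [← hz, h, map_zero, Pi.zero_apply, Int.cast_zero]
  rw [kuhnHat, hcum, max_zero_one_sub_spread_sum z 0 hz0 hzfam hw0 hw1, Finset.sum_filter]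
  simp only [hvertex]

lemma sum_weights_eq_kuhnHat (hn : n = 1 ∨ n = 2 ∨ n = 3) {m : ℕ} {t : Simplex n}
    (ht : t ∈ iterSubdivide b m) {x : E n} {w : Fin (n + 1) → ℝ} (hw : IsBarycentric t x w)
    {p : E n} (hp : p ∈ lattice b m) [∀ k, Decidable (t k = p)] :
    ∑ k with t k = p, w k = kuhnHat b m (x - p) :=
  sum_weights_eq_kuhnHat_of_isKuhnFamily
    (fun k => exists_int_cumCoord_sub b (mem_lattice_of_mem_iterSubdivide ht k) hp)
    (isKuhnFamily_of_mem_iterSubdivide hn ht) hw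

/-- `w'` are barycentric coordinates, with respect to the child `c`, of the point with barycentric
coordinates `w`. -/
def IsChildWeights (c : Fin (n + 1) → Fin (n + 1) × Fin (n + 1)) (w w' : Fin (n + 1) → ℝ) : Prop :=
  (∀ k, 0 ≤ w' k) ∧ ∑ k, w' k = 1 ∧
    ∀ j, w j = ∑ k, w' k * ((if (c k).1 = j then 1 / 2 else 0) + if (c k).2 = j then 1 / 2 else 0)

lemma isChildWeights_corner {w : Fin (n + 1) → ℝ} (h0 : ∀ k, 0 ≤ w k) (h1 : ∑ k, w k = 1)
    {i : Fin (n + 1)} (hi : 1 / 2 ≤ w i) :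
    IsChildWeights (fun k => (min i k, max i k)) w fun k => 2 * w k - if k = i then 1 else 0 := by
  have hsum : ∑ k, (2 * w k - if k = i then 1 else 0) = 1 := by
    simp only [Finset.sum_sub_distrib, ← Finset.mul_sum, h1, Finset.sum_ite_eq', Finset.mem_univ,
      if_true]
    norm_num
  have hpair : ∀ j k : Fin (n + 1), ((if min i k = j then (1 / 2 : ℝ) else 0) +
      if max i k = j then 1 / 2 else 0) =
        (if i = j then 1 / 2 else 0) + if k = j then 1 / 2 else 0 := fun j k => by
      rcases le_total i k with h | h
      · simp only [min_eq_left h, max_eq_right h]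
      · simp only [min_eq_right h, max_eq_left h, add_comm]
  refine ⟨fun k => ?_, hsum, fun j => ?_⟩
  · beta_reduce
    split_ifs with h
    · subst h; linarith
    · linarith [h0 k]
  · simp_rw [hpair, mul_add, Finset.sum_add_distrib, ← Finset.sum_mul, hsum, mul_ite, mul_zero,
      Finset.sum_ite_eq', Finset.mem_univ, if_true, eq_comm (a := i)]
    split_ifs <;> ring

lemma corner_mem_children (hn : n = 1 ∨ n = 2 ∨ n = 3) (i : Fin (n + 1)) :
    (fun k => (min i k, max i k)) ∈ children n := by
  rcases hn with rfl | rfl | rfl <;> revert i <;> decide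

lemma exists_isChildWeights_one {w : Fin 2 → ℝ} (h1 : ∑ k, w k = 1) (hw : ∀ k, w k < 1 / 2) :
    ∃ c ∈ children 1, ∃ w', IsChildWeights (n := 1) c w w' := by
  rw [Fin.sum_univ_two] at h1
  linarith [hw 0, hw 1]

lemma exists_isChildWeights_two {w : Fin 3 → ℝ} (h1 : ∑ k, w k = 1) (hw : ∀ k, w k < 1 / 2) :
    ∃ c ∈ children 2, ∃ w', IsChildWeights (n := 2) c w w' := by
  rw [Fin.sum_univ_three] at h1
  have hw0 := hw 0
  have hw1 := hw 1
  have hw2 := hw 2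
  refine ⟨![(0, 1), (1, 2), (0, 2)], by simp [children],
    ![1 - 2 * w 2, 1 - 2 * w 0, 1 - 2 * w 1], ?_, ?_, ?_⟩
  · intro k; fin_cases k <;> simp <;> linarith
  · simp [Fin.sum_univ_three]; linarith
  · intro j; fin_cases j <;> simp [Fin.sum_univ_three] <;> linarith

lemma exists_isChildWeights_three {w : Fin 4 → ℝ} (h0 : ∀ k, 0 ≤ w k) (h1 : ∑ k, w k = 1)
    (hw : ∀ k, w k < 1 / 2) : ∃ c ∈ children 3, ∃ w', IsChildWeights (n := 3) c w w' := by
  rw [Fin.sum_univ_four] at h1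
  have h00 := h0 0
  have h01 := h0 1
  have h02 := h0 2
  have h03 := h0 3
  have hw0 := hw 0
  have hw1 := hw 1
  have hw2 := hw 2
  have hw3 := hw 3
  -- Bey cuts the inner octahedron along the diagonal joining the midpoints of `02` and `13`.
  obtain ⟨c, hc, w', h⟩ : ∃ c ∈ children 3, ∃ w' : Fin 4 → ℝ, (∀ k, 0 ≤ w' k) ∧
      w' 0 + w' 1 + w' 2 + w' 3 = 1 ∧ ∀ j, w j = ∑ k, w' k *
        ((if (c k).1 = j then 1 / 2 else 0) + if (c k).2 = j then 1 / 2 else 0) := by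
    rcases le_total (1 / 2) (w 0 + w 1) with h01 | h23 <;>
      rcases le_total (1 / 2) (w 1 + w 2) with h12 | h30
    · refine ⟨![(0, 1), (0, 2), (1, 2), (1, 3)], by simp [children],
        ![2 * w 0 + 2 * w 1 - 1, 1 - 2 * w 1, 2 * w 1 + 2 * w 2 - 1, 2 * w 3], ?_⟩
      simp [Fin.forall_fin_succ, Fin.sum_univ_four]
      grind
    · refine ⟨![(0, 1), (0, 2), (0, 3), (1, 3)], by simp [children],
        ![2 * w 0 + 2 * w 1 - 1, 2 * w 2, 2 * w 3 + 2 * w 0 - 1, 1 - 2 * w 0], ?_⟩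
      simp [Fin.forall_fin_succ, Fin.sum_univ_four]
      grind
    · refine ⟨![(0, 2), (1, 2), (1, 3), (2, 3)], by simp [children],
        ![2 * w 0, 2 * w 1 + 2 * w 2 - 1, 1 - 2 * w 2, 2 * w 2 + 2 * w 3 - 1], ?_⟩
      simp [Fin.forall_fin_succ, Fin.sum_univ_four]
      grind
    · refine ⟨![(0, 2), (0, 3), (1, 3), (2, 3)], by simp [children],
        ![1 - 2 * w 3, 2 * w 0 + 2 * w 3 - 1, 2 * w 1, 2 * w 2 + 2 * w 3 - 1], ?_⟩
      simp [Fin.forall_fin_succ, Fin.sum_univ_four]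
      grind
  exact ⟨c, hc, w', h.1, by rw [Fin.sum_univ_four, h.2.1], h.2.2⟩

lemma exists_isChildWeights (hn : n = 1 ∨ n = 2 ∨ n = 3) {w : Fin (n + 1) → ℝ}
    (h0 : ∀ k, 0 ≤ w k) (h1 : ∑ k, w k = 1) : ∃ c ∈ children n, ∃ w', IsChildWeights c w w' := by
  by_cases hw : ∃ i, 1 / 2 ≤ w i
  · obtain ⟨i, hi⟩ := hw
    exact ⟨_, corner_mem_children hn i, _, isChildWeights_corner h0 h1 hi⟩
  · push Not at hw
    rcases hn with rfl | rfl | rfl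
    exacts [exists_isChildWeights_one h1 hw, exists_isChildWeights_two h1 hw,
      exists_isChildWeights_three h0 h1 hw]

lemma IsChildWeights.isBarycentric {y : Simplex n} {x : E n} {w w' : Fin (n + 1) → ℝ}
    {c : Fin (n + 1) → Fin (n + 1) × Fin (n + 1)} (h : IsChildWeights c w w')
    (hx : ∑ k, w k • y k = x) :
    IsBarycentric (fun k => midpoint ℝ (y (c k).1) (y (c k).2)) x w' := by
  refine ⟨h.1, h.2.1, ?_⟩
  simp_rw [← hx, h.2.2, Finset.sum_smul]
  rw [Finset.sum_comm]
  refine Finset.sum_congr rfl fun k _ => ?_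
  simp_rw [mul_smul, ← Finset.smul_sum, add_smul, Finset.sum_add_distrib, ite_smul, zero_smul,
    Finset.sum_ite_eq, Finset.mem_univ, if_true]
  rw [midpoint_eq_smul_add, invOf_eq_inv, smul_add, one_div]

lemma exists_mem_iterSubdivide (hn : n = 1 ∨ n = 2 ∨ n = 3) (m : ℕ) {y : Simplex n} {x : E n}
    (hx : x ∈ closedSimplex y) : ∃ t ∈ iterSubdivide y m, ∃ w, IsBarycentric t x w := by
  induction m with
  | zero => exact ⟨y, by simp [iterSubdivide], mem_closedSimplex_iff.mp hx⟩
  | succ m ih =>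
    obtain ⟨t, ht, w, hw0, hw1, hwx⟩ := ih
    obtain ⟨c, hc, w', hw'⟩ := exists_isChildWeights hn hw0 hw1
    exact ⟨_, mem_iterSubdivide_succ.mpr ⟨t, ht, mem_subdivide_iff.mpr ⟨c, hc, rfl⟩⟩, w',
      hw'.isBarycentric hwx⟩

end Refinement

section Gradient

variable {F : Type*} [NormedAddCommGroup F] [InnerProductSpace ℝ F] [CompleteSpace F]

lemma gradient_eq_zero_of_nonneg_of_eq_zero {f : F → ℝ} (hf : ∀ x, 0 ≤ f x) {x : F}
    (hx : f x = 0) : gradient f x = 0 := by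
  have : IsLocalMin f x := Filter.Eventually.of_forall fun y => hx.trans_le (hf y)
  rw [gradient, this.fderiv_eq_zero, map_zero]

lemma gradient_comp_sub_right (f : F → ℝ) (a x : F) :
    gradient (fun y => f (y - a)) x = gradient f (x - a) := by
  rw [gradient, gradient, fderiv_comp_sub]

lemma norm_gradient_le_of_lipschitzWith {f : F → ℝ} {C : NNReal} (hf : LipschitzWith C f) (x : F) :
    ‖gradient f x‖ ≤ C := by
  rw [gradient, LinearIsometryEquiv.norm_map]
  exact norm_fderiv_le_of_lipschitz ℝ hf

end Gradient

/-! ### Hat functions on a simplex -/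

section KuhnHat

variable {n m : ℕ} {b : AffineBasis (Fin (n + 1)) ℝ (E n)}

lemma kuhnHat_neg (u : E n) : kuhnHat b m (-u) = kuhnHat b m u := by
  simp only [kuhnHat, map_neg]
  rw [← spread_neg (fun i => cumCoord b m i u)]
  rfl

lemma two_pow_mul_abs_linear_coord_le (k : Fin (n + 1)) (u : E n) :
    2 ^ m * |(b.coord k).linear u| ≤ spread fun i => cumCoord b m i u := by
  obtain ⟨i, j, hij⟩ := exists_linear_coord_eq_cumCoord_sub b m k
  rw [← abs_of_pos (by positivity : (0 : ℝ) < 2 ^ m), ← abs_mul, hij]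
  exact abs_sub_le_spread (fun i => cumCoord b m i u) i j

lemma abs_cumCoord_sub_le (i : Fin (n + 1)) {x y : E n} (hx : x ∈ closedSimplex b)
    (hy : y ∈ closedSimplex b) : |cumCoord b m i (x - y)| ≤ 2 ^ m := by
  have hmem : ∀ z ∈ closedSimplex b, ∑ k with i ≤ k, b.coord k z ∈ Icc 0 1 := by
    intro z hz
    rw [mem_closedSimplex_basis_iff] at hz
    refine ⟨Finset.sum_nonneg fun k _ => hz k, ?_⟩
    rw [← b.sum_coord_apply_eq_one z]
    exact Finset.sum_le_sum_of_subset_of_nonneg (Finset.filter_subset _ _) fun k _ _ => hz k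
  rw [cumCoord_sub, Finset.sum_sub_distrib, abs_mul, abs_of_pos (by positivity : (0 : ℝ) < 2 ^ m)]
  refine mul_le_of_le_one_right (by positivity) (abs_sub_le_iff.mpr ⟨?_, ?_⟩)
  · linarith [(hmem x hx).2, (hmem y hy).1]
  · linarith [(hmem y hy).2, (hmem x hx).1]

lemma cumCoord_sub_cumCoord_le {c : E n} {ρ : ℝ} (hρ : 0 < ρ)
    (hball : Metric.ball c (ρ / 2) ⊆ closedSimplex b) (i j : Fin (n + 1)) (u : E n) :
    cumCoord b m i u - cumCoord b m j u ≤ 8 * 2 ^ m / ρ * ‖u‖ := by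
  have hbound : ∀ z ∈ Metric.closedBall (0 : E n) (ρ / 4),
      ‖(cumCoord b m i - cumCoord b m j) z‖ ≤ 2 * 2 ^ m := by
    intro z hz
    rw [mem_closedBall_zero_iff] at hz
    have hcz : c + z ∈ closedSimplex b := hball (by simp; linarith)
    have hc : c ∈ closedSimplex b := hball (by simp; linarith)
    have hi := abs_cumCoord_sub_le (m := m) i hcz hc
    have hj := abs_cumCoord_sub_le (m := m) j hcz hc
    rw [add_sub_cancel_left] at hi hj
    rw [LinearMap.sub_apply, Real.norm_eq_abs]
    exact (abs_sub _ _).trans (by linarith)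
  have h := LinearMap.bound_of_ball_bound' (𝕜 := ℝ) (by positivity) _ _ hbound u
  rw [LinearMap.sub_apply, Real.norm_eq_abs] at h
  refine (le_abs_self _).trans (h.trans_eq ?_)
  field_simp
  ring

lemma spread_cumCoord_le_add {c : E n} {ρ : ℝ} (hρ : 0 < ρ)
    (hball : Metric.ball c (ρ / 2) ⊆ closedSimplex b) (u v : E n) :
    spread (fun i => cumCoord b m i u) ≤
      spread (fun i => cumCoord b m i v) + 8 * 2 ^ m / ρ * ‖u - v‖ := by
  refine spread_le fun i j => ?_
  have h := cumCoord_sub_cumCoord_le (m := m) hρ hball i j (u - v)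
  simp only [map_sub] at h
  linarith [sub_le_spread (fun i => cumCoord b m i v) i j]

lemma lipschitzWith_kuhnHat {c : E n} {ρ : ℝ} (hρ : 0 < ρ)
    (hball : Metric.ball c (ρ / 2) ⊆ closedSimplex b) :
    LipschitzWith (8 * 2 ^ m / ρ).toNNReal (kuhnHat b m) := by
  refine LipschitzWith.of_dist_le_mul fun u v => ?_
  rw [Real.dist_eq, dist_eq_norm, Real.coe_toNNReal _ (by positivity), kuhnHat, kuhnHat, max_comm 0,
    max_comm 0]
  refine (abs_max_sub_max_le_abs _ _ _).trans (abs_sub_le_iff.mpr ⟨?_, ?_⟩)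
  · rw [norm_sub_rev]
    linarith [spread_cumCoord_le_add (m := m) hρ hball v u]
  · linarith [spread_cumCoord_le_add (m := m) hρ hball u v]

lemma norm_gradient_kuhnHat_le {c : E n} {ρ : ℝ} (hρ : 0 < ρ)
    (hball : Metric.ball c (ρ / 2) ⊆ closedSimplex b) (u : E n) :
    ‖gradient (kuhnHat b m) u‖ ≤ 8 * 2 ^ m / ρ := by
  have h := norm_gradient_le_of_lipschitzWith (lipschitzWith_kuhnHat (m := m) hρ hball) u
  rwa [Real.coe_toNNReal _ (by positivity)] at h

lemma continuous_kuhnHat : Continuous (kuhnHat b m) := by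
  obtain ⟨c, hc⟩ := openSimplex_basis_nonempty b
  obtain ⟨r, hr, hball⟩ := Metric.isOpen_iff.mp (isOpen_openSimplex b) c hc
  refine (lipschitzWith_kuhnHat (c := c) (ρ := 2 * r) (by positivity) ?_).continuous
  rw [mul_div_cancel_left₀ _ two_ne_zero]
  exact hball.trans (openSimplex_subset b)

lemma eq_sum_linear_coord_smul_sub (δ : E n) :
    δ = ∑ k, (b.coord k).linear δ • (b k - b 0) := by
  have hlin : ∀ k, (b.coord k).linear δ = b.coord k δ - b.coord k 0 := fun k => by
    rw [← linear_coord_sub, sub_zero]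
  simp_rw [smul_sub, Finset.sum_sub_distrib, ← Finset.sum_smul, hlin, sub_smul,
    Finset.sum_sub_distrib, b.linear_combination_coord_eq_self, b.sum_coord_apply_eq_one]
  simp

lemma norm_le_of_spread_le_one {δ : E n} (h : spread (fun i => cumCoord b m i δ) ≤ 1) :
    ‖δ‖ ≤ (n + 1) * Metric.diam (closedSimplex b) / 2 ^ m := by
  have hterm : ∀ k, ‖(b.coord k).linear δ • (b k - b 0)‖ ≤
      Metric.diam (closedSimplex b) / 2 ^ m := by
    intro k
    have hcoord : |(b.coord k).linear δ| ≤ 1 / 2 ^ m := by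
      rw [le_div_iff₀' (by positivity)]
      exact (two_pow_mul_abs_linear_coord_le k δ).trans h
    have hedge : ‖b k - b 0‖ ≤ Metric.diam (closedSimplex b) := by
      rw [← dist_eq_norm]
      exact Metric.dist_le_diam_of_mem (isCompact_closedSimplex b).isBounded
        (subset_convexHull ℝ _ (mem_range_self k)) (subset_convexHull ℝ _ (mem_range_self 0))
    rw [norm_smul, Real.norm_eq_abs, div_eq_mul_one_div, mul_comm]
    exact mul_le_mul hedge hcoord (abs_nonneg _) Metric.diam_nonneg
  calc ‖δ‖ = ‖∑ k, (b.coord k).linear δ • (b k - b 0)‖ := by rw [← eq_sum_linear_coord_smul_sub]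
    _ ≤ ∑ _k : Fin (n + 1), Metric.diam (closedSimplex b) / 2 ^ m :=
      norm_sum_le_of_le _ fun k _ => hterm k
    _ = (n + 1) * Metric.diam (closedSimplex b) / 2 ^ m := by simp [mul_div_assoc]

lemma kuhnHat_half_smul_ne_zero {δ : E n} (h : spread (fun i => cumCoord b m i δ) ≤ 1) :
    kuhnHat b m ((1 / 2 : ℝ) • δ) ≠ 0 := by
  rw [kuhnHat_ne_zero_iff]
  refine (spread_le (c := 1 / 2) fun i j => ?_).trans_lt (by norm_num)
  simp only [map_smul, smul_eq_mul]
  linarith [sub_le_spread (fun i => cumCoord b m i δ) i j]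

lemma spread_cumCoord_sub_le_one {p q x : E n} (hpq : ∀ i, ∃ z : ℤ, cumCoord b m i (q - p) = z)
    (hp : kuhnHat b m (x - p) ≠ 0) (hq : kuhnHat b m (x - q) ≠ 0) :
    spread (fun i => cumCoord b m i (q - p)) ≤ 1 := by
  rw [kuhnHat_ne_zero_iff] at hp hq
  refine spread_le fun i j => ?_
  obtain ⟨zi, hzi⟩ := hpq i
  obtain ⟨zj, hzj⟩ := hpq j
  have hlt : cumCoord b m i (q - p) - cumCoord b m j (q - p) < 2 := by
    have hpij := sub_le_spread (fun i => cumCoord b m i (x - p)) i j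
    have hqji := sub_le_spread (fun i => cumCoord b m i (x - q)) j i
    simp only [map_sub] at hpij hqji hp hq ⊢
    linarith
  rw [hzi, hzj] at hlt ⊢
  have : zi - zj < 2 := by exact_mod_cast hlt
  exact_mod_cast Int.lt_add_one_iff.mp this

lemma exists_pos_nat_of_mem_interiorLattice {p : E n} (hp : p ∈ interiorLattice b m)
    (k : Fin (n + 1)) : ∃ c : ℕ, 1 ≤ c ∧ 2 ^ m * b.coord k p = c := by
  rw [mem_interiorLattice_iff, mem_lattice_iff, mem_openSimplex_basis_iff] at hp
  obtain ⟨c, hc⟩ := hp.1 k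
  have : 0 < 2 ^ m * b.coord k p := mul_pos (by positivity) (hp.2 k)
  rw [hc] at this
  exact ⟨c, by exact_mod_cast this, hc⟩

lemma mem_openSimplex_of_kuhnHat_ne_zero {p x : E n} (hp : p ∈ interiorLattice b m)
    (hx : kuhnHat b m (x - p) ≠ 0) : x ∈ openSimplex b := by
  rw [mem_openSimplex_basis_iff]
  intro k
  obtain ⟨c, hc, hpc⟩ := exists_pos_nat_of_mem_interiorLattice hp k
  have hlt := (two_pow_mul_abs_linear_coord_le k (x - p)).trans_lt
    ((kuhnHat_ne_zero_iff b m _).mp hx)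
  rw [linear_coord_sub, ← abs_of_pos (by positivity : (0 : ℝ) < 2 ^ m), ← abs_mul, mul_sub, hpc,
    abs_lt] at hlt
  have : 0 < 2 ^ m * b.coord k x := by linarith [(Nat.one_le_cast (α := ℝ)).mpr hc]
  exact pos_of_mul_pos_right this (by positivity)

lemma add_mem_lattice {p δ : E n} (hp : p ∈ interiorLattice b m)
    (hδ : ∀ i, ∃ z : ℤ, cumCoord b m i δ = z) (h : spread (fun i => cumCoord b m i δ) ≤ 1) :
    p + δ ∈ lattice b m := by
  rw [mem_lattice_iff]
  intro k
  obtain ⟨c, hc, hpc⟩ := exists_pos_nat_of_mem_interiorLattice hp k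
  obtain ⟨i, j, hij⟩ := exists_linear_coord_eq_cumCoord_sub b m k
  obtain ⟨zi, hzi⟩ := hδ i
  obtain ⟨zj, hzj⟩ := hδ j
  have hz : zj - zi ≤ 1 := by
    have := (sub_le_spread (fun i => cumCoord b m i δ) j i).trans h
    simp only [hzi, hzj] at this
    exact_mod_cast this
  have hcoord : 2 ^ m * b.coord k (p + δ) = ((c + (zi - zj) : ℤ) : ℝ) := by
    have hδk := hij δ
    rw [← add_sub_cancel_left p δ, linear_coord_sub, add_sub_cancel_left, mul_sub, hpc, hzi,
      hzj] at hδk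
    push_cast
    linarith
  refine ⟨(c + (zi - zj)).toNat, ?_⟩
  rw [hcoord, ← Int.cast_natCast (Int.toNat _), Int.toNat_of_nonneg (by omega)]

lemma closedSimplex_subset_of_mem_iterSubdivide {t : Simplex n} (ht : t ∈ iterSubdivide b m) :
    closedSimplex t ⊆ closedSimplex b := by
  refine convexHull_min ?_ (convex_closedSimplex _)
  rintro _ ⟨k, rfl⟩
  exact mem_closedSimplex_of_mem_lattice b (mem_lattice_of_mem_iterSubdivide ht k)

lemma openSimplex_subset_of_mem_iterSubdivide {t : Simplex n} (ht : t ∈ iterSubdivide b m) :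
    openSimplex t ⊆ openSimplex b :=
  interior_mono (closedSimplex_subset_of_mem_iterSubdivide ht)

lemma closedSimplex_subset_closure_openSimplex : closedSimplex b ⊆ closure (openSimplex b) := by
  rw [openSimplex, (convex_closedSimplex b).closure_interior_eq_closure_of_nonempty_interior
    (openSimplex_basis_nonempty b)]
  exact subset_closure

end KuhnHat

/-! ### Vertex functions on a macro-element -/

section MacroElement

variable {n m : ℕ} {Ω : Set (E n)} {𝒯 : Finset (Simplex n)}
  {b : AffineBasis (Fin (n + 1)) ℝ (E n)}

lemma mem_fineMesh_iff {t : Simplex n} : t ∈ fineMesh 𝒯 m ↔ ∃ y ∈ 𝒯, t ∈ iterSubdivide y m := by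
  simp [fineMesh]

lemma vertexFun_nonneg (𝒮 : Finset (Simplex n)) (p x : E n) : 0 ≤ vertexFun 𝒮 p x := by
  unfold vertexFun
  split_ifs with h
  · exact Finset.sum_nonneg fun k _ => h.choose_spec.2.1 k
  · exact le_rfl

lemma IsMacroMesh.exists_basis (hM : IsMacroMesh Ω 𝒯) {T : Simplex n} (hT : T ∈ 𝒯) :
    ∃ b : AffineBasis (Fin (n + 1)) ℝ (E n), ⇑b = T :=
  exists_affineBasis (hM.nondegenerate T hT)

lemma IsMacroMesh.eq_of_mem (hM : IsMacroMesh Ω 𝒯) {T S : Simplex n} (hT : T ∈ 𝒯) (hS : S ∈ 𝒯)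
    {x : E n} (hxT : x ∈ openSimplex T) (hxS : x ∈ closedSimplex S) : S = T := by
  by_contra hne
  obtain ⟨b', rfl⟩ := hM.exists_basis hS
  obtain ⟨y, hyT, hyS⟩ := mem_closure_iff.mp (closedSimplex_subset_closure_openSimplex hxS) _
    (isOpen_openSimplex T) hxT
  exact disjoint_left.mp (hM.disjoint T hT _ hS (Ne.symm hne)) hyT hyS

lemma sum_weights_eq_ite (hn : n = 1 ∨ n = 2 ∨ n = 3) {t : Simplex n} (ht : t ∈ iterSubdivide b m)
    {x : E n} {w : Fin (n + 1) → ℝ} (hw : IsBarycentric t x w) (q : E n)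
    [∀ k, Decidable (t k = q)] [Decidable (q ∈ lattice b m)] :
    ∑ k with t k = q, w k = if q ∈ lattice b m then kuhnHat b m (x - q) else 0 := by
  split_ifs with hq
  · exact sum_weights_eq_kuhnHat hn ht hw hq
  · rw [Finset.filter_eq_empty_iff.mpr, Finset.sum_empty]
    rintro k - rfl
    exact hq (mem_lattice_of_mem_iterSubdivide ht k)

variable (hn : n = 1 ∨ n = 2 ∨ n = 3) (hM : IsMacroMesh Ω 𝒯) (hb : ⇑b ∈ 𝒯)
include hn hM hb

lemma vertexFun_eq_sum {x : E n} (hx : x ∈ openSimplex b) {t : Simplex n}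
    (ht : t ∈ iterSubdivide b m) {w : Fin (n + 1) → ℝ} (hw : IsBarycentric t x w) (q : E n)
    [∀ k, Decidable (t k = q)] :
    vertexFun (fineMesh 𝒯 m) q x = ∑ k with t k = q, w k := by
  classical
  have h : ∃ tw : Simplex n × (Fin (n + 1) → ℝ), tw.1 ∈ fineMesh 𝒯 m ∧
      IsBarycentric tw.1 x tw.2 := ⟨(t, w), mem_fineMesh_iff.mpr ⟨_, hb, ht⟩, hw⟩
  obtain ⟨hmesh, hbary⟩ := h.choose_spec
  obtain ⟨S, hS, hmem⟩ := mem_fineMesh_iff.mp hmesh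
  obtain ⟨b', rfl⟩ := hM.exists_basis hS
  rw [hM.eq_of_mem hb hS hx (closedSimplex_subset_of_mem_iterSubdivide hmem
    (mem_closedSimplex_iff.mpr ⟨_, hbary⟩))] at hmem
  rw [vertexFun, dif_pos h, sum_weights_eq_ite hn ht hw]
  exact sum_weights_eq_ite hn hmem hbary q

lemma vertexFun_eq_kuhnHat {x : E n} (hx : x ∈ openSimplex b) {q : E n} (hq : q ∈ lattice b m) :
    vertexFun (fineMesh 𝒯 m) q x = kuhnHat b m (x - q) := by
  classical
  obtain ⟨t, ht, w, hw⟩ := exists_mem_iterSubdivide hn m (openSimplex_subset _ hx)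
  rw [vertexFun_eq_sum hn hM hb hx ht hw, sum_weights_eq_kuhnHat hn ht hw hq]

lemma vertexFun_eq_zero {x : E n} (hx : x ∈ openSimplex b) {q : E n} (hq : q ∉ lattice b m) :
    vertexFun (fineMesh 𝒯 m) q x = 0 := by
  classical
  obtain ⟨t, ht, w, hw⟩ := exists_mem_iterSubdivide hn m (openSimplex_subset _ hx)
  rw [vertexFun_eq_sum hn hM hb hx ht hw, sum_weights_eq_ite hn ht hw, if_neg hq]

lemma vertexFun_eq_zero_of_notMem_openSimplex {p : E n} (hp : p ∈ interiorLattice b m) {x : E n}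
    (hx : x ∉ openSimplex b) : vertexFun (fineMesh 𝒯 m) p x = 0 := by
  classical
  rw [mem_interiorLattice_iff] at hp
  rw [vertexFun]
  split_ifs with h
  · obtain ⟨hmesh, hbary⟩ := h.choose_spec
    obtain ⟨S, hS, hmem⟩ := mem_fineMesh_iff.mp hmesh
    obtain ⟨b', rfl⟩ := hM.exists_basis hS
    rw [sum_weights_eq_ite hn hmem hbary]
    split_ifs with hpS
    · obtain rfl : b' = b := DFunLike.coe_injective
        (hM.eq_of_mem hb hS hp.2 (mem_closedSimplex_of_mem_lattice b' hpS))
      by_contra hne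
      exact hx (mem_openSimplex_of_kuhnHat_ne_zero (mem_interiorLattice_iff.mpr hp) hne)
    · rfl
  · rfl

lemma vertexFun_eq_kuhnHat_of_mem_interiorLattice {p : E n} (hp : p ∈ interiorLattice b m)
    (x : E n) : vertexFun (fineMesh 𝒯 m) p x = kuhnHat b m (x - p) := by
  by_cases hx : x ∈ openSimplex b
  · exact vertexFun_eq_kuhnHat hn hM hb hx (mem_interiorLattice_iff.mp hp).1
  · rw [vertexFun_eq_zero_of_notMem_openSimplex hn hM hb hp hx, eq_comm]
    by_contra hne
    exact hx (mem_openSimplex_of_kuhnHat_ne_zero hp hne)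

lemma refFun_eq_kuhnHat (h : (interiorLattice b m).Nonempty) : refFun 𝒯 m b = kuhnHat b m := by
  ext y
  rw [refFun, dif_pos h, vertexFun_eq_kuhnHat_of_mem_interiorLattice hn hM hb h.choose_spec,
    add_sub_cancel_right]

lemma mem_directions_iff {δ : E n} :
    δ ∈ directions 𝒯 m b ↔ (interiorLattice b m).Nonempty ∧
      (∀ i, ∃ z : ℤ, cumCoord b m i δ = z) ∧ spread (fun i => cumCoord b m i δ) ≤ 1 := by
  have hinterior := @vertexFun_eq_kuhnHat_of_mem_interiorLattice n m Ω 𝒯 b hn hM hb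
  constructor
  · rintro ⟨p, hp, q, hq, rfl, x, hxp, hxq⟩
    rw [Function.mem_support, hinterior hp] at hxp
    rw [Function.mem_support, vertexFun_eq_kuhnHat hn hM hb
      (mem_openSimplex_of_kuhnHat_ne_zero hp hxp) hq] at hxq
    have hint := exists_int_cumCoord_sub b hq (mem_interiorLattice_iff.mp hp).1
    exact ⟨⟨p, hp⟩, hint, spread_cumCoord_sub_le_one hint hxp hxq⟩
  · rintro ⟨⟨p, hp⟩, hint, hspread⟩
    have hmid := kuhnHat_half_smul_ne_zero hspread
    have hxp : kuhnHat b m (p + (1 / 2 : ℝ) • δ - p) ≠ 0 := by rwa [add_sub_cancel_left]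
    refine ⟨p, hp, p + δ, add_mem_lattice hp hint hspread, (add_sub_cancel_left p δ).symm,
      p + (1 / 2 : ℝ) • δ, ?_, ?_⟩
    · rwa [Function.mem_support, hinterior hp]
    · rw [Function.mem_support, vertexFun_eq_kuhnHat hn hM hb
        (mem_openSimplex_of_kuhnHat_ne_zero hp hxp) (add_mem_lattice hp hint hspread)]
      rwa [← kuhnHat_neg, show p + (1 / 2 : ℝ) • δ - (p + δ) = -((1 / 2 : ℝ) • δ) by module,
        neg_neg]

lemma neg_mem_directions {δ : E n} (hδ : δ ∈ directions 𝒯 m b) : -δ ∈ directions 𝒯 m b := by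
  rw [mem_directions_iff hn hM hb] at hδ ⊢
  obtain ⟨hne, hint, hspread⟩ := hδ
  simp only [map_neg]
  refine ⟨hne, fun i => ?_, (spread_neg _).trans_le hspread⟩
  obtain ⟨z, hz⟩ := hint i
  exact ⟨-z, by rw [hz, Int.cast_neg]⟩

lemma add_direction_mem_lattice {p δ : E n} (hp : p ∈ interiorLattice b m)
    (hδ : δ ∈ directions 𝒯 m b) : p + δ ∈ lattice b m := by
  rw [mem_directions_iff hn hM hb] at hδ
  exact add_mem_lattice hp hδ.2.1 hδ.2.2

lemma norm_direction_le {δ : E n} (hδ : δ ∈ directions 𝒯 m b) :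
    ‖δ‖ ≤ (n + 1) * Metric.diam (closedSimplex b) / 2 ^ m :=
  norm_le_of_spread_le_one ((mem_directions_iff hn hM hb).mp hδ).2.2

lemma overlap_eq {δ : E n} (h : (interiorLattice b m).Nonempty) :
    overlap 𝒯 m b δ = {y | kuhnHat b m y ≠ 0 ∧ kuhnHat b m (y - δ) ≠ 0} := by
  ext y
  simp [overlap, refFunShift, refFun_eq_kuhnHat hn hM hb h]

lemma isOpen_overlap {δ : E n} (h : (interiorLattice b m).Nonempty) :
    IsOpen (overlap 𝒯 m b δ) := by
  rw [overlap_eq hn hM hb h]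
  have hcont : Continuous (kuhnHat b m) := continuous_kuhnHat
  exact (isOpen_ne_fun hcont continuous_const).inter
    (isOpen_ne_fun (hcont.comp (continuous_sub_right δ)) continuous_const)

lemma add_mem_openSimplex_of_mem_stencilDomain {δ x y : E n} (h : (interiorLattice b m).Nonempty)
    (hx : x ∈ stencilDomain 𝒯 m b δ) (hy : y ∈ overlap 𝒯 m b δ) : x + y ∈ openSimplex b := by
  have hsub : (fun y => x + y) '' overlap 𝒯 m b δ ⊆ closedSimplex b := by
    rintro _ ⟨z, hz, rfl⟩
    suffices stencilDomain 𝒯 m b δ ⊆ (fun x => x + z) ⁻¹' closedSimplex b from this hx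
    refine closure_minimal (fun x' hx' => ?_)
      ((isCompact_closedSimplex _).isClosed.preimage (by fun_prop))
    exact openSimplex_subset _ (hx'.2 z hz)
  have hopen : IsOpen ((fun y => x + y) '' overlap 𝒯 m b δ) :=
    (Homeomorph.addLeft x).isOpenMap _ (isOpen_overlap hn hM hb h)
  exact interior_maximal hsub hopen ⟨y, hy, rfl⟩

lemma add_mem_openSimplex_of_mem_overlap {p q : E n}
    (hpq : p ∈ interiorLattice b m ∨ q ∈ interiorLattice b m)
    {y : E n} (hy : y ∈ overlap 𝒯 m b (q - p)) : p + y ∈ openSimplex b := by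
  rw [overlap_eq hn hM hb (hpq.elim (⟨_, ·⟩) (⟨_, ·⟩))] at hy
  rcases hpq with hp | hq
  · exact mem_openSimplex_of_kuhnHat_ne_zero hp (by simpa only [add_sub_cancel_left] using hy.1)
  · exact mem_openSimplex_of_kuhnHat_ne_zero hq
      (by simpa only [show p + y - q = y - (q - p) by abel] using hy.2)

lemma right_add_mem_openSimplex_of_mem_overlap {p q : E n} (hq : q ∈ interiorLattice b m)
    {y : E n} (hy : y ∈ overlap 𝒯 m b (q - p)) : q + y ∈ openSimplex b := by
  rw [overlap_eq hn hM hb ⟨_, hq⟩] at hy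
  exact mem_openSimplex_of_kuhnHat_ne_zero hq (by simpa only [add_sub_cancel_left] using hy.1)

lemma mem_stencilDomain {p q : E n} (hpq : p ∈ interiorLattice b m ∨ q ∈ interiorLattice b m)
    (hp : p ∈ lattice b m) : p ∈ stencilDomain 𝒯 m b (q - p) := by
  by_cases hp' : p ∈ interiorLattice b m
  · exact subset_closure ⟨(mem_interiorLattice_iff.mp hp').2,
      fun y hy => add_mem_openSimplex_of_mem_overlap hn hM hb hpq hy⟩
  have hq : q ∈ interiorLattice b m := hpq.resolve_left hp'
  have hsub : openSegment ℝ p q ⊆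
      {x | x ∈ openSimplex b ∧ ∀ y ∈ overlap 𝒯 m b (q - p), x + y ∈ openSimplex b} := by
    refine fun x hx => ⟨?_, fun y hy => ?_⟩
    · exact (convex_closedSimplex b).openSegment_self_interior_subset_interior
        (mem_closedSimplex_of_mem_lattice b hp) (mem_interiorLattice_iff.mp hq).2 hx
    · refine (convex_openSimplex b).openSegment_subset
        (add_mem_openSimplex_of_mem_overlap hn hM hb hpq hy)
        (right_add_mem_openSimplex_of_mem_overlap hn hM hb hq hy) ?_
      rw [add_comm x, add_comm p, add_comm q]
      exact (mem_openSegment_translate ℝ y).mpr hx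
  exact closure_mono hsub (segment_subset_closure_openSegment (left_mem_segment ℝ p q))

end MacroElement

/-! ### Weak derivatives -/

section WeakDeriv

variable {n k : ℕ} {U V : Set (E n)} {ι : Fin k → Fin n} {f f' g g' φ : E n → ℝ}

lemma IsTestFunction.mono (hVU : V ⊆ U) (hφ : IsTestFunction V φ) : IsTestFunction U φ :=
  ⟨hφ.1, hφ.2.1, hφ.2.2.trans hVU⟩

lemma setIntegral_mul_of_isTestFunction (hφ : IsTestFunction U φ) (f : E n → ℝ) :
    ∫ x in U, f x * φ x = ∫ x, f x * φ x := by
  refine setIntegral_eq_integral_of_forall_compl_eq_zero fun x hx => ?_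
  rw [image_eq_zero_of_notMem_tsupport fun h => hx (hφ.2.2 h), mul_zero]

lemma setIntegral_mul_iteratedFDeriv_of_isTestFunction (hφ : IsTestFunction U φ) (f : E n → ℝ)
    (e : Fin k → E n) :
    ∫ x in U, f x * iteratedFDeriv ℝ k φ x e = ∫ x, f x * iteratedFDeriv ℝ k φ x e := by
  refine setIntegral_eq_integral_of_forall_compl_eq_zero fun x hx => ?_
  have hzero : iteratedFDeriv ℝ k φ x = 0 := by
    by_contra h
    exact hx (hφ.2.2 (support_iteratedFDeriv_subset k h))
  rw [hzero, zero_apply, mul_zero]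

lemma integrable_mul_of_isTestFunction (hφ : IsTestFunction U φ) (hf : LocallyIntegrableOn f U) :
    Integrable fun x => f x * φ x := by
  have hon : IntegrableOn (fun x => f x * φ x) (tsupport φ) :=
    ((hf.mono_set hφ.2.2).integrableOn_isCompact hφ.2.1).mul_continuousOn
      hφ.1.continuous.continuousOn hφ.2.1
  refine (integrableOn_iff_integrable_of_support_subset fun x hx => ?_).mp hon
  exact subset_tsupport _ (right_ne_zero_of_mul hx)

lemma IsWeakDeriv.integral_eq (h : IsWeakDeriv U ι f g) (hφ : IsTestFunction U φ) :
    ∫ x, f x * iteratedFDeriv ℝ k φ x (fun i => EuclideanSpace.single (ι i) (1 : ℝ)) =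
      (-1 : ℝ) ^ k * ∫ x, g x * φ x := by
  rw [← setIntegral_mul_of_isTestFunction hφ, ← setIntegral_mul_iteratedFDeriv_of_isTestFunction hφ]
  exact h.2.2 φ hφ

lemma IsWeakDeriv.mono (hVU : V ⊆ U) (h : IsWeakDeriv U ι f g) : IsWeakDeriv V ι f g := by
  refine ⟨h.1.mono_set hVU, h.2.1.mono_set hVU, fun φ hφ => ?_⟩
  rw [setIntegral_mul_of_isTestFunction hφ, setIntegral_mul_iteratedFDeriv_of_isTestFunction hφ]
  exact h.integral_eq (hφ.mono hVU)

lemma IsWeakDeriv.congr_left (hU : MeasurableSet U) (h : IsWeakDeriv U ι f g)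
    (hff' : EqOn f f' U) : IsWeakDeriv U ι f' g := by
  refine ⟨fun x hx => ?_, h.2.1, fun φ hφ => ?_⟩
  · obtain ⟨s, hs, hint⟩ := h.1 x hx
    refine ⟨U ∩ s, Filter.inter_mem self_mem_nhdsWithin hs, ?_⟩
    exact (hint.mono_set inter_subset_right).congr (ae_restrict_of_ae_restrict_of_subset
      inter_subset_left (ae_restrict_of_forall_mem hU hff'))
  · rw [← h.2.2 φ hφ]
    exact setIntegral_congr_fun hU fun x hx => by simp only [hff' hx]

lemma IsWeakDeriv.ae_eq (hU : IsOpen U) (h : IsWeakDeriv U ι f g) (h' : IsWeakDeriv U ι f g') :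
    ∀ᵐ x, x ∈ U → g x = g' x := by
  have hzero := hU.ae_eq_zero_of_integral_contDiff_smul_eq_zero (μ := volume)
    (f := fun x => g x - g' x) (h.2.1.sub h'.2.1) (fun φ hsmooth hcompact hsupp => ?_)
  · filter_upwards [hzero] with x hx hxU
    exact sub_eq_zero.mp (hx hxU)
  · have hφ : IsTestFunction U φ := ⟨hsmooth, hcompact, hsupp⟩
    have hint : ∫ x, g x * φ x = ∫ x, g' x * φ x :=
      mul_left_cancel₀ (pow_ne_zero k (neg_ne_zero.mpr one_ne_zero))
        ((h.integral_eq hφ).symm.trans (h'.integral_eq hφ))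
    simp_rw [smul_eq_mul, mul_sub, mul_comm (φ _)]
    rw [integral_sub (integrable_mul_of_isTestFunction hφ h.2.1)
      (integrable_mul_of_isTestFunction hφ h'.2.1), hint, sub_self]

lemma isWeakDeriv_fderiv (U : Set (E n)) (hf : ContDiff ℝ 1 f) (a : Fin n) :
    IsWeakDeriv U (fun _ : Fin 1 => a) f fun x => fderiv ℝ f x (EuclideanSpace.single a 1) := by
  have hcont (g : E n → ℝ) (hg : ContDiff ℝ 1 g) :
      Continuous fun x => fderiv ℝ g x (EuclideanSpace.single a (1 : ℝ)) :=
    (hg.continuous_fderiv one_ne_zero).clm_apply continuous_const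
  refine ⟨hf.continuous.locallyIntegrable.locallyIntegrableOn _,
    (hcont f hf).locallyIntegrable.locallyIntegrableOn _, fun φ hφ => ?_⟩
  have hφ1 : ContDiff ℝ 1 φ := hφ.1.of_le (by simp)
  rw [setIntegral_mul_of_isTestFunction hφ, setIntegral_mul_iteratedFDeriv_of_isTestFunction hφ]
  simp_rw [iteratedFDeriv_one_apply]
  rw [integral_mul_fderiv_eq_neg_fderiv_mul_of_integrable (μ := volume)]
  · rw [pow_one, neg_one_mul]
  · exact ((hcont f hf).mul hφ1.continuous).integrable_of_hasCompactSupport hφ.2.1.mul_left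
  · exact (hf.continuous.mul (hcont φ hφ1)).integrable_of_hasCompactSupport
      (hφ.2.1.fderiv_apply ℝ _).mul_left
  · exact (hf.continuous.mul hφ1.continuous).integrable_of_hasCompactSupport hφ.2.1.mul_left
  · exact fun x _ => hf.differentiable one_ne_zero x
  · exact fun x _ => hφ1.differentiable one_ne_zero x

end WeakDeriv

section AffineGrad

variable {n : ℕ}

/-- The constant gradient of an affine function, depending linearly on the function. -/
noncomputable def affineGrad : (E n →ᵃ[ℝ] ℝ) →ₗ[ℝ] E n where
  toFun f := (InnerProductSpace.toDual ℝ (E n)).symm f.linear.toContinuousLinearMap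
  map_add' f g := by simp only [AffineMap.add_linear, map_add]
  map_smul' c f := by
    simp only [AffineMap.smul_linear, map_smul, RingHom.id_apply]

lemma inner_affineGrad (f : E n →ᵃ[ℝ] ℝ) (u : E n) : inner ℝ (affineGrad f) u = f.linear u := by
  change inner ℝ ((InnerProductSpace.toDual ℝ (E n)).symm f.linear.toContinuousLinearMap) u = _
  rw [InnerProductSpace.toDual_symm_apply, LinearMap.coe_toContinuousLinearMap']

lemma affineGrad_apply (f : E n →ᵃ[ℝ] ℝ) (a : Fin n) :
    affineGrad f a = f.linear (EuclideanSpace.single a 1) := by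
  rw [← inner_affineGrad, EuclideanSpace.inner_single_right, one_mul, RCLike.conj_to_real]

lemma hasFDerivAt_affineMap (f : E n →ᵃ[ℝ] ℝ) (x : E n) :
    HasFDerivAt f f.linear.toContinuousLinearMap x := by
  rw [f.decomp]
  exact f.linear.toContinuousLinearMap.hasFDerivAt.add_const (f 0)

lemma gradient_affineMap (f : E n →ᵃ[ℝ] ℝ) (x : E n) : gradient f x = affineGrad f := by
  rw [gradient, (hasFDerivAt_affineMap f x).fderiv]
  rfl

lemma isWeakDeriv_affineMap (U : Set (E n)) (f : E n →ᵃ[ℝ] ℝ) (a : Fin n) :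
    IsWeakDeriv U (fun _ : Fin 1 => a) f fun _ => affineGrad f a := by
  have hf : ContDiff ℝ 1 f := by
    rw [f.decomp]
    exact f.linear.toContinuousLinearMap.contDiff.add contDiff_const
  convert isWeakDeriv_fderiv U hf a using 2 with x
  rw [affineGrad_apply, (hasFDerivAt_affineMap f x).fderiv, LinearMap.coe_toContinuousLinearMap']

lemma ae_eq_affineGrad {Ω V : Set (E n)} (hV : IsOpen V) (hVΩ : V ⊆ Ω) {v : E n → ℝ}
    {g : E n → E n} (h : ∀ a : Fin n, IsWeakDeriv Ω (fun _ : Fin 1 => a) v (fun x => g x a))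
    {f : E n →ᵃ[ℝ] ℝ} (hf : EqOn v f V) : ∀ᵐ x, x ∈ V → g x = affineGrad f := by
  have hcomp (a : Fin n) : ∀ᵐ x, x ∈ V → g x a = affineGrad f a :=
    (((h a).mono hVΩ).congr_left hV.measurableSet hf).ae_eq hV (isWeakDeriv_affineMap V f a)
  filter_upwards [ae_all_iff.mpr hcomp] with x hx hxV
  ext a
  exact hx a hxV

lemma affineMap_sum_apply {κ : Type*} (s : Finset κ) (f : κ → E n →ᵃ[ℝ] ℝ) (x : E n) :
    (∑ k ∈ s, f k) x = ∑ k ∈ s, f k x :=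
  map_sum (⟨⟨fun f => f x, rfl⟩, fun _ _ => rfl⟩ : (E n →ᵃ[ℝ] ℝ) →+ ℝ) f s

lemma affineMap_eq_sum_coord (b : AffineBasis (Fin (n + 1)) ℝ (E n)) (f : E n →ᵃ[ℝ] ℝ) :
    f = ∑ k, f (b k) • b.coord k := by
  ext x
  conv_lhs => rw [← b.linear_combination_coord_eq_self x,
    affineMap_sum_smul f (b.sum_coord_apply_eq_one x)]
  simp only [affineMap_sum_apply, AffineMap.coe_smul, Pi.smul_apply, smul_eq_mul, mul_comm]

lemma affineGrad_eq_sum (b : AffineBasis (Fin (n + 1)) ℝ (E n)) (f : E n →ᵃ[ℝ] ℝ) :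
    affineGrad f = ∑ k, f (b k) • affineGrad (b.coord k) := by
  conv_lhs => rw [affineMap_eq_sum_coord b f, map_sum]
  simp only [map_smul]

lemma sum_affineGrad_coord (b : AffineBasis (Fin (n + 1)) ℝ (E n)) :
    ∑ k, affineGrad (b.coord k) = 0 := by
  have h := affineGrad_eq_sum b (AffineMap.const ℝ (E n) (1 : ℝ))
  simp only [AffineMap.const_apply, one_smul] at h
  rw [← h, ← gradient_affineMap _ 0]
  exact gradient_const 0 1

end AffineGrad

/-! ### Finite element functions at almost every point -/

section RegularPoint

variable {n : ℕ} {Ω : Set (E n)} {𝒯 : Finset (Simplex n)}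

lemma mem_vertices_iff {m : ℕ} {p : E n} : p ∈ vertices 𝒯 m ↔ ∃ T ∈ 𝒯, p ∈ lattice T m := by
  simp [vertices]

/-- What holds at almost every point of `Ω` for a finite element function `v` with weak gradient
`g`. -/
structure IsRegularPoint (𝒯 : Finset (Simplex n)) (m : ℕ) (v : E n → ℝ) (g : E n → E n)
    (x : E n) : Prop where
  grad_eq : g x = ∑ q ∈ vertices 𝒯 m, v q • gradient (vertexFun (fineMesh 𝒯 m) q) x
  sum_grad : ∑ q ∈ vertices 𝒯 m, gradient (vertexFun (fineMesh 𝒯 m) q) x = 0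
  inner_grad : ∀ p q, vertexFun (fineMesh 𝒯 m) p x ≠ 0 → vertexFun (fineMesh 𝒯 m) q x ≠ 0 →
    inner ℝ (g x) (q - p) = v q - v p
  exists_card : ∃ s : Finset (E n), s.card ≤ n + 1 ∧
    ∀ p, vertexFun (fineMesh 𝒯 m) p x ≠ 0 → p ∈ s

variable (hn : n = 1 ∨ n = 2 ∨ n = 3) (hM : IsMacroMesh Ω 𝒯)
include hn hM

lemma ae_mem_fine_openSimplex (m : ℕ) :
    ∀ᵐ x, x ∈ Ω → ∃ T ∈ 𝒯, ∃ t ∈ iterSubdivide T m, x ∈ openSimplex t := by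
  have hnull : volume (⋃ T ∈ 𝒯, ⋃ t ∈ iterSubdivide T m, closedSimplex t \ openSimplex t) = 0 :=
    (measure_biUnion_null_iff 𝒯.countable_toSet).mpr fun T _ =>
      (measure_biUnion_null_iff (iterSubdivide T m).countable_toSet).mpr fun t _ =>
        volume_closedSimplex_diff_openSimplex t
  filter_upwards [measure_eq_zero_iff_ae_notMem.mp hnull] with x hx hxΩ
  have hcover := subset_closure hxΩ
  rw [hM.cover] at hcover
  obtain ⟨T, hT, hxT⟩ := mem_iUnion₂.mp hcover
  obtain ⟨t, ht, hw⟩ := exists_mem_iterSubdivide hn m hxT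
  refine ⟨T, hT, t, ht, ?_⟩
  by_contra h
  exact hx (mem_iUnion₂.mpr ⟨T, hT, mem_iUnion₂.mpr ⟨t, ht, mem_closedSimplex_iff.mpr hw, h⟩⟩)

lemma ae_mem_openSimplex : ∀ᵐ x, x ∈ Ω → ∃ T ∈ 𝒯, x ∈ openSimplex T := by
  filter_upwards [ae_mem_fine_openSimplex hn hM 0] with x hx hxΩ
  obtain ⟨T, hT, t, ht, hxt⟩ := hx hxΩ
  rw [iterSubdivide, Finset.mem_singleton] at ht
  exact ⟨T, hT, ht ▸ hxt⟩

section FineSimplex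

variable {m : ℕ} {b c : AffineBasis (Fin (n + 1)) ℝ (E n)} (hb : ⇑b ∈ 𝒯)
  (hc : ⇑c ∈ iterSubdivide b m) {x : E n} (hx : x ∈ openSimplex c)
include hb hc hx

lemma vertexFun_eq_sum_coord (q : E n) [∀ k, Decidable (c k = q)] :
    vertexFun (fineMesh 𝒯 m) q x = ∑ k with c k = q, c.coord k x := by
  obtain ⟨w, hw⟩ := mem_closedSimplex_iff.mp (openSimplex_subset _ hx)
  rw [vertexFun_eq_sum hn hM hb (openSimplex_subset_of_mem_iterSubdivide hc hx) hc hw]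
  simp only [coord_eq_of_isBarycentric c hw]

lemma gradient_vertexFun_eq_sum (q : E n) [∀ k, Decidable (c k = q)] :
    gradient (vertexFun (fineMesh 𝒯 m) q) x = ∑ k with c k = q, affineGrad (c.coord k) := by
  have heq : vertexFun (fineMesh 𝒯 m) q =ᶠ[nhds x] ⇑(∑ k with c k = q, c.coord k) := by
    filter_upwards [(isOpen_openSimplex c).mem_nhds hx] with z hz
    rw [vertexFun_eq_sum_coord hn hM hb hc hz, affineMap_sum_apply]
  rw [heq.gradient_eq, gradient_affineMap, map_sum]

lemma sum_smul_gradient_vertexFun (v : E n → ℝ) :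
    ∑ q ∈ vertices 𝒯 m, v q • gradient (vertexFun (fineMesh 𝒯 m) q) x =
      ∑ k, v (c k) • affineGrad (c.coord k) := by
  classical
  have hmaps : ∀ k ∈ (Finset.univ : Finset (Fin (n + 1))), c k ∈ vertices 𝒯 m := fun k _ =>
    mem_vertices_iff.mpr ⟨_, hb, mem_lattice_of_mem_iterSubdivide hc k⟩
  rw [← Finset.sum_fiberwise_of_maps_to hmaps]
  refine Finset.sum_congr rfl fun q _ => ?_
  rw [gradient_vertexFun_eq_sum hn hM hb hc hx, Finset.smul_sum]
  exact Finset.sum_congr rfl fun k hk => by rw [(Finset.mem_filter.mp hk).2]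

lemma exists_vertex_eq_of_vertexFun_ne_zero {q : E n} (hq : vertexFun (fineMesh 𝒯 m) q x ≠ 0) :
    ∃ k, c k = q := by
  classical
  rw [vertexFun_eq_sum_coord hn hM hb hc hx] at hq
  obtain ⟨k, hk, -⟩ := Finset.exists_ne_zero_of_sum_ne_zero hq
  exact ⟨k, (Finset.mem_filter.mp hk).2⟩

lemma isRegularPoint_of_eqOn_affineMap {v : E n → ℝ} {g : E n → E n} {f : E n →ᵃ[ℝ] ℝ}
    (hf : EqOn v f (closedSimplex c)) (hg : g x = affineGrad f) : IsRegularPoint 𝒯 m v g x := by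
  classical
  have hv (k) : v (c k) = f (c k) := hf (subset_convexHull ℝ _ (mem_range_self k))
  have hvertex := @exists_vertex_eq_of_vertexFun_ne_zero n Ω 𝒯 hn hM m b c hb hc x hx
  refine ⟨?_, ?_, fun p q hp hq => ?_, Finset.univ.image c, ?_, fun p hp => ?_⟩
  · rw [sum_smul_gradient_vertexFun hn hM hb hc hx, hg, affineGrad_eq_sum c]
    simp_rw [hv]
  · simpa only [one_smul, sum_affineGrad_coord] using
      sum_smul_gradient_vertexFun hn hM hb hc hx fun _ => 1
  · obtain ⟨k, rfl⟩ := hvertex hp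
    obtain ⟨l, rfl⟩ := hvertex hq
    rw [hg, inner_affineGrad, hv, hv]
    exact f.linearMap_vsub _ _
  · exact Finset.card_image_le.trans_eq (Finset.card_fin (n + 1))
  · obtain ⟨k, rfl⟩ := hvertex hp
    exact Finset.mem_image_of_mem _ (Finset.mem_univ k)

end FineSimplex

lemma ae_isRegularPoint {m : ℕ} {v : E n → ℝ} (hv : v ∈ feSpace Ω (fineMesh 𝒯 m))
    {g : E n → E n} (hg : IsH10 Ω v g) : ∀ᵐ x, x ∈ Ω → IsRegularPoint 𝒯 m v g x := by
  have hgrad : ∀ T ∈ 𝒯, ∀ t ∈ iterSubdivide T m, ∃ f : E n →ᵃ[ℝ] ℝ,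
      EqOn v f (closedSimplex t) ∧ ∀ᵐ x, x ∈ openSimplex t → g x = affineGrad f := by
    intro T hT t ht
    obtain ⟨f, hf⟩ := hv.2.2.2 t (mem_fineMesh_iff.mpr ⟨T, hT, ht⟩)
    obtain ⟨b, rfl⟩ := hM.exists_basis hT
    exact ⟨f, hf, ae_eq_affineGrad (isOpen_openSimplex t)
      ((openSimplex_subset_of_mem_iterSubdivide ht).trans (hM.subset _ hT)) hg.weak_grad
      (hf.mono (openSimplex_subset t))⟩
  choose! f hf hfg using hgrad
  have hae : ∀ᵐ x, ∀ T ∈ 𝒯, ∀ t ∈ iterSubdivide T m, x ∈ openSimplex t →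
      g x = affineGrad (f T t) :=
    (Filter.eventually_all_finset 𝒯).mpr fun T hT =>
      (Filter.eventually_all_finset (iterSubdivide T m)).mpr (hfg T hT)
  filter_upwards [hae, ae_mem_fine_openSimplex hn hM m] with x hgx hfine hxΩ
  obtain ⟨T, hT, t, ht, hxt⟩ := hfine hxΩ
  obtain ⟨b, rfl⟩ := hM.exists_basis hT
  obtain ⟨c, rfl⟩ := exists_affineBasis_of_openSimplex_nonempty ⟨x, hxt⟩
  exact isRegularPoint_of_eqOn_affineMap hn hM hT ht hxt (hf _ hT _ ht) (hgx _ hT _ ht hxt)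

end RegularPoint

section Seminorm

variable {n k : ℕ} {U : Set (E n)} {ι : Fin k → Fin n} {f g g' φ : E n → ℝ}

lemma IsTestFunction.fderiv_apply (hφ : IsTestFunction U φ) (e : E n) :
    IsTestFunction U fun x => fderiv ℝ φ x e :=
  ⟨(hφ.1.fderiv_right (by simp)).clm_apply contDiff_const, hφ.2.1.fderiv_apply ℝ e,
    (tsupport_fderiv_apply_subset ℝ e).trans hφ.2.2⟩

lemma iteratedFDeriv_succ_snoc (hφ : ContDiff ℝ ∞ φ) (ι : Fin k → Fin n) (a : Fin n) (x : E n) :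
    iteratedFDeriv ℝ (k + 1) φ x (fun i => EuclideanSpace.single
      ((Fin.snoc ι a : Fin (k + 1) → Fin n) i) (1 : ℝ)) =
    iteratedFDeriv ℝ k (fun y => fderiv ℝ φ y (EuclideanSpace.single a 1)) x
      (fun i => EuclideanSpace.single (ι i) (1 : ℝ)) := by
  have hcomp := ContinuousLinearMap.iteratedFDeriv_comp_left (x := x) (n := (k : WithTop ℕ∞))
    (ContinuousLinearMap.apply ℝ ℝ (EuclideanSpace.single a (1 : ℝ) : E n))
    ((hφ.fderiv_right (m := (k : WithTop ℕ∞)) (by exact_mod_cast le_top)).contDiffAt) le_rfl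
  have happ := congrArg (fun M => M fun i => EuclideanSpace.single (ι i) (1 : ℝ)) hcomp
  rw [iteratedFDeriv_succ_apply_right]
  refine Eq.trans ?_ happ.symm
  simp only [ContinuousLinearMap.compContinuousMultilinearMap_coe, Function.comp_apply,
    ContinuousLinearMap.apply_apply, Fin.snoc_last]
  congr 2
  ext i : 1
  exact congrArg (fun j => EuclideanSpace.single j (1 : ℝ))
    (Fin.snoc_castSucc (α := fun _ => Fin n) a ι i)

lemma IsWeakDeriv.of_snoc {a : Fin n} (h : IsWeakDeriv U ι f g)
    (h' : IsWeakDeriv U (Fin.snoc ι a : Fin (k + 1) → Fin n) f g') :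
    IsWeakDeriv U (fun _ : Fin 1 => a) g g' := by
  refine ⟨h.2.1, h'.2.1, fun φ hφ => ?_⟩
  rw [setIntegral_mul_of_isTestFunction hφ, setIntegral_mul_iteratedFDeriv_of_isTestFunction hφ]
  simp_rw [iteratedFDeriv_one_apply]
  have hg := h.integral_eq (hφ.fderiv_apply (EuclideanSpace.single a 1))
  have hg' := h'.integral_eq hφ
  simp_rw [iteratedFDeriv_succ_snoc hφ.1] at hg'
  rw [hg, pow_succ, mul_assoc] at hg'
  rw [mul_left_cancel₀ (pow_ne_zero k (by norm_num : (-1 : ℝ) ≠ 0)) hg', pow_one]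

lemma isWeakDeriv_self (hf : LocallyIntegrableOn f U) (ι : Fin 0 → Fin n) :
    IsWeakDeriv U ι f f :=
  ⟨hf, hf, fun φ _ => by simp⟩

lemma IsWeakDeriv.congr_right (hU : MeasurableSet U) (h : IsWeakDeriv U ι f g)
    (hgg' : EqOn g g' U) : IsWeakDeriv U ι f g' := by
  have hg' := ((isWeakDeriv_self h.2.1 Fin.elim0).congr_left hU hgg').1
  refine ⟨h.1, hg', fun φ hφ => ?_⟩
  rw [h.2.2 φ hφ]
  congr 1
  exact setIntegral_congr_fun hU fun x hx => by simp only [hgg' hx]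

lemma IsWeakDeriv.eLpNorm_le_seminorm (hU : IsOpen U) (h : IsWeakDeriv U ι f g) :
    eLpNorm g ∞ (volume.restrict U) ≤ sobolevInfSeminorm U k f :=
  le_iSup_of_le ι (le_iInf₂ fun _ h' =>
    (eLpNorm_congr_ae ((ae_restrict_iff' hU.measurableSet).mpr (h.ae_eq hU h'))).le)

lemma sobolevInfSeminorm_le {B : ℝ≥0∞}
    (h : ∀ ι : Fin k → Fin n, ∃ g, IsWeakDeriv U ι f g ∧ eLpNorm g ∞ (volume.restrict U) ≤ B) :
    sobolevInfSeminorm U k f ≤ B :=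
  iSup_le fun ι => by
    obtain ⟨g, hg, hB⟩ := h ι
    exact (iInf₂_le g hg).trans hB

lemma MemSobolevInf.seminorm_ne_top (hf : MemSobolevInf U k f) :
    sobolevInfSeminorm U k f ≠ ⊤ := by
  choose g hg hgm using hf.2 k le_rfl
  refine ne_top_of_le_ne_top (b := ∑ ι, eLpNorm (g ι) ∞ (volume.restrict U)) ?_ ?_
  · exact ENNReal.sum_ne_top.mpr fun ι _ => (hgm ι).eLpNorm_ne_top
  · exact sobolevInfSeminorm_le fun ι => ⟨g ι, hg ι,
      Finset.single_le_sum (f := fun ι => eLpNorm (g ι) ∞ (volume.restrict U))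
        (fun _ _ => zero_le) (Finset.mem_univ ι)⟩

lemma ae_abs_indicator_le_of_eLpNorm_le (hU : MeasurableSet U) {B : ℝ≥0∞} (hB : B ≠ ⊤)
    (h : eLpNorm g ∞ (volume.restrict U) ≤ B) : ∀ᵐ x, |U.indicator g x| ≤ B.toReal := by
  rw [← eLpNorm_indicator_eq_eLpNorm_restrict hU, eLpNorm_exponent_top] at h
  filter_upwards [ae_le_eLpNormEssSup (f := U.indicator g) (μ := volume)] with x hx
  simpa using ENNReal.toReal_mono hB (hx.trans h)

lemma MemSobolevInf.exists_ae_abs_indicator_le (hU : MeasurableSet U)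
    (hf : MemSobolevInf U k f) : ∃ C, ∀ᵐ x, |U.indicator f x| ≤ C :=
  ⟨_, ae_abs_indicator_le_of_eLpNorm_le hU hf.1.eLpNorm_ne_top le_rfl⟩

/-- A family `G j ι` of globally defined functions, one for each multi-index `ι` of order `j ≤ k`,
each being the weak derivative on `U` of its predecessor. It packages the derivatives of
`G 0 default` up to order `k` for Taylor's formula. -/
structure IsWeakDerivChain (U : Set (E n)) (k : ℕ) (G : ∀ j, (Fin j → Fin n) → E n → ℝ) :
    Prop where
  locallyIntegrable : ∀ j ≤ k, ∀ ι, LocallyIntegrable (G j ι)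
  isWeakDeriv : ∀ j < k, ∀ ι a,
    IsWeakDeriv U (fun _ : Fin 1 => a) (G j ι) (G (j + 1) (Fin.snoc ι a))

lemma MemSobolevInf.exists_isWeakDerivChain (hU : IsOpen U) (hfin : volume U ≠ ⊤)
    (hf : MemSobolevInf U k f) :
    ∃ G : ∀ j, (Fin j → Fin n) → E n → ℝ, IsWeakDerivChain U k G ∧
      (∀ ι, ∀ᵐ x, |G k ι x| ≤ (sobolevInfSeminorm U k f).toReal) ∧
      ∀ᵐ x, x ∈ U → f x = G 0 default x := by
  choose! g hg hgm using hf.2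
  have hind (g : E n → ℝ) : EqOn g (U.indicator g) U := fun x hx => (indicator_of_mem hx g).symm
  have : IsFiniteMeasure (volume.restrict U) := ⟨by simpa using hfin.lt_top⟩
  refine ⟨fun j ι => U.indicator (g j ι), ⟨fun j hj ι => ?_, fun j hj ι a => ?_⟩,
    fun ι => ?_, ?_⟩
  · have hgU : IntegrableOn (g j ι) U := (hgm j hj ι).integrable le_top
    exact (hgU.integrable_indicator hU.measurableSet).locallyIntegrable
  · exact (((hg j hj.le ι).of_snoc (hg (j + 1) hj _)).congr_left hU.measurableSet
      (hind _)).congr_right hU.measurableSet (hind _)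
  · exact ae_abs_indicator_le_of_eLpNorm_le hU.measurableSet hf.seminorm_ne_top
      ((hg _ le_rfl ι).eLpNorm_le_seminorm hU)
  · have hg0 := hg 0 k.zero_le default
    filter_upwards [(isWeakDeriv_self hg0.1 default).ae_eq hU hg0] with x hx hxU
    rw [hx hxU, ← hind _ hxU]

end Seminorm

section Mollify

variable {n : ℕ} {U : Set (E n)} {φ g g' : E n → ℝ} {x : E n}

/-- The convolution of `g` with the kernel `φ`, used to smooth `g`. -/
noncomputable def mollify (φ g : E n → ℝ) (x : E n) : ℝ := ∫ t, φ (x - t) * g t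

lemma mollify_eq_convolution (φ g : E n → ℝ) :
    mollify φ g = convolution φ g (ContinuousLinearMap.lsmul ℝ ℝ) volume := by
  ext x
  rw [convolution_lsmul_swap]
  rfl

lemma exists_hasFDerivAt_mollify (hφ : ContDiff ℝ ∞ φ) (hφc : HasCompactSupport φ)
    (hg : LocallyIntegrable g) (x : E n) :
    ∃ L : E n →L[ℝ] ℝ, HasFDerivAt (mollify φ g) L x ∧
      ∀ u, L u = mollify (fun y => fderiv ℝ φ y u) g x := by
  have hconv := hφc.hasFDerivAt_convolution_right (ContinuousLinearMap.mul ℝ ℝ) hg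
    (hφ.of_le (by simp)) x
  have hswap (φ : E n → ℝ) : convolution g φ (ContinuousLinearMap.mul ℝ ℝ) volume =
      mollify φ g :=
    funext fun y => integral_congr_ae (Filter.Eventually.of_forall fun t => mul_comm _ _)
  rw [hswap] at hconv
  refine ⟨_, hconv, fun u => ?_⟩
  rw [convolution_precompR_apply _ hg (hφc.fderiv ℝ) (hφ.continuous_fderiv (by simp))]
  exact congrFun (hswap _) x

lemma isTestFunction_comp_sub_left (hφ : ContDiff ℝ ∞ φ) (hφc : HasCompactSupport φ)
    (hx : ∀ y ∈ tsupport φ, x - y ∈ U) : IsTestFunction U fun t => φ (x - t) := by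
  have hts : tsupport (fun t => φ (x - t)) ⊆ (fun t => x - t) ⁻¹' tsupport φ :=
    closure_minimal (fun t ht => subset_tsupport φ ht)
      ((isClosed_tsupport φ).preimage (by fun_prop))
  refine ⟨hφ.comp (contDiff_const.sub contDiff_id),
    hφc.comp_homeomorph (Homeomorph.subLeft x), fun t ht => ?_⟩
  simpa only [sub_sub_cancel] using hx _ (hts ht)

lemma IsWeakDeriv.mollify_fderiv {a : Fin n} (h : IsWeakDeriv U (fun _ : Fin 1 => a) g g')
    (hφ : ContDiff ℝ ∞ φ) (hφc : HasCompactSupport φ) (hx : ∀ y ∈ tsupport φ, x - y ∈ U) :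
    mollify (fun y => fderiv ℝ φ y (EuclideanSpace.single a 1)) g x = mollify φ g' x := by
  have hparts := h.integral_eq (isTestFunction_comp_sub_left hφ hφc hx)
  have hfd (t : E n) : fderiv ℝ (fun t => φ (x - t)) t = -fderiv ℝ φ (x - t) := by
    have hcomp := ((hφ.differentiable (by simp)) (x - t)).hasFDerivAt.comp t
      ((hasFDerivAt_const x t).sub (hasFDerivAt_id t))
    refine hcomp.fderiv.trans ?_
    ext u
    simp
  simp_rw [iteratedFDeriv_one_apply, hfd, neg_apply, mul_neg, integral_neg,
    pow_one, neg_one_mul, neg_inj] at hparts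
  simp_rw [mollify, mul_comm _ (g _), mul_comm _ (g' _)]
  exact hparts

lemma abs_mollify_le (hφ : Integrable φ) (hφ0 : ∀ x, 0 ≤ φ x) (hφ1 : ∫ x, φ x = 1)
    {B : ℝ} (hg : ∀ᵐ x, |g x| ≤ B) (x : E n) : |mollify φ g x| ≤ B := by
  have hmass : ∫ t, φ (x - t) * B = B := by
    rw [integral_mul_const, integral_sub_left_eq_self φ volume x, hφ1, one_mul]
  rw [← hmass, ← Real.norm_eq_abs, mollify]
  refine norm_integral_le_of_norm_le ((hφ.comp_sub_left x).mul_const B) ?_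
  filter_upwards [hg] with t ht
  rw [norm_mul, Real.norm_of_nonneg (hφ0 _)]
  exact mul_le_mul_of_nonneg_left ht (hφ0 _)

lemma exists_contDiffBump_tendsto_mollify (n : ℕ) :
    ∃ φ : ℕ → ContDiffBump (0 : E n), Filter.Tendsto (fun i => (φ i).rOut) Filter.atTop (nhds 0) ∧
      ∀ g : E n → ℝ, LocallyIntegrable g → ∀ᵐ x, Filter.Tendsto
        (fun i => mollify ((φ i).normed volume) g x) Filter.atTop (nhds (g x)) := by
  let φ : ℕ → ContDiffBump (0 : E n) := fun i =>
    ⟨1 / (i + 1), 2 * (1 / (i + 1)), by positivity, by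
      linarith [show (0 : ℝ) < 1 / (i + 1) by positivity]⟩
  have hr : Filter.Tendsto (fun i => (φ i).rOut) Filter.atTop (nhds 0) := by
    simpa only [mul_zero] using (tendsto_one_div_add_atTop_nhds_zero_nat (𝕜 := ℝ)).const_mul 2
  refine ⟨φ, hr, fun g hg => ?_⟩
  simpa only [mollify_eq_convolution] using
    ContDiffBump.ae_convolution_tendsto_right_of_locallyIntegrable (K := 2) hr
      (Filter.Eventually.of_forall fun i => le_rfl) hg

end Mollify

section Taylor

variable {n : ℕ} {U : Set (E n)}

lemma abs_sub_taylor_le {k : ℕ} {F : ℕ → ℝ → ℝ} {M : ℝ}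
    (hF : ∀ j < k, ∀ t ∈ Icc (0 : ℝ) 1, HasDerivAt (F j) (F (j + 1) t) t)
    (hM : ∀ t ∈ Icc (0 : ℝ) 1, |F k t| ≤ M) :
    ∀ t ∈ Icc (0 : ℝ) 1, |F 0 t - ∑ j ∈ Finset.range k, F j 0 * (t ^ j / j.factorial)| ≤ M := by
  induction k generalizing F with
  | zero => simpa using hM
  | succ k ih =>
    intro t ht
    have hM0 : 0 ≤ M := (abs_nonneg _).trans (hM 0 (by simp))
    have hpoly (s : ℝ) : HasDerivAt
        (fun s : ℝ => ∑ j ∈ Finset.range (k + 1), F j 0 * (s ^ j / j.factorial))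
        (∑ j ∈ Finset.range k, F (j + 1) 0 * (s ^ j / j.factorial)) s := by
      refine (HasDerivAt.fun_sum fun j _ =>
        ((hasDerivAt_pow j s).div_const _).const_mul _).congr_deriv ?_
      rw [Finset.sum_range_succ']
      simp only [CharP.cast_eq_zero, zero_mul, zero_div, mul_zero, add_zero, Nat.add_sub_cancel]
      refine Finset.sum_congr rfl fun j _ => ?_
      rw [Nat.factorial_succ, Nat.cast_mul, mul_div_mul_left _ _ (by positivity)]
    have hbound := (convex_Icc (0 : ℝ) 1).norm_image_sub_le_of_norm_hasDerivWithin_le (C := M)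
      (fun s hs => ((hF 0 k.succ_pos s hs).sub (hpoly s)).hasDerivWithinAt)
      (fun s hs => ih (F := fun j => F (j + 1)) (fun j hj => hF (j + 1) (by omega)) hM s hs)
      (left_mem_Icc.mpr zero_le_one) ht
    have hzero : F 0 0 - ∑ j ∈ Finset.range (k + 1), F j 0 * ((0 : ℝ) ^ j / j.factorial) = 0 := by
      simp [Finset.sum_range_succ']
    simp only [Pi.sub_apply, hzero, sub_zero, Real.norm_eq_abs, abs_of_nonneg ht.1] at hbound
    exact hbound.trans (mul_le_of_le_one_right hM0 ht.2)

/-- The form `u ↦ ∑_ι c_ι u_{ι 0} ⋯ u_{ι (j-1)}` of degree `j` with coefficients `c`. If `c` lists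
the partial derivatives of order `j` of a function, it is the `j`-th derivative in direction `u`. -/
noncomputable def homForm {j : ℕ} (c : (Fin j → Fin n) → ℝ) (u : E n) : ℝ :=
  ∑ ι, (∏ l, u (ι l)) * c ι

lemma homForm_default (c : (Fin 0 → Fin n) → ℝ) (u : E n) : homForm c u = c default := by
  simp [homForm]

lemma homForm_snoc {j : ℕ} (c : (Fin (j + 1) → Fin n) → ℝ) (u : E n) :
    homForm c u = ∑ ι : Fin j → Fin n, (∏ l, u (ι l)) * ∑ a, u a * c (Fin.snoc ι a) := by
  rw [homForm, ← (Fin.snocEquiv fun _ : Fin (j + 1) => Fin n).sum_comp, Fintype.sum_prod_type_right]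
  refine Finset.sum_congr rfl fun ι _ => ?_
  rw [Finset.mul_sum]
  refine Finset.sum_congr rfl fun a _ => ?_
  simp only [Fin.snocEquiv_apply, Fin.prod_univ_castSucc, Fin.snoc_castSucc, Fin.snoc_last,
    mul_assoc]
  rfl

lemma abs_homForm_le {j : ℕ} {c : (Fin j → Fin n) → ℝ} {u : E n} {B D : ℝ}
    (hc : ∀ ι, |c ι| ≤ B) (hu : ‖u‖ ≤ D) : |homForm c u| ≤ (n * D) ^ j * B := by
  have hprod (ι : Fin j → Fin n) : ∏ l, |u (ι l)| ≤ D ^ j := by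
    refine (Finset.prod_le_prod (fun l _ => abs_nonneg _) fun l _ =>
      (PiLp.norm_apply_le u (ι l)).trans hu).trans_eq ?_
    rw [Finset.prod_const, Finset.card_univ, Fintype.card_fin]
  calc |homForm c u| ≤ ∑ ι : Fin j → Fin n, |(∏ l, u (ι l)) * c ι| :=
        Finset.abs_sum_le_sum_abs _ _
    _ ≤ ∑ _ι : Fin j → Fin n, D ^ j * B := by
        refine Finset.sum_le_sum fun ι _ => ?_
        rw [abs_mul, Finset.abs_prod]
        exact mul_le_mul (hprod ι) (hc ι) (abs_nonneg _) (pow_nonneg ((norm_nonneg u).trans hu) j)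
    _ = (n * D) ^ j * B := by
        rw [Finset.sum_const, Finset.card_univ, Fintype.card_fun, Fintype.card_fin,
          Fintype.card_fin, nsmul_eq_mul, Nat.cast_pow, mul_pow, mul_assoc]

lemma exists_poly_eval_eq_sum_homForm (c : ∀ j, (Fin j → Fin n) → ℝ) (x₀ : E n) (r : ℕ) :
    ∃ p : MvPolynomial (Fin n) ℝ, p.totalDegree ≤ r ∧ ∀ x : E n,
      MvPolynomial.eval (fun a => x a) p = ∑ j ∈ Finset.range (r + 1), homForm (c j) (x - x₀) := by
  refine ⟨∑ j ∈ Finset.range (r + 1), ∑ ι : Fin j → Fin n,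
    (∏ l, (MvPolynomial.X (ι l) - MvPolynomial.C (x₀ (ι l)))) * MvPolynomial.C (c j ι),
    ?_, fun x => by simp [homForm]⟩
  refine MvPolynomial.totalDegree_finsetSum_le fun j hj =>
    MvPolynomial.totalDegree_finsetSum_le fun ι _ => (MvPolynomial.totalDegree_mul _ _).trans ?_
  have hprod := MvPolynomial.totalDegree_finsetProd Finset.univ
    fun l => (MvPolynomial.X (ι l) - MvPolynomial.C (x₀ (ι l)) : MvPolynomial (Fin n) ℝ)
  have hlin := Finset.sum_le_card_nsmul Finset.univ _ 1 fun l _ =>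
    (MvPolynomial.totalDegree_sub_C_le (MvPolynomial.X (ι l)) (x₀ (ι l))).trans_eq
      (MvPolynomial.totalDegree_X (R := ℝ) (ι l))
  rw [Finset.card_univ, Fintype.card_fin, smul_eq_mul, mul_one] at hlin
  rw [MvPolynomial.totalDegree_C, add_zero]
  exact (hprod.trans hlin).trans (Nat.lt_succ_iff.mp (Finset.mem_range.mp hj))

variable {k : ℕ} {G : ∀ j, (Fin j → Fin n) → E n → ℝ} {B D : ℝ}

lemma IsWeakDerivChain.hasDerivAt_homForm_mollify (hG : IsWeakDerivChain U k G)
    {φ : E n → ℝ} (hφ : ContDiff ℝ ∞ φ) (hφc : HasCompactSupport φ) {j : ℕ} (hj : j < k)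
    {x u : E n} {t : ℝ} (hx : ∀ y ∈ tsupport φ, x + t • u - y ∈ U) :
    HasDerivAt (fun t : ℝ => homForm (fun ι => mollify φ (G j ι) (x + t • u)) u)
      (homForm (fun ι => mollify φ (G (j + 1) ι) (x + t • u)) u) t := by
  have hline : HasDerivAt (fun t : ℝ => x + t • u) u t := by
    simpa using ((hasDerivAt_id t).smul_const u).const_add x
  have hbasis : u = ∑ a, u a • EuclideanSpace.single a (1 : ℝ) := by
    simpa using ((EuclideanSpace.basisFun (Fin n) ℝ).sum_repr u).symm
  rw [homForm_snoc]
  refine HasDerivAt.fun_sum fun ι _ => HasDerivAt.const_mul _ ?_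
  obtain ⟨L, hL, hLu⟩ :=
    exists_hasFDerivAt_mollify hφ hφc (hG.locallyIntegrable j hj.le ι) (x + t • u)
  refine (hL.comp_hasDerivAt t hline).congr_deriv ?_
  conv_lhs => rw [hbasis]
  simp_rw [map_sum, map_smul, hLu, (hG.isWeakDeriv j hj ι _).mollify_fderiv hφ hφc hx, smul_eq_mul]

lemma IsWeakDerivChain.abs_mollify_sub_taylor_le (hG : IsWeakDerivChain U k G)
    (hB : ∀ ι, ∀ᵐ x, |G k ι x| ≤ B) (φ : ContDiffBump (0 : E n)) {x u : E n} (hu : ‖u‖ ≤ D)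
    (hx : ∀ t ∈ Icc (0 : ℝ) 1, Metric.closedBall (x + t • u) φ.rOut ⊆ U) :
    |mollify (φ.normed volume) (G 0 default) (x + u) - ∑ j ∈ Finset.range k,
      homForm (fun ι => mollify (φ.normed volume) (G j ι) x) u / j.factorial| ≤
      (n * D) ^ k * B := by
  have htaylor := abs_sub_taylor_le (k := k) (M := (n * D) ^ k * B)
    (F := fun j t => homForm (fun ι => mollify (φ.normed volume) (G j ι) (x + t • u)) u)
    (fun j hj t ht => hG.hasDerivAt_homForm_mollify φ.contDiff_normed
      φ.hasCompactSupport_normed hj fun y hy => hx t ht ?_)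
    (fun t _ => abs_homForm_le (fun ι => abs_mollify_le φ.integrable_normed φ.nonneg_normed
      φ.integral_normed (hB ι) _) hu) 1 (right_mem_Icc.mpr zero_le_one)
  · simpa only [homForm_default, one_smul, zero_smul, add_zero, one_pow, mul_one_div] using htaylor
  · rw [φ.tsupport_normed_eq, mem_closedBall_zero_iff] at hy
    rwa [mem_closedBall_iff_norm, sub_sub_cancel_left, norm_neg]

lemma IsWeakDerivChain.exists_ae_abs_sub_taylor_le (hG : IsWeakDerivChain U k G) (hU : IsOpen U)
    (hconv : Convex ℝ U) (hB : ∀ ι, ∀ᵐ x, |G k ι x| ≤ B)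
    (hD : ∀ x ∈ U, ∀ y ∈ U, dist x y ≤ D) :
    ∃ x₀ : E n, ∀ᵐ x, x ∈ U → |G 0 default x - ∑ j ∈ Finset.range k,
      homForm (fun ι => G j ι x₀) (x - x₀) / j.factorial| ≤ (n * D) ^ k * B := by
  rcases U.eq_empty_or_nonempty with rfl | hne
  · exact ⟨0, Filter.Eventually.of_forall fun x hx => hx.elim⟩
  obtain ⟨φ, hr, hφ⟩ := exists_contDiffBump_tendsto_mollify n
  have hlim : ∀ᵐ x : E n, ∀ j ≤ k, ∀ ι : Fin j → Fin n, Filter.Tendsto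
      (fun i => mollify ((φ i).normed volume) (G j ι) x) Filter.atTop (nhds (G j ι x)) :=
    ae_all_iff.mpr fun j => ae_all_iff.mpr fun hj => ae_all_iff.mpr fun ι =>
      hφ _ (hG.locallyIntegrable j hj ι)
  obtain ⟨x₀, hx₀, hx₀U⟩ : ∃ x, _ ∧ x ∈ U :=
    (Filter.Eventually.and_frequently hlim
      (frequently_ae_mem_iff.mpr (hU.measure_pos volume hne).ne')).exists
  refine ⟨x₀, ?_⟩
  filter_upwards [hlim] with x hx hxU
  obtain ⟨δ, hδ, hδU⟩ : ∃ δ > 0, Metric.cthickening δ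
      ((fun t : ℝ => x₀ + t • (x - x₀)) '' Icc 0 1) ⊆ U :=
    (isCompact_Icc.image (by fun_prop)).exists_cthickening_subset_open hU
      (image_subset_iff.mpr fun t ht => hconv.add_smul_sub_mem hx₀U hxU ht)
  have hbound : ∀ᶠ i in Filter.atTop, |mollify ((φ i).normed volume) (G 0 default) x -
      ∑ j ∈ Finset.range k, homForm (fun ι => mollify ((φ i).normed volume) (G j ι) x₀) (x - x₀) /
        j.factorial| ≤ (n * D) ^ k * B := by
    filter_upwards [hr.eventually_le_const hδ] with i hi
    have hi' := hG.abs_mollify_sub_taylor_le (D := D) hB (φ i) (x := x₀) (u := x - x₀)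
      (by rw [← dist_eq_norm]; exact hD x hxU x₀ hx₀U)
      fun t ht y hy => hδU (Metric.mem_cthickening_of_dist_le y _ δ _ (mem_image_of_mem _ ht)
        ((Metric.mem_closedBall.mp hy).trans hi))
    rwa [add_sub_cancel] at hi'
  refine le_of_tendsto (((hx 0 k.zero_le default).sub
    (tendsto_finsetSum _ fun j hj => Filter.Tendsto.div_const ?_ _)).abs) hbound
  exact tendsto_finsetSum _ fun ι _ =>
    (hx₀ j (Finset.mem_range.mp hj).le ι).const_mul _

theorem MemSobolevInf.exists_poly_ae_abs_sub_le (hU : IsOpen U) (hconv : Convex ℝ U)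
    (hfin : volume U ≠ ⊤) {r : ℕ} {f : E n → ℝ} (hf : MemSobolevInf U (r + 1) f)
    (hD : ∀ x ∈ U, ∀ y ∈ U, dist x y ≤ D) :
    ∃ p : MvPolynomial (Fin n) ℝ, p.totalDegree ≤ r ∧ ∀ᵐ x : E n, x ∈ U →
      |f x - MvPolynomial.eval (fun a => x a) p| ≤
        (n * D) ^ (r + 1) * (sobolevInfSeminorm U (r + 1) f).toReal := by
  obtain ⟨G, hG, htop, hf0⟩ := hf.exists_isWeakDerivChain hU hfin
  obtain ⟨x₀, hx₀⟩ := hG.exists_ae_abs_sub_taylor_le hU hconv htop hD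
  obtain ⟨p, hp, hpx⟩ := exists_poly_eval_eq_sum_homForm
    (fun j ι => G j ι x₀ / j.factorial) x₀ r
  refine ⟨p, hp, ?_⟩
  filter_upwards [hx₀, hf0] with x hx hfx hxU
  simpa only [hpx, hfx hxU, homForm, mul_div_assoc', Finset.sum_div] using hx hxU

end Taylor

section Correlation

variable {n : ℕ} {s k k' : E n → ℝ} {B C M : ℝ} {U V : Set (E n)}

/-- The correlation of a kernel `s` with a function `k`. Stencil functions are sums of
correlations. -/
noncomputable def correlation (s k : E n → ℝ) (x : E n) : ℝ := ∫ y, s y * k (x + y)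

lemma integrable_mul_comp_add_left (hs : Integrable s) (hk : AEStronglyMeasurable k volume)
    (hC : ∀ᵐ z, |k z| ≤ C) (x : E n) : Integrable fun y => s y * k (x + y) := by
  have hmp := measurePreserving_add_left (volume : Measure (E n)) x
  exact hs.mul_bdd (c := C) (hk.comp_measurePreserving hmp) (hmp.quasiMeasurePreserving.ae hC)

lemma correlation_eq_mollify (s k : E n → ℝ) : correlation s k = mollify (fun y => s (-y)) k := by
  ext x
  rw [correlation, mollify, ← integral_add_left_eq_self (fun t => s (-(x - t)) * k t) x]
  simp only [sub_add_cancel_left, neg_neg]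

lemma continuous_correlation_of_hasCompactSupport (hs : HasCompactSupport s) (hsc : Continuous s)
    (hk : LocallyIntegrable k) : Continuous (correlation s k) := by
  rw [correlation_eq_mollify, mollify_eq_convolution]
  exact HasCompactSupport.continuous_convolution_left _
    (hs.comp_homeomorph (Homeomorph.neg (E n))) (hsc.comp continuous_neg) hk

lemma continuous_correlation (hs : Integrable s) (hk : AEStronglyMeasurable k volume)
    (hC : ∀ᵐ z, |k z| ≤ C) : Continuous (correlation s k) := by
  have hkloc : LocallyIntegrable k := by
    refine MeasureTheory.locallyIntegrable_iff.mpr fun K hK => ?_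
    have : IsFiniteMeasure (volume.restrict K) := ⟨by simpa using hK.measure_lt_top⟩
    exact Integrable.of_bound hk.restrict C (ae_restrict_of_ae hC)
  have hC0 : 0 ≤ C := by
    obtain ⟨z, hz⟩ := hC.exists
    exact (abs_nonneg _).trans hz
  refine continuous_of_uniform_approx_of_continuous fun u hu => ?_
  obtain ⟨ε, hε, hεu⟩ := Metric.mem_uniformity_dist.mp hu
  obtain ⟨χ, hχs, hχ, hχc, hχi⟩ := hs.exists_hasCompactSupport_integral_sub_le
    (ε := ε / (2 * (C + 1))) (by positivity)
  refine ⟨correlation χ k, continuous_correlation_of_hasCompactSupport hχs hχc hkloc,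
    fun x => hεu ?_⟩
  have hmp := measurePreserving_add_left (volume : Measure (E n)) x
  rw [Real.dist_eq, correlation, correlation,
    ← integral_sub (integrable_mul_comp_add_left hs hk hC x)
      (integrable_mul_comp_add_left hχi hk hC x), ← Real.norm_eq_abs]
  calc ‖∫ y, (s y * k (x + y) - χ y * k (x + y))‖ ≤ ∫ y, ‖s y - χ y‖ * C := by
        refine norm_integral_le_of_norm_le ((hs.sub hχi).norm.mul_const C) ?_
        filter_upwards [hmp.quasiMeasurePreserving.ae hC] with y hy
        rw [← sub_mul, norm_mul]
        exact mul_le_mul_of_nonneg_left hy (norm_nonneg _)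
    _ = (∫ y, ‖s y - χ y‖) * C := integral_mul_const _ _
    _ ≤ ε / (2 * (C + 1)) * C := mul_le_mul_of_nonneg_right hχ hC0
    _ < ε := by
        rw [div_mul_eq_mul_div, div_lt_iff₀ (by positivity)]
        nlinarith

lemma abs_correlation_sub_le (hV : MeasurableSet V) (hVfin : volume V ≠ ⊤) {x : E n}
    (hsk : Integrable fun y => s y * k (x + y)) (hsk' : Integrable fun y => s y * k' (x + y))
    (hs : ∀ y, |s y| ≤ V.indicator (fun _ => M) y) (hx : ∀ y ∈ V, x + y ∈ U)
    (hB : ∀ᵐ z, z ∈ U → |k z - k' z| ≤ B) :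
    |correlation s k x - correlation s k' x| ≤ M * B * (volume V).toReal := by
  have hmp := measurePreserving_add_left (volume : Measure (E n)) x
  have hconst : ∫ y, V.indicator (fun _ => M * B) y = M * B * (volume V).toReal := by
    rw [integral_indicator hV, setIntegral_const, smul_eq_mul, mul_comm]
    rfl
  rw [correlation, correlation, ← integral_sub hsk hsk', ← hconst, ← Real.norm_eq_abs]
  refine norm_integral_le_of_norm_le
    ((integrable_indicator_iff hV).mpr (integrableOn_const hVfin)) ?_
  filter_upwards [hmp.quasiMeasurePreserving.ae hB] with y hy
  rw [← mul_sub, norm_mul, Real.norm_eq_abs, Real.norm_eq_abs]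
  have hsy := hs y
  by_cases hyV : y ∈ V
  · rw [indicator_of_mem hyV] at hsy ⊢
    exact mul_le_mul hsy (hy (hx y hyV)) (abs_nonneg _) ((abs_nonneg _).trans hsy)
  · rw [indicator_of_notMem hyV] at hsy ⊢
    rw [le_antisymm hsy (abs_nonneg _), zero_mul]

lemma totalDegree_aeval_X_add_C_X_le {σ R : Type*} [CommSemiring R] (p : MvPolynomial σ R) :
    (MvPolynomial.aeval (fun a => MvPolynomial.X a + MvPolynomial.C (MvPolynomial.X a)) p :
      MvPolynomial σ (MvPolynomial σ R)).totalDegree ≤ p.totalDegree := by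
  have hlin (a : σ) : (MvPolynomial.X a + MvPolynomial.C (MvPolynomial.X a) :
      MvPolynomial σ (MvPolynomial σ R)).totalDegree ≤ 1 := by
    refine (MvPolynomial.totalDegree_add _ _).trans (max_le ?_ ?_)
    · exact MvPolynomial.totalDegree_monomial_le _ _ |>.trans (by simp)
    · rw [MvPolynomial.totalDegree_C]
      exact zero_le_one
  rw [MvPolynomial.aeval_def, MvPolynomial.eval₂_eq]
  refine MvPolynomial.totalDegree_finsetSum_le fun d hd =>
    (MvPolynomial.totalDegree_mul _ _).trans ?_
  rw [MvPolynomial.algebraMap_apply, MvPolynomial.totalDegree_C, zero_add]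
  calc _ ≤ ∑ a ∈ d.support, ((MvPolynomial.X a + MvPolynomial.C (MvPolynomial.X a) :
        MvPolynomial σ (MvPolynomial σ R)) ^ d a).totalDegree :=
        MvPolynomial.totalDegree_finsetProd _ _
    _ ≤ ∑ a ∈ d.support, d a := Finset.sum_le_sum fun a _ =>
        (MvPolynomial.totalDegree_pow _ _).trans (mul_le_of_le_one_right (d a).zero_le (hlin a))
    _ ≤ p.totalDegree := MvPolynomial.le_totalDegree hd

lemma continuous_poly_eval (p : MvPolynomial (Fin n) ℝ) :
    Continuous fun x : E n => MvPolynomial.eval (fun a => x a) p :=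
  (MvPolynomial.continuous_eval p).comp
    (by fun_prop : Continuous fun x : E n => (fun a => x a : Fin n → ℝ))

lemma integrable_mul_of_continuous_of_isBounded (hV : Bornology.IsBounded V) (hs : Integrable s)
    (hsV : Function.support s ⊆ V) {f : E n → ℝ} (hf : Continuous f) :
    Integrable fun y => s y * f y := by
  rw [← integrableOn_iff_integrable_of_support_subset
    ((Function.support_mul_subset_left s f).trans (hsV.trans subset_closure))]
  exact hs.integrableOn.mul_continuousOn hf.continuousOn hV.isCompact_closure

lemma exists_poly_eval_eq_correlation (hV : Bornology.IsBounded V) (hs : Integrable s)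
    (hsV : Function.support s ⊆ V) (p : MvPolynomial (Fin n) ℝ) :
    ∃ p' : MvPolynomial (Fin n) ℝ, p'.totalDegree ≤ p.totalDegree ∧ ∀ x : E n,
      MvPolynomial.eval (fun a => x a) p' =
        correlation s (fun z => MvPolynomial.eval (fun a => z a) p) x := by
  let Q : MvPolynomial (Fin n) (MvPolynomial (Fin n) ℝ) :=
    MvPolynomial.aeval (fun a => MvPolynomial.X a + MvPolynomial.C (MvPolynomial.X a)) p
  have hQ (x y : E n) : MvPolynomial.eval (fun a => (x + y) a) p =
      ∑ d ∈ Q.support, MvPolynomial.eval (fun a => y a) (Q.coeff d) * ∏ a, x a ^ d a := by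
    rw [← MvPolynomial.eval₂_eq', ← MvPolynomial.coe_eval₂Hom, MvPolynomial.map_aeval]
    refine MvPolynomial.eval₂Hom_congr (RingHom.ext fun c => ?_) (funext fun a => ?_) rfl
    · simp
    · simp
  have hint (d : Fin n →₀ ℕ) :=
    integrable_mul_of_continuous_of_isBounded hV hs hsV (continuous_poly_eval (Q.coeff d))
  refine ⟨∑ d ∈ Q.support, MvPolynomial.monomial d
    (∫ y, s y * MvPolynomial.eval (fun a => y a) (Q.coeff d)), ?_, fun x => ?_⟩
  · refine MvPolynomial.totalDegree_finsetSum_le fun d hd =>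
      (MvPolynomial.totalDegree_monomial_le _ _).trans ?_
    exact (MvPolynomial.le_totalDegree hd).trans (totalDegree_aeval_X_add_C_X_le p)
  · simp_rw [correlation, hQ, Finset.mul_sum, ← mul_assoc]
    rw [integral_finsetSum _ fun d _ => (hint d).mul_const _]
    simp only [integral_mul_const, map_sum, MvPolynomial.eval_monomial,
      Finsupp.prod_fintype _ _ fun _ => pow_zero _]

lemma exists_poly_abs_correlation_sub_le (hV : MeasurableSet V) (hVb : Bornology.IsBounded V)
    (hs : Integrable s) (hsM : ∀ y, |s y| ≤ V.indicator (fun _ => M) y) (hU : IsOpen U)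
    (hconv : Convex ℝ U) (hUb : Bornology.IsBounded U) {r : ℕ} (hk : MemSobolevInf U (r + 1) k) :
    ∃ p : MvPolynomial (Fin n) ℝ, p.totalDegree ≤ r ∧ ∀ x : E n, (∀ y ∈ V, x + y ∈ U) →
      |correlation s (U.indicator k) x - MvPolynomial.eval (fun a => x a) p| ≤
        M * ((n * Metric.diam U) ^ (r + 1) * (sobolevInfSeminorm U (r + 1) k).toReal) *
          (volume V).toReal := by
  have hsV : Function.support s ⊆ V := fun y hy => by
    by_contra hyV
    exact hy (abs_nonpos_iff.mp ((hsM y).trans_eq (indicator_of_notMem hyV _)))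
  obtain ⟨C, hC⟩ := hk.exists_ae_abs_indicator_le hU.measurableSet
  obtain ⟨p, hp, hpk⟩ := hk.exists_poly_ae_abs_sub_le hU hconv hUb.measure_lt_top.ne
    fun x hx y hy => Metric.dist_le_diam_of_mem hUb hx hy
  obtain ⟨p', hp', hpx⟩ := exists_poly_eval_eq_correlation hVb hs hsV p
  refine ⟨p', hp'.trans hp, fun x hx => ?_⟩
  rw [hpx]
  refine abs_correlation_sub_le hV hVb.measure_lt_top.ne
    (integrable_mul_comp_add_left hs
      ((aestronglyMeasurable_indicator_iff hU.measurableSet).mpr hk.1.aestronglyMeasurable) hC x)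
    (integrable_mul_of_continuous_of_isBounded hVb hs hsV
      ((continuous_poly_eval p).comp (continuous_const_add x))) hsM hx ?_
  filter_upwards [hpk] with z hz hzU
  rw [indicator_of_mem hzU]
  exact hz hzU

end Correlation

/-! ### Stencil functions and their projections -/

section BrokenSobolev

variable {n k : ℕ} {K : E n → Matrix (Fin n) (Fin n) ℝ} {𝒯 : Finset (Simplex n)}

lemma seminorm_le_brokenSeminorm {T : Simplex n} (hT : T ∈ 𝒯) (k : ℕ) (a c : Fin n) :
    sobolevInfSeminorm (openSimplex T) k (fun x => K x a c) ≤ brokenSeminorm K 𝒯 k :=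
  le_iSup₂_of_le T hT (le_iSup₂_of_le a c le_rfl)

lemma MemBrokenSobolev.brokenSeminorm_ne_top (hK : MemBrokenSobolev K 𝒯 k) :
    brokenSeminorm K 𝒯 k ≠ ⊤ := by
  have hsum : ∑ T ∈ 𝒯, ∑ a, ∑ c, sobolevInfSeminorm (openSimplex T) k (fun x => K x a c) ≠ ⊤ :=
    ENNReal.sum_ne_top.mpr fun T hT => ENNReal.sum_ne_top.mpr fun a _ =>
      ENNReal.sum_ne_top.mpr fun c _ => (hK T hT a c).seminorm_ne_top
  refine ne_top_of_le_ne_top hsum (iSup₂_le fun T hT => iSup₂_le fun a c => ?_)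
  refine le_trans ?_ (Finset.single_le_sum_of_canonicallyOrdered hT)
  refine le_trans ?_ (Finset.single_le_sum_of_canonicallyOrdered (Finset.mem_univ a))
  exact Finset.single_le_sum_of_canonicallyOrdered
    (f := fun c => sobolevInfSeminorm (openSimplex T) k fun x => K x a c) (Finset.mem_univ c)

end BrokenSobolev

section PolyProjection

variable {n q : ℕ} {S : Set (E n)} {Λ B : ℝ} {P : (E n → ℝ) → E n → ℝ} {f : E n → ℝ}

lemma IsPolyProjection.abs_sub_le (hP : IsPolyProjection S q Λ P) (hf : ContinuousOn f S)
    {p : MvPolynomial (Fin n) ℝ} (hp : p.totalDegree ≤ q)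
    (hB : ∀ x ∈ S, |f x - MvPolynomial.eval (fun a => x a) p| ≤ B) {x : E n} (hx : x ∈ S) :
    |f x - P f x| ≤ (1 + |Λ|) * B := by
  set e : E n → ℝ := fun x => MvPolynomial.eval (fun a => x a) p with he
  have he_cont : ContinuousOn e S := (continuous_poly_eval p).continuousOn
  have hsub_cont : ContinuousOn (f - e) S := hf.sub he_cont
  have hsplit : P f x = P (f - e) x + e x := by
    have hadd := hP.map_add (f - e) e hsub_cont he_cont hx
    rwa [sub_add_cancel, Pi.add_apply, he, hP.apply_poly p hp hx] at hadd
  have hbound : |P (f - e) x| ≤ |Λ| * B :=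
    (hP.bound (f - e) B hsub_cont hB x hx).trans
      (mul_le_mul_of_nonneg_right (le_abs_self Λ) ((abs_nonneg _).trans (hB x hx)))
  calc |f x - P f x| = |(f x - e x) - P (f - e) x| := by rw [hsplit]; congr 1; ring
    _ ≤ |f x - e x| + |P (f - e) x| := abs_sub _ _
    _ ≤ B + |Λ| * B := add_le_add (hB x hx) hbound
    _ = (1 + |Λ|) * B := by ring

end PolyProjection

section Stencil

variable {n m : ℕ} {Ω : Set (E n)} {𝒯 : Finset (Simplex n)}
  {b : AffineBasis (Fin (n + 1)) ℝ (E n)} {K : E n → Matrix (Fin n) (Fin n) ℝ}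

lemma measurable_gradient_apply (f : E n → ℝ) (a : Fin n) : Measurable fun x => gradient f x a :=
  (by fun_prop : Continuous fun u : E n => u a).measurable.comp
    ((InnerProductSpace.toDual ℝ (E n)).symm.continuous.measurable.comp (measurable_fderiv ℝ f))

lemma exists_norm_gradient_kuhnHat_le (b : AffineBasis (Fin (n + 1)) ℝ (E n)) (m : ℕ) :
    ∃ C, ∀ u, ‖gradient (kuhnHat b m) u‖ ≤ C := by
  obtain ⟨c, hc⟩ := openSimplex_basis_nonempty b
  obtain ⟨r, hr, hball⟩ := Metric.isOpen_iff.mp (isOpen_openSimplex b) c hc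
  have hball' : Metric.ball c ((2 * r) / 2) ⊆ closedSimplex b := by
    rw [mul_div_cancel_left₀ _ two_ne_zero]
    exact hball.trans (openSimplex_subset b)
  exact ⟨_, norm_gradient_kuhnHat_le (by positivity) hball'⟩

/-- The kernel `(∇φ_δ)_a (∇φ)_c` on `Ω_δ`, extended by zero: the stencil function is the sum over
`a` and `c` of the correlations of these kernels with the entries `K_ac`. -/
noncomputable def stencilKernel (𝒯 : Finset (Simplex n)) (m : ℕ) (T : Simplex n) (δ : E n)
    (a c : Fin n) : E n → ℝ :=
  (overlap 𝒯 m T δ).indicator fun y =>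
    gradient (refFunShift 𝒯 m T δ) y a * gradient (refFun 𝒯 m T) y c

variable (hn : n = 1 ∨ n = 2 ∨ n = 3) (hM : IsMacroMesh Ω 𝒯) (hb : ⇑b ∈ 𝒯)
  (hne : (interiorLattice b m).Nonempty)
include hn hM hb hne

lemma isBounded_overlap (δ : E n) : Bornology.IsBounded (overlap 𝒯 m b δ) := by
  obtain ⟨p, hp⟩ := hne
  refine ((Homeomorph.addLeft p).isCompact_preimage.mpr
    (isCompact_closedSimplex b)).isBounded.subset fun y hy => ?_
  rw [overlap_eq hn hM hb ⟨p, hp⟩] at hy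
  exact openSimplex_subset _
    (mem_openSimplex_of_kuhnHat_ne_zero hp ((add_sub_cancel_left p y).symm ▸ hy.1))

lemma gradient_refFunShift (δ y : E n) :
    gradient (refFunShift 𝒯 m b δ) y = gradient (kuhnHat b m) (y - δ) := by
  rw [← gradient_comp_sub_right, ← refFun_eq_kuhnHat hn hM hb hne]
  rfl

lemma abs_stencilKernel_le {G : ℝ} (hG : ∀ u, ‖gradient (kuhnHat b m) u‖ ≤ G) (δ : E n)
    (a c : Fin n) (y : E n) :
    |stencilKernel 𝒯 m b δ a c y| ≤ (overlap 𝒯 m b δ).indicator (fun _ => G ^ 2) y := by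
  have hG0 : 0 ≤ G := (norm_nonneg _).trans (hG 0)
  rw [stencilKernel]
  by_cases hy : y ∈ overlap 𝒯 m b δ
  · rw [indicator_of_mem hy, indicator_of_mem hy, abs_mul, sq, gradient_refFunShift hn hM hb hne,
      refFun_eq_kuhnHat hn hM hb hne]
    exact mul_le_mul ((PiLp.norm_apply_le _ a).trans (hG _)) ((PiLp.norm_apply_le _ c).trans (hG y))
      (abs_nonneg _) hG0
  · rw [indicator_of_notMem hy, indicator_of_notMem hy, abs_zero]

lemma integrable_stencilKernel (δ : E n) (a c : Fin n) :
    Integrable (stencilKernel 𝒯 m b δ a c) := by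
  obtain ⟨G, hG⟩ := exists_norm_gradient_kuhnHat_le b m
  have hV : MeasurableSet (overlap 𝒯 m b δ) := (isOpen_overlap hn hM hb hne).measurableSet
  have hbound : Integrable ((overlap 𝒯 m b δ).indicator fun _ => G ^ 2) :=
    (integrable_indicator_iff hV).mpr
      (integrableOn_const (isBounded_overlap hn hM hb hne δ).measure_lt_top.ne)
  refine hbound.mono' ?_ (ae_of_all _ (abs_stencilKernel_le hn hM hb hne hG δ a c))
  exact (((measurable_gradient_apply _ a).mul (measurable_gradient_apply _ c)).indicator
    hV).aestronglyMeasurable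

variable {k : ℕ} (hK : MemBrokenSobolev K 𝒯 k)
include hK

lemma stencil_eq_sum_correlation {δ x : E n} (hx : x ∈ stencilDomain 𝒯 m b δ) :
    stencil K 𝒯 m b δ x = ∑ a, ∑ c, correlation (stencilKernel 𝒯 m b δ a c)
      ((openSimplex b).indicator fun z => K z a c) x := by
  have hU : MeasurableSet (openSimplex b) := (isOpen_openSimplex b).measurableSet
  have hint (a c) : Integrable fun y => stencilKernel 𝒯 m b δ a c y *
      (openSimplex b).indicator (fun z => K z a c) (x + y) := by
    obtain ⟨C, hC⟩ := (hK _ hb a c).exists_ae_abs_indicator_le hU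
    exact integrable_mul_comp_add_left (integrable_stencilKernel hn hM hb hne δ a c)
      ((aestronglyMeasurable_indicator_iff hU).mpr (hK _ hb a c).1.aestronglyMeasurable) hC x
  simp only [correlation]
  rw [stencil, ← integral_indicator (isOpen_overlap hn hM hb hne).measurableSet]
  simp_rw [← integral_finsetSum Finset.univ fun c _ => hint _ c]
  rw [← integral_finsetSum _ fun a _ => integrable_finsetSum _ fun c _ => hint a c]
  congr 1 with y
  by_cases hy : y ∈ overlap 𝒯 m b δ
  · simp only [stencilKernel, indicator_of_mem hy,
      indicator_of_mem (add_mem_openSimplex_of_mem_stencilDomain hn hM hb hne hx hy)]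
    exact Finset.sum_congr rfl fun a _ => Finset.sum_congr rfl fun c _ => by ring
  · simp only [stencilKernel, indicator_of_notMem hy, zero_mul, Finset.sum_const_zero]

lemma continuousOn_stencil (δ : E n) :
    ContinuousOn (stencil K 𝒯 m b δ) (stencilDomain 𝒯 m b δ) := by
  have hU : MeasurableSet (openSimplex b) := (isOpen_openSimplex b).measurableSet
  refine ContinuousOn.congr (Continuous.continuousOn ?_) fun x hx =>
    stencil_eq_sum_correlation hn hM hb hne hK hx
  refine continuous_finsetSum _ fun a _ => continuous_finsetSum _ fun c _ => ?_
  obtain ⟨C, hC⟩ := (hK _ hb a c).exists_ae_abs_indicator_le hU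
  exact continuous_correlation (integrable_stencilKernel hn hM hb hne δ a c)
    ((aestronglyMeasurable_indicator_iff hU).mpr (hK _ hb a c).1.aestronglyMeasurable) hC

omit hK in
theorem abs_stencil_sub_proj_le {r q : ℕ} (hrq : r ≤ q) (hK : MemBrokenSobolev K 𝒯 (r + 1))
    {G : ℝ} (hG : ∀ u, ‖gradient (kuhnHat b m) u‖ ≤ G) {δ : E n} {Λ : ℝ}
    {P : (E n → ℝ) → E n → ℝ} (hP : IsPolyProjection (stencilDomain 𝒯 m b δ) q Λ P) {x : E n}
    (hx : x ∈ stencilDomain 𝒯 m b δ) :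
    |stencil K 𝒯 m b δ x - P (stencil K 𝒯 m b δ) x| ≤ (1 + |Λ|) * (n ^ 2 *
      (G ^ 2 * ((n * Metric.diam (closedSimplex b)) ^ (r + 1) *
        (brokenSeminorm K 𝒯 (r + 1)).toReal) * (volume (overlap 𝒯 m b δ)).toReal)) := by
  have hbdd : Bornology.IsBounded (closedSimplex b) := (isCompact_closedSimplex b).isBounded
  choose p hp hpx using fun a c => exists_poly_abs_correlation_sub_le
    (isOpen_overlap hn hM hb hne).measurableSet (isBounded_overlap hn hM hb hne δ)
    (integrable_stencilKernel hn hM hb hne δ a c) (abs_stencilKernel_le hn hM hb hne hG δ a c)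
    (isOpen_openSimplex b) (convex_openSimplex b) (hbdd.subset (openSimplex_subset _))
    (hK _ hb a c)
  refine hP.abs_sub_le (continuousOn_stencil hn hM hb hne hK δ) (p := ∑ a, ∑ c, p a c) ?_
    (fun x hx => ?_) hx
  · exact MvPolynomial.totalDegree_finsetSum_le fun a _ =>
      MvPolynomial.totalDegree_finsetSum_le fun c _ => (hp a c).trans hrq
  set D := G ^ 2 * ((n * Metric.diam (closedSimplex b)) ^ (r + 1) *
    (brokenSeminorm K 𝒯 (r + 1)).toReal) * (volume (overlap 𝒯 m b δ)).toReal with hD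
  have hentry (a c) : |correlation (stencilKernel 𝒯 m b δ a c)
      ((openSimplex b).indicator fun z => K z a c) x -
        MvPolynomial.eval (fun i => x i) (p a c)| ≤ D := by
    refine (hpx a c x fun y hy =>
      add_mem_openSimplex_of_mem_stencilDomain hn hM hb hne hx hy).trans ?_
    have hdiam := Metric.diam_mono (openSimplex_subset b) hbdd
    have hsemi := ENNReal.toReal_mono hK.brokenSeminorm_ne_top
      (seminorm_le_brokenSeminorm hb (r + 1) a c)
    rw [hD]
    gcongr
  rw [stencil_eq_sum_correlation hn hM hb hne hK hx]
  simp only [map_sum, ← Finset.sum_sub_distrib]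
  calc _ ≤ ∑ _a : Fin n, ∑ _c : Fin n, D :=
        (Finset.abs_sum_le_sum_abs _ _).trans (Finset.sum_le_sum fun a _ =>
          (Finset.abs_sum_le_sum_abs _ _).trans (Finset.sum_le_sum fun c _ => hentry a c))
    _ = n ^ 2 * D := by
        simp only [Finset.sum_const, Finset.card_univ, Fintype.card_fin, nsmul_eq_mul]
        ring

end Stencil

/-! ### The stiffness matrix -/

section Stiffness

variable {n m k : ℕ} {Ω : Set (E n)} {𝒯 : Finset (Simplex n)}
  {b : AffineBasis (Fin (n + 1)) ℝ (E n)} {K : E n → Matrix (Fin n) (Fin n) ℝ}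

/-- The common support `{φ_p ≠ 0} ∩ {φ_q ≠ 0}` of two vertex functions of the fine mesh. If `p` or
`q` lies inside a macro-element containing both, it is a translate of `Ω_δ` with `δ = q - p`. -/
def commonSupport (𝒯 : Finset (Simplex n)) (m : ℕ) (p q : E n) : Set (E n) :=
  Function.support (vertexFun (fineMesh 𝒯 m) p) ∩ Function.support (vertexFun (fineMesh 𝒯 m) q)

lemma gradient_vertexFun_eq_zero {𝒮 : Finset (Simplex n)} {p x : E n} (h : vertexFun 𝒮 p x = 0) :
    gradient (vertexFun 𝒮 p) x = 0 :=
  gradient_eq_zero_of_nonneg_of_eq_zero (vertexFun_nonneg 𝒮 p) h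

lemma sum_gradient_mul_eq_zero_of_notMem_commonSupport (K : E n → Matrix (Fin n) (Fin n) ℝ)
    {p q x : E n} (hx : x ∉ commonSupport 𝒯 m p q) :
    ∑ a, ∑ c, gradient (vertexFun (fineMesh 𝒯 m) q) x a * K x a c *
      gradient (vertexFun (fineMesh 𝒯 m) p) x c = 0 := by
  have hzero : gradient (vertexFun (fineMesh 𝒯 m) p) x = 0 ∨
      gradient (vertexFun (fineMesh 𝒯 m) q) x = 0 :=
    (not_and_or.mp hx).imp (fun h => gradient_vertexFun_eq_zero (not_not.mp h))
      fun h => gradient_vertexFun_eq_zero (not_not.mp h)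
  rcases hzero with h | h <;> simp [h]

lemma stiffness_comm (hsym : ∀ᵐ x ∂(volume.restrict Ω), (K x).IsSymm) (p q : E n) :
    stiffness Ω K 𝒯 m p q = stiffness Ω K 𝒯 m q p := by
  refine integral_congr_ae ?_
  filter_upwards [hsym] with x hx
  rw [Finset.sum_comm]
  refine Finset.sum_congr rfl fun a _ => Finset.sum_congr rfl fun c _ => ?_
  rw [← hx.apply a c]
  ring

lemma IsMacroMesh.volume_ne_top (hM : IsMacroMesh Ω 𝒯) : volume Ω ≠ ⊤ := by
  have hsub : Ω ⊆ ⋃ y ∈ 𝒯, closedSimplex y := hM.cover ▸ subset_closure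
  refine ((measure_mono hsub).trans_lt ?_).ne
  exact (𝒯.finite_toSet.isCompact_biUnion fun y _ => isCompact_closedSimplex y).measure_lt_top

variable (hn : n = 1 ∨ n = 2 ∨ n = 3) (hM : IsMacroMesh Ω 𝒯)
include hn hM

lemma MemBrokenSobolev.aestronglyMeasurable (hK : MemBrokenSobolev K 𝒯 k) (a c : Fin n) :
    AEStronglyMeasurable (fun x => K x a c) (volume.restrict Ω) := by
  have hunion : AEStronglyMeasurable (fun x => K x a c)
      (volume.restrict (⋃ T : 𝒯, openSimplex T.1)) :=
    AEStronglyMeasurable.iUnion fun T => (hK T.1 T.2 a c).1.aestronglyMeasurable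
  refine hunion.mono_measure (Measure.restrict_mono_ae ?_)
  filter_upwards [ae_mem_openSimplex hn hM] with x hx hxΩ
  obtain ⟨T, hT, hxT⟩ := hx hxΩ
  exact mem_iUnion.mpr ⟨⟨T, hT⟩, hxT⟩

section VertexGradient

variable (hb : ⇑b ∈ 𝒯)
include hb

lemma gradient_vertexFun_eq {x : E n} (hx : x ∈ openSimplex b) {q : E n} (hq : q ∈ lattice b m) :
    gradient (vertexFun (fineMesh 𝒯 m) q) x = gradient (kuhnHat b m) (x - q) := by
  rw [← gradient_comp_sub_right]
  refine Filter.EventuallyEq.gradient_eq ?_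
  filter_upwards [(isOpen_openSimplex b).mem_nhds hx] with y hy
  exact vertexFun_eq_kuhnHat hn hM hb hy hq

lemma isOpen_openSimplex_inter_support_vertexFun (p : E n) :
    IsOpen (openSimplex b ∩ Function.support (vertexFun (fineMesh 𝒯 m) p)) := by
  by_cases hp : p ∈ lattice b m
  · have heq : openSimplex b ∩ Function.support (vertexFun (fineMesh 𝒯 m) p) =
        openSimplex b ∩ {x | kuhnHat b m (x - p) ≠ 0} := by
      ext x
      refine and_congr_right fun hx => ?_
      rw [Function.mem_support, vertexFun_eq_kuhnHat hn hM hb hx hp, mem_ofPred_eq]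
    rw [heq]
    exact (isOpen_openSimplex b).inter
      (isOpen_ne_fun (continuous_kuhnHat.comp (continuous_sub_right p)) continuous_const)
  · convert isOpen_empty
    exact eq_empty_of_forall_notMem fun x hx => hx.2 (vertexFun_eq_zero hn hM hb hx.1 hp)

end VertexGradient

variable (hΩ : IsOpen Ω)
include hΩ

lemma ae_restrict_mem_openSimplex :
    ∀ᵐ x ∂(volume.restrict Ω), ∃ T ∈ 𝒯, x ∈ openSimplex T :=
  (ae_restrict_iff' hΩ.measurableSet).mpr (ae_mem_openSimplex hn hM)

lemma nullMeasurableSet_commonSupport (p q : E n) :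
    NullMeasurableSet (commonSupport 𝒯 m p q) (volume.restrict Ω) := by
  have hsupport (p : E n) : NullMeasurableSet (Function.support (vertexFun (fineMesh 𝒯 m) p))
      (volume.restrict Ω) := by
    have hopen : IsOpen (⋃ T ∈ 𝒯, openSimplex T ∩
        Function.support (vertexFun (fineMesh 𝒯 m) p)) := by
      refine isOpen_biUnion fun T hT => ?_
      obtain ⟨b, rfl⟩ := hM.exists_basis hT
      exact isOpen_openSimplex_inter_support_vertexFun hn hM hT p
    refine hopen.measurableSet.nullMeasurableSet.congr (Filter.eventuallyEq_set.mpr ?_)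
    filter_upwards [ae_restrict_mem_openSimplex hn hM hΩ] with x hx
    simp only [mem_iUnion, mem_inter_iff, exists_prop]
    exact ⟨fun ⟨_, _, _, h⟩ => h, fun h => hx.imp fun T hT => ⟨hT.1, hT.2, h⟩⟩
  exact (hsupport p).inter (hsupport q)

lemma exists_ae_norm_gradient_vertexFun_le (m : ℕ) (q : E n) :
    ∃ C, ∀ᵐ x ∂(volume.restrict Ω), ‖gradient (vertexFun (fineMesh 𝒯 m) q) x‖ ≤ C := by
  have hlocal : ∀ T ∈ 𝒯, ∃ C, 0 ≤ C ∧
      ∀ x ∈ openSimplex T, ‖gradient (vertexFun (fineMesh 𝒯 m) q) x‖ ≤ C := by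
    intro T hT
    obtain ⟨b, rfl⟩ := hM.exists_basis hT
    obtain ⟨C, hC⟩ := exists_norm_gradient_kuhnHat_le b m
    have hC0 : 0 ≤ C := (norm_nonneg _).trans (hC 0)
    refine ⟨C, hC0, fun x hx => ?_⟩
    by_cases hq : q ∈ lattice b m
    · exact gradient_vertexFun_eq hn hM hT hx hq ▸ hC _
    · rwa [gradient_vertexFun_eq_zero (vertexFun_eq_zero hn hM hT hx hq), norm_zero]
  choose! C hC0 hC using hlocal
  refine ⟨∑ T ∈ 𝒯, C T, ?_⟩
  filter_upwards [ae_restrict_mem_openSimplex hn hM hΩ] with x ⟨T, hT, hxT⟩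
  exact (hC T hT x hxT).trans (Finset.single_le_sum hC0 hT)

variable (hK : MemBrokenSobolev K 𝒯 k)
include hK

lemma MemBrokenSobolev.exists_ae_abs_le (a c : Fin n) :
    ∃ C, ∀ᵐ x ∂(volume.restrict Ω), |K x a c| ≤ C := by
  have hlocal := fun T (hT : T ∈ 𝒯) =>
    (hK T hT a c).exists_ae_abs_indicator_le (isOpen_openSimplex T).measurableSet
  choose! C hC using hlocal
  refine ⟨∑ T ∈ 𝒯, |C T|, ?_⟩
  filter_upwards [ae_restrict_mem_openSimplex hn hM hΩ,
    ae_restrict_of_ae ((Filter.eventually_all_finset 𝒯).mpr hC)] with x ⟨T, hT, hxT⟩ hbound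
  calc |K x a c| = |(openSimplex T).indicator (fun x => K x a c) x| := by
        rw [indicator_of_mem hxT]
    _ ≤ |C T| := (hbound T hT).trans (le_abs_self _)
    _ ≤ ∑ T ∈ 𝒯, |C T| := Finset.single_le_sum (f := fun T => |C T|) (fun _ _ => abs_nonneg _) hT

lemma integrableOn_gradient_mul_mul_gradient (p q : E n) (a c : Fin n) :
    IntegrableOn (fun x => gradient (vertexFun (fineMesh 𝒯 m) q) x a * K x a c *
      gradient (vertexFun (fineMesh 𝒯 m) p) x c) Ω := by
  obtain ⟨Cq, hq⟩ := exists_ae_norm_gradient_vertexFun_le hn hM hΩ m q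
  obtain ⟨Cp, hp⟩ := exists_ae_norm_gradient_vertexFun_le hn hM hΩ m p
  obtain ⟨CK, hCK⟩ := hK.exists_ae_abs_le hn hM hΩ a c
  have : IsFiniteMeasure (volume.restrict Ω) :=
    ⟨by simpa only [Measure.restrict_apply_univ] using hM.volume_ne_top.lt_top⟩
  refine Integrable.of_bound (((measurable_gradient_apply _ a).aestronglyMeasurable.mul
    (hK.aestronglyMeasurable hn hM a c)).mul
    (measurable_gradient_apply _ c).aestronglyMeasurable) (Cq * CK * Cp) ?_
  filter_upwards [hp, hq, hCK] with x hp hq hCK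
  rw [norm_mul, norm_mul]
  have hq' := (PiLp.norm_apply_le _ a).trans hq
  have hp' := (PiLp.norm_apply_le _ c).trans hp
  have hCq0 := (norm_nonneg _).trans hq
  exact mul_le_mul (mul_le_mul hq' hCK (norm_nonneg _) hCq0) hp' (norm_nonneg _)
    (mul_nonneg hCq0 ((abs_nonneg _).trans hCK))

lemma integrableOn_sum_gradient_mul_mul_gradient (p q : E n) :
    IntegrableOn (fun x => ∑ a, ∑ c, gradient (vertexFun (fineMesh 𝒯 m) q) x a * K x a c *
      gradient (vertexFun (fineMesh 𝒯 m) p) x c) Ω :=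
  integrable_finsetSum _ fun a _ => integrable_finsetSum _ fun c _ =>
    integrableOn_gradient_mul_mul_gradient hn hM hΩ hK p q a c

variable {v : E n → ℝ} {g : E n → E n}
  (hreg : ∀ᵐ x ∂(volume.restrict Ω), IsRegularPoint 𝒯 m v g x)
include hreg

lemma sum_stiffness_eq_zero (p : E n) : ∑ q ∈ vertices 𝒯 m, stiffness Ω K 𝒯 m p q = 0 := by
  simp only [stiffness, poissonForm]
  rw [← integral_finsetSum _ fun q _ =>
    integrableOn_sum_gradient_mul_mul_gradient hn hM hΩ hK p q]
  refine integral_eq_zero_of_ae ?_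
  filter_upwards [hreg] with x hx
  have hsum (a : Fin n) :
      ∑ q ∈ vertices 𝒯 m, gradient (vertexFun (fineMesh 𝒯 m) q) x a = 0 := by
    simpa only [WithLp.ofLp_sum, Finset.sum_apply, PiLp.zero_apply] using
      congrArg (fun u : E n => u a) hx.sum_grad
  rw [Finset.sum_comm]
  refine Finset.sum_eq_zero fun a _ => ?_
  rw [Finset.sum_comm]
  refine Finset.sum_eq_zero fun c _ => ?_
  simp_rw [mul_assoc]
  rw [← Finset.sum_mul, hsum, zero_mul]

lemma poissonForm_eq_sum_stiffness : poissonForm Ω K g g =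
    ∑ p ∈ vertices 𝒯 m, ∑ q ∈ vertices 𝒯 m, stiffness Ω K 𝒯 m p q * v q * v p := by
  have hint (p q : E n) : IntegrableOn (fun x => (∑ a, ∑ c,
      gradient (vertexFun (fineMesh 𝒯 m) q) x a * K x a c *
        gradient (vertexFun (fineMesh 𝒯 m) p) x c) * v q * v p) Ω :=
    ((integrableOn_sum_gradient_mul_mul_gradient hn hM hΩ hK p q).mul_const _).mul_const _
  simp only [stiffness, poissonForm]
  simp_rw [← integral_mul_const, ← integral_finsetSum _ fun q _ => hint _ q]
  rw [← integral_finsetSum _ fun p _ => integrable_finsetSum _ fun q _ => hint p q]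
  refine integral_congr_ae ?_
  filter_upwards [hreg] with x hx
  have hcoord (a : Fin n) : g x a = ∑ q ∈ vertices 𝒯 m,
      v q * gradient (vertexFun (fineMesh 𝒯 m) q) x a := by
    simpa only [WithLp.ofLp_sum, Finset.sum_apply, PiLp.smul_apply, smul_eq_mul] using
      congrArg (fun u : E n => u a) hx.grad_eq
  calc ∑ a, ∑ c, g x a * K x a c * g x c = ∑ a, ∑ c, ∑ p ∈ vertices 𝒯 m, ∑ q ∈ vertices 𝒯 m,
        gradient (vertexFun (fineMesh 𝒯 m) q) x a * K x a c *
          gradient (vertexFun (fineMesh 𝒯 m) p) x c * v q * v p := by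
        refine Finset.sum_congr rfl fun a _ => Finset.sum_congr rfl fun c _ => ?_
        rw [hcoord a, hcoord c, Finset.mul_sum]
        refine Finset.sum_congr rfl fun p _ => ?_
        rw [Finset.sum_mul, Finset.sum_mul]
        exact Finset.sum_congr rfl fun q _ => by ring
    _ = _ := by
        simp_rw [Finset.sum_mul]
        rw [Finset.sum_congr rfl fun a _ => Finset.sum_comm, Finset.sum_comm]
        refine Finset.sum_congr rfl fun p _ => ?_
        rw [Finset.sum_congr rfl fun a _ => Finset.sum_comm, Finset.sum_comm]

end Stiffness

/-! ### Stencil functions as translated stiffness entries -/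

section InteriorPair

variable {n m : ℕ} {Ω : Set (E n)} {𝒯 : Finset (Simplex n)}
  {b : AffineBasis (Fin (n + 1)) ℝ (E n)} (hn : n = 1 ∨ n = 2 ∨ n = 3) (hM : IsMacroMesh Ω 𝒯)
  (hb : ⇑b ∈ 𝒯) {p q : E n} (hpq : p ∈ interiorLattice b m ∨ q ∈ interiorLattice b m)
include hn hM hb hpq

lemma commonSupport_subset_openSimplex : commonSupport 𝒯 m p q ⊆ openSimplex b := by
  intro x hx
  by_contra hxb
  rcases hpq with h | h
  · exact hx.1 (vertexFun_eq_zero_of_notMem_openSimplex hn hM hb h hxb)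
  · exact hx.2 (vertexFun_eq_zero_of_notMem_openSimplex hn hM hb h hxb)

lemma commonSupport_subset_domain : commonSupport 𝒯 m p q ⊆ Ω :=
  (commonSupport_subset_openSimplex hn hM hb hpq).trans (hM.subset _ hb)

lemma isOpen_commonSupport : IsOpen (commonSupport 𝒯 m p q) := by
  rw [← inter_eq_self_of_subset_right (commonSupport_subset_openSimplex hn hM hb hpq),
    commonSupport, inter_inter_distrib_left]
  exact (isOpen_openSimplex_inter_support_vertexFun hn hM hb p).inter
    (isOpen_openSimplex_inter_support_vertexFun hn hM hb q)

lemma sub_mem_directions (hne : (commonSupport 𝒯 m p q).Nonempty) :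
    q - p ∈ directions 𝒯 m b := by
  obtain ⟨x, hx⟩ := hne
  have hxb := commonSupport_subset_openSimplex hn hM hb hpq hx
  have hp : p ∈ lattice b m := not_imp_comm.mp (vertexFun_eq_zero hn hM hb hxb) hx.1
  have hq : q ∈ lattice b m := not_imp_comm.mp (vertexFun_eq_zero hn hM hb hxb) hx.2
  rcases hpq with h | h
  · exact ⟨p, h, q, hq, rfl, x, hx⟩
  · rw [← neg_sub]
    exact neg_mem_directions hn hM hb ⟨q, h, p, hp, rfl, x, hx.symm⟩

lemma stiffness_eq_setIntegral_commonSupport (hΩ : IsOpen Ω)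
    (K : E n → Matrix (Fin n) (Fin n) ℝ) :
    stiffness Ω K 𝒯 m p q = ∫ x in commonSupport 𝒯 m p q, ∑ a, ∑ c,
      gradient (vertexFun (fineMesh 𝒯 m) q) x a * K x a c *
        gradient (vertexFun (fineMesh 𝒯 m) p) x c :=
  setIntegral_eq_of_subset_of_forall_sdiff_eq_zero hΩ.measurableSet
    (commonSupport_subset_domain hn hM hb hpq)
    fun _ hx => sum_gradient_mul_eq_zero_of_notMem_commonSupport K hx.2

lemma stiffness_eq_zero (hΩ : IsOpen Ω) (K : E n → Matrix (Fin n) (Fin n) ℝ)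
    (hδ : q - p ∉ directions 𝒯 m b) : stiffness Ω K 𝒯 m p q = 0 := by
  have hempty : commonSupport 𝒯 m p q = ∅ :=
    not_nonempty_iff_eq_empty.mp (mt (sub_mem_directions hn hM hb hpq) hδ)
  rw [stiffness_eq_setIntegral_commonSupport hn hM hb hpq hΩ, hempty, Measure.restrict_empty,
    integral_zero_measure]

variable (hp : p ∈ lattice b m) (hq : q ∈ lattice b m)
include hp hq

lemma commonSupport_eq_preimage_overlap :
    commonSupport 𝒯 m p q = (fun x => -p + x) ⁻¹' overlap 𝒯 m b (q - p) := by
  have hiff {x : E n} (hx : x ∈ openSimplex b) :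
      x ∈ commonSupport 𝒯 m p q ↔ -p + x ∈ overlap 𝒯 m b (q - p) := by
    rw [overlap_eq hn hM hb (hpq.elim (⟨_, ·⟩) (⟨_, ·⟩)), commonSupport, mem_inter_iff,
      Function.mem_support, Function.mem_support, vertexFun_eq_kuhnHat hn hM hb hx hp,
      vertexFun_eq_kuhnHat hn hM hb hx hq, mem_ofPred_eq, neg_add_eq_sub, sub_sub_sub_cancel_right]
  ext x
  refine ⟨fun hx => (hiff (commonSupport_subset_openSimplex hn hM hb hpq hx)).mp hx,
    fun hx => (hiff ?_).mpr hx⟩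
  simpa only [add_neg_cancel_left] using add_mem_openSimplex_of_mem_overlap hn hM hb hpq hx

lemma volume_commonSupport : volume (commonSupport 𝒯 m p q) = volume (overlap 𝒯 m b (q - p)) := by
  rw [commonSupport_eq_preimage_overlap hn hM hb hpq hp hq, measure_preimage_add]

lemma stencil_eq_stiffness (hΩ : IsOpen Ω) (K : E n → Matrix (Fin n) (Fin n) ℝ) :
    stencil K 𝒯 m b (q - p) p = stiffness Ω K 𝒯 m p q := by
  have hne : (interiorLattice b m).Nonempty := hpq.elim (⟨_, ·⟩) (⟨_, ·⟩)
  rw [stiffness_eq_setIntegral_commonSupport hn hM hb hpq hΩ, stencil,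
    ← (measurePreserving_add_left volume (-p)).setIntegral_preimage_emb
      (measurableEmbedding_addLeft (-p)), ← commonSupport_eq_preimage_overlap hn hM hb hpq hp hq]
  refine setIntegral_congr_fun (isOpen_commonSupport hn hM hb hpq).measurableSet fun x hx => ?_
  have hxb := commonSupport_subset_openSimplex hn hM hb hpq hx
  simp only [gradient_refFunShift hn hM hb hne, refFun_eq_kuhnHat hn hM hb hne,
    gradient_vertexFun_eq hn hM hb hxb hp, gradient_vertexFun_eq hn hM hb hxb hq,
    neg_add_eq_sub, sub_sub_sub_cancel_right, add_sub_cancel]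

end InteriorPair

/-! ### The surrogate stiffness matrix -/

section SurrogateMatrix

variable {n m : ℕ} {Ω : Set (E n)} {𝒯 : Finset (Simplex n)}
  {b : AffineBasis (Fin (n + 1)) ℝ (E n)} {K : E n → Matrix (Fin n) (Fin n) ℝ}
  {P : Simplex n → E n → (E n → ℝ) → E n → ℝ}

lemma dofs_subset_vertices : dofs Ω 𝒯 m ⊆ vertices 𝒯 m := by
  classical
  exact Finset.filter_subset _ _

lemma surrogateStiffness_of_ne {p q : E n} (h : p ≠ q) :
    surrogateStiffness Ω K 𝒯 m P p q = surrogateOffDiag Ω K 𝒯 m P p q :=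
  if_neg h

open scoped Classical in
lemma sum_surrogateStiffness_eq {p : E n} (hp : p ∈ dofs Ω 𝒯 m) :
    ∑ q ∈ dofs Ω 𝒯 m, surrogateStiffness Ω K 𝒯 m P p q =
      -∑ z ∈ vertices 𝒯 m \ dofs Ω 𝒯 m, stiffness Ω K 𝒯 m p z := by
  have hoff : ∀ z ∈ (dofs Ω 𝒯 m).erase p,
      surrogateStiffness Ω K 𝒯 m P p z = surrogateOffDiag Ω K 𝒯 m P p z :=
    fun z hz => surrogateStiffness_of_ne (Finset.ne_of_mem_erase hz).symm
  rw [← Finset.add_sum_erase _ _ hp, Finset.sum_congr rfl hoff, surrogateStiffness, if_pos rfl]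
  ring

section Mesh

variable (hM : IsMacroMesh Ω 𝒯)
include hM

lemma notMem_interfaceVertices (hb : ⇑b ∈ 𝒯) {p : E n} (hp : p ∈ interiorLattice b m) :
    p ∉ interfaceVertices 𝒯 m := by
  classical
  simp only [interfaceVertices, boundaryLattice, Finset.mem_biUnion, Finset.mem_sdiff, not_exists,
    not_and, not_not]
  intro T hT hpT
  obtain ⟨b', rfl⟩ := hM.exists_basis hT
  rwa [hM.eq_of_mem hb hT (mem_interiorLattice_iff.mp hp).2
    (mem_closedSimplex_of_mem_lattice b' hpT)]

lemma exists_mem_interiorLattice {p : E n} (hp : p ∈ vertices 𝒯 m)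
    (hinterface : p ∉ interfaceVertices 𝒯 m) :
    ∃ b : AffineBasis (Fin (n + 1)) ℝ (E n), ⇑b ∈ 𝒯 ∧ p ∈ interiorLattice b m := by
  classical
  obtain ⟨T, hT, hpT⟩ := mem_vertices_iff.mp hp
  obtain ⟨b, rfl⟩ := hM.exists_basis hT
  refine ⟨b, hT, ?_⟩
  by_contra hcon
  exact hinterface (Finset.mem_biUnion.mpr ⟨_, hT, Finset.mem_sdiff.mpr ⟨hpT, hcon⟩⟩)

lemma exists_mem_interiorLattice_or {p q : E n} (hp : p ∈ vertices 𝒯 m) (hq : q ∈ vertices 𝒯 m)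
    (hinterface : ¬(p ∈ interfaceVertices 𝒯 m ∧ q ∈ interfaceVertices 𝒯 m)) :
    ∃ b : AffineBasis (Fin (n + 1)) ℝ (E n), ⇑b ∈ 𝒯 ∧
      (p ∈ interiorLattice b m ∨ q ∈ interiorLattice b m) := by
  rcases not_and_or.mp hinterface with h | h
  · exact (exists_mem_interiorLattice hM hp h).imp fun _ hb => ⟨hb.1, .inl hb.2⟩
  · exact (exists_mem_interiorLattice hM hq h).imp fun _ hb => ⟨hb.1, .inr hb.2⟩

variable (hn : n = 1 ∨ n = 2 ∨ n = 3)
include hn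

lemma mem_lattice_of_sub_mem_directions (hb : ⇑b ∈ 𝒯) {p q : E n}
    (hpq : p ∈ interiorLattice b m ∨ q ∈ interiorLattice b m) (hδ : q - p ∈ directions 𝒯 m b) :
    p ∈ lattice b m ∧ q ∈ lattice b m := by
  rcases hpq with h | h
  · exact ⟨(mem_interiorLattice_iff.mp h).1,
      add_sub_cancel p q ▸ add_direction_mem_lattice hn hM hb h hδ⟩
  · have hp := add_direction_mem_lattice hn hM hb h (neg_mem_directions hn hM hb hδ)
    rw [neg_sub, add_sub_cancel] at hp
    exact ⟨hp, (mem_interiorLattice_iff.mp h).1⟩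

lemma surrogateOffDiag_eq_ite (hb : ⇑b ∈ 𝒯) {p q : E n}
    (hpq : p ∈ interiorLattice b m ∨ q ∈ interiorLattice b m)
    [Decidable (q - p ∈ directions 𝒯 m b)] :
    surrogateOffDiag Ω K 𝒯 m P p q =
      if q - p ∈ directions 𝒯 m b then P b (q - p) (stencil K 𝒯 m b (q - p)) p else 0 := by
  classical
  have hinterface : ¬(p ∈ interfaceVertices 𝒯 m ∧ q ∈ interfaceVertices 𝒯 m) := fun h =>
    hpq.elim (notMem_interfaceVertices hM hb · h.1) (notMem_interfaceVertices hM hb · h.2)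
  have hunique : ∀ T ∈ 𝒯, T ≠ b → ¬(q - p ∈ directions 𝒯 m T ∧
      (p ∈ interiorLattice T m ∨ q ∈ interiorLattice T m)) := by
    rintro T hT hne ⟨hδ, hpqT⟩
    obtain ⟨b', rfl⟩ := hM.exists_basis hT
    obtain ⟨hp, hq⟩ := mem_lattice_of_sub_mem_directions hM hn hT hpqT hδ
    have hmem {x : E n} (hx : x ∈ lattice b' m) : x ∈ closedSimplex b' :=
      mem_closedSimplex_of_mem_lattice b' hx
    exact hne (hpq.elim (fun h => hM.eq_of_mem hb hT (mem_interiorLattice_iff.mp h).2 (hmem hp))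
      fun h => hM.eq_of_mem hb hT (mem_interiorLattice_iff.mp h).2 (hmem hq))
  rw [surrogateOffDiag, if_neg hinterface,
    Finset.sum_eq_single_of_mem _ hb fun T hT hne => if_neg (hunique T hT hne)]
  simp only [hpq, and_true]

variable {q' : ℕ} {Λ : ℝ} (hP : IsProjectionFamily K 𝒯 m q' Λ P)
  (hsym : ∀ᵐ x ∂(volume.restrict Ω), (K x).IsSymm)
include hP hsym

lemma surrogateOffDiag_comm {p q : E n} (hp : p ∈ vertices 𝒯 m) (hq : q ∈ vertices 𝒯 m) :
    surrogateOffDiag Ω K 𝒯 m P p q = surrogateOffDiag Ω K 𝒯 m P q p := by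
  classical
  by_cases hinterface : p ∈ interfaceVertices 𝒯 m ∧ q ∈ interfaceVertices 𝒯 m
  · rw [surrogateOffDiag, surrogateOffDiag, if_pos hinterface, if_pos hinterface.symm,
      stiffness_comm hsym]
  obtain ⟨b, hb, hpq⟩ := exists_mem_interiorLattice_or hM hp hq hinterface
  have hiff : p - q ∈ directions 𝒯 m b ↔ q - p ∈ directions 𝒯 m b :=
    ⟨fun h => neg_sub p q ▸ neg_mem_directions hn hM hb h,
      fun h => neg_sub q p ▸ neg_mem_directions hn hM hb h⟩
  rw [surrogateOffDiag_eq_ite hM hn hb hpq, surrogateOffDiag_eq_ite hM hn hb hpq.symm]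
  simp only [hiff]
  split_ifs with hδ
  · rw [hP.related _ hb _ hδ p (mem_stencilDomain hn hM hb hpq
      (mem_lattice_of_sub_mem_directions hM hn hb hpq hδ).1), neg_sub, add_sub_cancel]
  · rfl

lemma surrogateStiffness_comm {p q : E n} (hp : p ∈ vertices 𝒯 m) (hq : q ∈ vertices 𝒯 m) :
    surrogateStiffness Ω K 𝒯 m P p q = surrogateStiffness Ω K 𝒯 m P q p := by
  rcases eq_or_ne p q with rfl | h
  · rfl
  · rw [surrogateStiffness_of_ne h, surrogateStiffness_of_ne h.symm,
      surrogateOffDiag_comm hM hn hP hsym hp hq]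

end Mesh

end SurrogateMatrix

/-! ### The consistency error -/

section FiniteSums

lemma two_mul_sum_mul_mul_eq_of_row_sum_eq_zero {ι R : Type*} [CommRing R] {D : Finset ι}
    {M : ι → ι → R} (hsymm : ∀ p ∈ D, ∀ q ∈ D, M p q = M q p)
    (hrow : ∀ p ∈ D, ∑ q ∈ D, M p q = 0) (v : ι → R) :
    2 * ∑ p ∈ D, ∑ q ∈ D, M p q * v q * v p = -∑ p ∈ D, ∑ q ∈ D, M p q * (v q - v p) ^ 2 := by
  have hleft : ∑ p ∈ D, ∑ q ∈ D, M p q * v p ^ 2 = 0 :=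
    Finset.sum_eq_zero fun p hp => by rw [← Finset.sum_mul, hrow p hp, zero_mul]
  have hright : ∑ p ∈ D, ∑ q ∈ D, M p q * v q ^ 2 = 0 := by
    rw [Finset.sum_comm, ← hleft]
    exact Finset.sum_congr rfl fun p hp => Finset.sum_congr rfl fun q hq => by rw [hsymm q hq p hp]
  have hexpand : ∑ p ∈ D, ∑ q ∈ D, M p q * (v q - v p) ^ 2 =
      ∑ p ∈ D, ∑ q ∈ D, M p q * v q ^ 2 + ∑ p ∈ D, ∑ q ∈ D, M p q * v p ^ 2 -
        2 * ∑ p ∈ D, ∑ q ∈ D, M p q * v q * v p := by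
    simp_rw [Finset.mul_sum, ← Finset.sum_add_distrib, ← Finset.sum_sub_distrib]
    exact Finset.sum_congr rfl fun p _ => Finset.sum_congr rfl fun q _ => by ring
  rw [hexpand, hleft, hright, add_zero, zero_sub, neg_neg]

lemma sum_setIntegral_le_of_card_le {ι α : Type*} [MeasurableSpace α] {μ : Measure α}
    {D : Finset ι} {A : ι → Set α} (hA : ∀ i ∈ D, NullMeasurableSet (A i) μ) {f : α → ℝ}
    (hf_nonneg : ∀ x, 0 ≤ f x) (hf : Integrable f μ) {N : ℕ}
    (hN : ∀ᵐ x ∂μ, ∃ s : Finset ι, s.card ≤ N ∧ ∀ i ∈ D, x ∈ A i → i ∈ s) :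
    ∑ i ∈ D, ∫ x in A i, f x ∂μ ≤ N * ∫ x, f x ∂μ := by
  classical
  have hint : ∀ i ∈ D, Integrable ((A i).indicator f) μ := fun i hi => hf.indicator₀ (hA i hi)
  rw [Finset.sum_congr rfl fun i hi => (integral_indicator₀ (hA i hi)).symm,
    ← integral_finsetSum _ hint, ← integral_const_mul]
  refine integral_mono_ae (integrable_finsetSum _ hint) (hf.const_mul _) ?_
  filter_upwards [hN] with x ⟨s, hs, hsA⟩
  have hcard : (D.filter (· ∈ s)).card ≤ N :=
    (Finset.card_le_card fun i hi => (Finset.mem_filter.mp hi).2).trans hs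
  calc ∑ i ∈ D, (A i).indicator f x = ∑ i ∈ D with i ∈ s, (A i).indicator f x :=
        (Finset.sum_filter_of_ne fun i hi h => hsA i hi (mem_of_indicator_ne_zero h)).symm
    _ ≤ (D.filter (· ∈ s)).card • f x :=
        Finset.sum_le_card_nsmul _ _ _ fun i _ => indicator_le_self' (fun _ _ => hf_nonneg x) x
    _ ≤ N * f x := by
        rw [nsmul_eq_mul]
        exact mul_le_mul_of_nonneg_right (Nat.cast_le.mpr hcard) (hf_nonneg x)

end FiniteSums

section Consistency

variable {n m : ℕ} {Ω : Set (E n)} {𝒯 : Finset (Simplex n)}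
  {b : AffineBasis (Fin (n + 1)) ℝ (E n)} {K : E n → Matrix (Fin n) (Fin n) ℝ}
  {P : Simplex n → E n → (E n → ℝ) → E n → ℝ} {v : E n → ℝ} {g : E n → E n}

lemma meshSize_nonneg (𝒯 : Finset (Simplex n)) : 0 ≤ meshSize 𝒯 :=
  Real.iSup_nonneg fun _ => Metric.diam_nonneg

lemma diam_le_meshSize {T : Simplex n} (hT : T ∈ 𝒯) :
    Metric.diam (closedSimplex T) ≤ meshSize 𝒯 :=
  le_ciSup (f := fun y : 𝒯 => Metric.diam (closedSimplex y.1)) (finite_range _).bddAbove ⟨T, hT⟩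

lemma IsH10.integrable_norm_sq {u : E n → ℝ} (h : IsH10 Ω u g) :
    Integrable (fun x => ‖g x‖ ^ 2) (volume.restrict Ω) :=
  h.memLp_grad.integrable_norm_pow two_ne_zero

/-- The constant of the weighted error of an off-diagonal entry. The factor `64 (n + 1)² σ²` bounds
`‖∇φ‖²_∞ |δ|²` on a shape regular mesh, and `(n H)^(r+1)` comes from Taylor's formula. -/
noncomputable def offDiagErrorConst (n r : ℕ) (σ Λ : ℝ) : ℝ :=
  (1 + |Λ|) * n ^ 2 * (64 * (n + 1) ^ 2 * σ ^ 2) * n ^ (r + 1)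

lemma offDiagErrorConst_nonneg (n r : ℕ) (σ Λ : ℝ) : 0 ≤ offDiagErrorConst n r σ Λ := by
  unfold offDiagErrorConst
  positivity

variable (hn : n = 1 ∨ n = 2 ∨ n = 3) (hM : IsMacroMesh Ω 𝒯)
include hn hM

lemma sq_mul_norm_direction_sq_le (hb : ⇑b ∈ 𝒯) {δ : E n} (hδ : δ ∈ directions 𝒯 m b) {ρ σ : ℝ}
    (hρ : 0 < ρ) (hdiam : Metric.diam (closedSimplex b) ≤ σ * ρ) :
    (8 * 2 ^ m / ρ) ^ 2 * ‖δ‖ ^ 2 ≤ 64 * (n + 1) ^ 2 * σ ^ 2 :=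
  calc (8 * 2 ^ m / ρ) ^ 2 * ‖δ‖ ^ 2 = (8 * 2 ^ m / ρ * ‖δ‖) ^ 2 := (mul_pow _ _ 2).symm
    _ ≤ (8 * 2 ^ m / ρ * ((n + 1) * (σ * ρ) / 2 ^ m)) ^ 2 := by
        gcongr
        exact (norm_direction_le hn hM hb hδ).trans (by gcongr)
    _ = 64 * (n + 1) ^ 2 * σ ^ 2 := by
        field_simp
        ring

variable (hΩ : IsOpen Ω)
include hΩ

/-- The directional derivative of `v` along `q - p` is `v q - v p` on the whole common support. -/
lemma volume_commonSupport_mul_sub_sq_le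
    (hg : Integrable (fun x => ‖g x‖ ^ 2) (volume.restrict Ω))
    (hreg : ∀ᵐ x ∂(volume.restrict Ω), IsRegularPoint 𝒯 m v g x) (p q : E n) :
    (volume.restrict Ω).real (commonSupport 𝒯 m p q) * (v q - v p) ^ 2 ≤
      ‖q - p‖ ^ 2 * ∫ x in commonSupport 𝒯 m p q, ‖g x‖ ^ 2 ∂(volume.restrict Ω) := by
  have : IsFiniteMeasure (volume.restrict Ω) :=
    ⟨by simpa only [Measure.restrict_apply_univ] using hM.volume_ne_top.lt_top⟩
  rw [← smul_eq_mul, ← setIntegral_const, ← integral_const_mul]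
  refine integral_mono_ae (integrable_const _) (hg.integrableOn.const_mul _) ?_
  filter_upwards [ae_restrict_of_ae hreg,
    ae_restrict_mem₀ (nullMeasurableSet_commonSupport hn hM hΩ p q)] with x hx hxS
  rw [← hx.inner_grad p q hxS.1 hxS.2, ← mul_pow, mul_comm, ← sq_abs]
  exact pow_le_pow_left₀ (abs_nonneg _) (abs_real_inner_le_norm _ _) 2

lemma sum_setIntegral_commonSupport_le
    (hg : Integrable (fun x => ‖g x‖ ^ 2) (volume.restrict Ω))
    (hreg : ∀ᵐ x ∂(volume.restrict Ω), IsRegularPoint 𝒯 m v g x) (D : Finset (E n)) :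
    ∑ z ∈ D ×ˢ D, ∫ x in commonSupport 𝒯 m z.1 z.2, ‖g x‖ ^ 2 ∂(volume.restrict Ω) ≤
      (n + 1) ^ 2 * ∫ x in Ω, ‖g x‖ ^ 2 := by
  have hcard : ∀ᵐ x ∂(volume.restrict Ω), ∃ s : Finset (E n × E n), s.card ≤ (n + 1) ^ 2 ∧
      ∀ z ∈ D ×ˢ D, x ∈ commonSupport 𝒯 m z.1 z.2 → z ∈ s := by
    filter_upwards [hreg] with x hx
    obtain ⟨s, hs, hmem⟩ := hx.exists_card
    refine ⟨s ×ˢ s, ?_, fun z _ hxz => Finset.mem_product.mpr ⟨hmem _ hxz.1, hmem _ hxz.2⟩⟩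
    rw [Finset.card_product, sq]
    exact Nat.mul_le_mul hs hs
  simpa only [Nat.cast_pow, Nat.cast_add, Nat.cast_one] using sum_setIntegral_le_of_card_le
    (fun z _ => nullMeasurableSet_commonSupport hn hM hΩ z.1 z.2) (fun x => sq_nonneg ‖g x‖) hg
    hcard

variable {q r : ℕ} {σ Λ : ℝ} (hσ : ShapeRegular σ 𝒯) (hrq : r ≤ q)
  (hK : MemBrokenSobolev K 𝒯 (r + 1)) (hP : IsProjectionFamily K 𝒯 m q Λ P)
include hσ hrq hK hP

/-- The gradient bound `‖∇φ‖² ≲ 4^m / ρ²` in the entrywise error is absorbed by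
`|δ|² ≲ H_T² / 4^m`, which makes the estimate uniform in `m`. -/
lemma abs_stiffness_sub_proj_stencil_mul_sub_sq_le (hb : ⇑b ∈ 𝒯) {p z : E n}
    (hpz : p ∈ interiorLattice b m ∨ z ∈ interiorLattice b m) (hδ : z - p ∈ directions 𝒯 m b)
    (hg : Integrable (fun x => ‖g x‖ ^ 2) (volume.restrict Ω))
    (hreg : ∀ᵐ x ∂(volume.restrict Ω), IsRegularPoint 𝒯 m v g x) :
    |stiffness Ω K 𝒯 m p z - P b (z - p) (stencil K 𝒯 m b (z - p)) p| * (v z - v p) ^ 2 ≤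
      offDiagErrorConst n r σ Λ * meshSize 𝒯 ^ (r + 1) * (brokenSeminorm K 𝒯 (r + 1)).toReal *
        ∫ x in commonSupport 𝒯 m p z, ‖g x‖ ^ 2 ∂(volume.restrict Ω) := by
  obtain ⟨c, ρ, hρ, hball, hdiam⟩ := hσ _ hb
  obtain ⟨hp, hz⟩ := mem_lattice_of_sub_mem_directions hM hn hb hpz hδ
  have herror := abs_stencil_sub_proj_le hn hM hb (hpz.elim (⟨_, ·⟩) (⟨_, ·⟩)) hrq hK
    (norm_gradient_kuhnHat_le hρ hball) (hP.proj _ hb _ hδ) (mem_stencilDomain hn hM hb hpz hp)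
  have hvolume : (volume (overlap 𝒯 m b (z - p))).toReal =
      (volume.restrict Ω).real (commonSupport 𝒯 m p z) := by
    rw [← volume_commonSupport hn hM hb hpz hp hz, measureReal_def, Measure.restrict_eq_self _
      (commonSupport_subset_domain hn hM hb hpz)]
  rw [stencil_eq_stiffness hn hM hb hpz hp hz hΩ, hvolume] at herror
  have hdiff := volume_commonSupport_mul_sub_sq_le hn hM hΩ hg hreg p z
  have hgeom := sq_mul_norm_direction_sq_le hn hM hb hδ hρ hdiam
  have hmesh := diam_le_meshSize hb
  have hmesh_nonneg := meshSize_nonneg 𝒯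
  set κ := (brokenSeminorm K 𝒯 (r + 1)).toReal
  have : 0 ≤ κ := ENNReal.toReal_nonneg
  set V := (volume.restrict Ω).real (commonSupport 𝒯 m p z)
  set I := ∫ x in commonSupport 𝒯 m p z, ‖g x‖ ^ 2 ∂(volume.restrict Ω)
  have : 0 ≤ I := integral_nonneg fun x => sq_nonneg _
  calc _ ≤ (1 + |Λ|) * (n ^ 2 * ((8 * 2 ^ m / ρ) ^ 2 *
        ((n * Metric.diam (closedSimplex b)) ^ (r + 1) * κ) * V)) * (v z - v p) ^ 2 := by gcongr
    _ = (1 + |Λ|) * n ^ 2 * (8 * 2 ^ m / ρ) ^ 2 *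
        (n * Metric.diam (closedSimplex b)) ^ (r + 1) * κ * (V * (v z - v p) ^ 2) := by ring
    _ ≤ (1 + |Λ|) * n ^ 2 * (8 * 2 ^ m / ρ) ^ 2 * (n * meshSize 𝒯) ^ (r + 1) * κ *
        (‖z - p‖ ^ 2 * I) := by gcongr
    _ = (1 + |Λ|) * n ^ 2 * ((8 * 2 ^ m / ρ) ^ 2 * ‖z - p‖ ^ 2) *
        (n ^ (r + 1) * meshSize 𝒯 ^ (r + 1)) * κ * I := by rw [mul_pow]; ring
    _ ≤ (1 + |Λ|) * n ^ 2 * (64 * (n + 1) ^ 2 * σ ^ 2) *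
        (n ^ (r + 1) * meshSize 𝒯 ^ (r + 1)) * κ * I := by gcongr
    _ = _ := by rw [offDiagErrorConst]; ring

lemma abs_stiffness_sub_surrogateStiffness_mul_sub_sq_le {p z : E n} (hp : p ∈ vertices 𝒯 m)
    (hz : z ∈ vertices 𝒯 m) (hg : Integrable (fun x => ‖g x‖ ^ 2) (volume.restrict Ω))
    (hreg : ∀ᵐ x ∂(volume.restrict Ω), IsRegularPoint 𝒯 m v g x) :
    |stiffness Ω K 𝒯 m p z - surrogateStiffness Ω K 𝒯 m P p z| * (v z - v p) ^ 2 ≤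
      offDiagErrorConst n r σ Λ * meshSize 𝒯 ^ (r + 1) * (brokenSeminorm K 𝒯 (r + 1)).toReal *
        ∫ x in commonSupport 𝒯 m p z, ‖g x‖ ^ 2 ∂(volume.restrict Ω) := by
  classical
  have hrhs : 0 ≤ offDiagErrorConst n r σ Λ * meshSize 𝒯 ^ (r + 1) *
      (brokenSeminorm K 𝒯 (r + 1)).toReal *
        ∫ x in commonSupport 𝒯 m p z, ‖g x‖ ^ 2 ∂(volume.restrict Ω) :=
    mul_nonneg (mul_nonneg (mul_nonneg (offDiagErrorConst_nonneg n r σ Λ)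
      (pow_nonneg (meshSize_nonneg 𝒯) _)) ENNReal.toReal_nonneg)
      (integral_nonneg fun x => sq_nonneg _)
  rcases eq_or_ne p z with rfl | hne
  · rwa [sub_self (v p), zero_pow two_ne_zero, mul_zero]
  rw [surrogateStiffness_of_ne hne]
  by_cases hinterface : p ∈ interfaceVertices 𝒯 m ∧ z ∈ interfaceVertices 𝒯 m
  · rwa [surrogateOffDiag, if_pos hinterface, sub_self, abs_zero, zero_mul]
  obtain ⟨b, hb, hpz⟩ := exists_mem_interiorLattice_or hM hp hz hinterface
  rw [surrogateOffDiag_eq_ite hM hn hb hpz]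
  split_ifs with hδ
  · exact abs_stiffness_sub_proj_stencil_mul_sub_sq_le hn hM hΩ hσ hrq hK hP hb hpz hδ hg hreg
  · rwa [stiffness_eq_zero hn hM hb hpz hΩ K hδ, sub_self, abs_zero, zero_mul]

omit hσ hrq hP in
lemma poissonForm_sub_surrogateForm_eq (hv : ∀ x, x ∉ Ω → v x = 0)
    (hreg : ∀ᵐ x ∂(volume.restrict Ω), IsRegularPoint 𝒯 m v g x) :
    poissonForm Ω K g g - surrogateForm Ω K 𝒯 m P v v = ∑ p ∈ dofs Ω 𝒯 m, ∑ z ∈ dofs Ω 𝒯 m,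
      (stiffness Ω K 𝒯 m p z - surrogateStiffness Ω K 𝒯 m P p z) * v z * v p := by
  classical
  have hsub : dofs Ω 𝒯 m ⊆ vertices 𝒯 m := dofs_subset_vertices
  have hv_zero : ∀ p ∈ vertices 𝒯 m, p ∉ dofs Ω 𝒯 m → v p = 0 := fun p hp hpD =>
    hv p fun h => hpD (Finset.mem_filter.mpr ⟨hp, h⟩)
  have hpoisson : poissonForm Ω K g g =
      ∑ p ∈ dofs Ω 𝒯 m, ∑ z ∈ dofs Ω 𝒯 m, stiffness Ω K 𝒯 m p z * v z * v p := by
    rw [poissonForm_eq_sum_stiffness hn hM hΩ hK hreg]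
    refine (Finset.sum_subset hsub fun p hp hpD => ?_).symm.trans
      (Finset.sum_congr rfl fun p _ => (Finset.sum_subset hsub fun z hz hzD => ?_).symm)
    · simp only [hv_zero p hp hpD, mul_zero, Finset.sum_const_zero]
    · simp only [hv_zero z hz hzD, mul_zero, zero_mul]
  rw [hpoisson, surrogateForm]
  simp only [← Finset.sum_sub_distrib, sub_mul]

omit hσ hrq hP in
lemma sum_stiffness_sub_surrogateStiffness_eq_zero
    (hreg : ∀ᵐ x ∂(volume.restrict Ω), IsRegularPoint 𝒯 m v g x) {p : E n}
    (hp : p ∈ dofs Ω 𝒯 m) :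
    ∑ z ∈ dofs Ω 𝒯 m, (stiffness Ω K 𝒯 m p z - surrogateStiffness Ω K 𝒯 m P p z) = 0 := by
  classical
  rw [Finset.sum_sub_distrib, sum_surrogateStiffness_eq hp, sub_neg_eq_add, add_comm,
    Finset.sum_sdiff dofs_subset_vertices, sum_stiffness_eq_zero hn hM hΩ hK hreg]

theorem abs_poissonForm_sub_surrogateForm_le
    (hsym : ∀ᵐ x ∂(volume.restrict Ω), (K x).IsSymm) (hv : v ∈ feSpace Ω (fineMesh 𝒯 m))
    (hg : IsH10 Ω v g) :
    |poissonForm Ω K g g - surrogateForm Ω K 𝒯 m P v v| ≤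
      (n + 1) ^ 2 / 2 * offDiagErrorConst n r σ Λ * meshSize 𝒯 ^ (r + 1) *
        (brokenSeminorm K 𝒯 (r + 1)).toReal * ∫ x in Ω, ‖g x‖ ^ 2 := by
  have hreg : ∀ᵐ x ∂(volume.restrict Ω), IsRegularPoint 𝒯 m v g x :=
    (ae_restrict_iff' hΩ.measurableSet).mpr (ae_isRegularPoint hn hM hv hg)
  have hmem : ∀ {p}, p ∈ dofs Ω 𝒯 m → p ∈ vertices 𝒯 m := fun h => dofs_subset_vertices h
  set M : E n → E n → ℝ := fun p z =>
    stiffness Ω K 𝒯 m p z - surrogateStiffness Ω K 𝒯 m P p z with hM_def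
  set ε := offDiagErrorConst n r σ Λ * meshSize 𝒯 ^ (r + 1) *
    (brokenSeminorm K 𝒯 (r + 1)).toReal
  have hε_nonneg : 0 ≤ ε := mul_nonneg (mul_nonneg (offDiagErrorConst_nonneg n r σ Λ)
    (pow_nonneg (meshSize_nonneg 𝒯) _)) ENNReal.toReal_nonneg
  have hdiff : 2 * (poissonForm Ω K g g - surrogateForm Ω K 𝒯 m P v v) =
      -∑ z ∈ dofs Ω 𝒯 m ×ˢ dofs Ω 𝒯 m, M z.1 z.2 * (v z.2 - v z.1) ^ 2 := by
    rw [poissonForm_sub_surrogateForm_eq hn hM hΩ hK hv.2.1 hreg, Finset.sum_product]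
    refine two_mul_sum_mul_mul_eq_of_row_sum_eq_zero (M := M) (fun p hp z hz => ?_)
      (fun p hp => sum_stiffness_sub_surrogateStiffness_eq_zero hn hM hΩ hK hreg hp) v
    simp only [hM_def]
    rw [stiffness_comm hsym, surrogateStiffness_comm hM hn hP hsym (hmem hp) (hmem hz)]
  have hsum : 2 * |poissonForm Ω K g g - surrogateForm Ω K 𝒯 m P v v| ≤
      ε * ((n + 1) ^ 2 * ∫ x in Ω, ‖g x‖ ^ 2) :=
    calc _ = |∑ z ∈ dofs Ω 𝒯 m ×ˢ dofs Ω 𝒯 m, M z.1 z.2 * (v z.2 - v z.1) ^ 2| := by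
          rw [← abs_neg (∑ z ∈ _, _), ← hdiff, abs_mul, abs_two]
      _ ≤ ∑ z ∈ dofs Ω 𝒯 m ×ˢ dofs Ω 𝒯 m,
            ε * ∫ x in commonSupport 𝒯 m z.1 z.2, ‖g x‖ ^ 2 ∂(volume.restrict Ω) := by
          refine (Finset.abs_sum_le_sum_abs _ _).trans (Finset.sum_le_sum fun z hz => ?_)
          rw [abs_mul, abs_of_nonneg (sq_nonneg (v z.2 - v z.1))]
          obtain ⟨hp, hq⟩ := Finset.mem_product.mp hz
          exact abs_stiffness_sub_surrogateStiffness_mul_sub_sq_le hn hM hΩ hσ hrq hK hP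
            (hmem hp) (hmem hq) hg.integrable_norm_sq hreg
      _ ≤ _ := by
          rw [← Finset.mul_sum]
          exact mul_le_mul_of_nonneg_left
            (sum_setIntegral_commonSupport_le hn hM hΩ hg.integrable_norm_sq hreg _) hε_nonneg
  linear_combination hsum / 2

end Consistency

/-! ### Coercivity of the surrogate form -/

section MeshIndependence

variable {n k : ℕ} {U Ω : Set (E n)} {f g : E n → ℝ} {ι : Fin k → Fin n}

lemma IsWeakDeriv.ae_enorm_le_seminorm (hU : IsOpen U) (h : IsWeakDeriv U ι f g) :
    ∀ᵐ x, x ∈ U → ‖g x‖ₑ ≤ sobolevInfSeminorm U k f := by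
  rw [← ae_restrict_iff' hU.measurableSet]
  filter_upwards [enorm_ae_le_eLpNormEssSup g (volume.restrict U)] with x hx
  rw [← eLpNorm_exponent_top] at hx
  exact hx.trans (h.eLpNorm_le_seminorm hU)

lemma sobolevInfSeminorm_le_of_ae_mem {α : Type*} {s : Finset α} {V : α → Set (E n)} {B : ℝ≥0∞}
    (hU : IsOpen U) (hf : MemSobolevInf U k f) (hV : ∀ i ∈ s, IsOpen (V i))
    (hfV : ∀ i ∈ s, MemSobolevInf (V i) k f) (hB : ∀ i ∈ s, sobolevInfSeminorm (V i) k f ≤ B)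
    (hcover : ∀ᵐ x, x ∈ U → ∃ i ∈ s, x ∈ V i) : sobolevInfSeminorm U k f ≤ B := by
  refine sobolevInfSeminorm_le fun ι => ?_
  obtain ⟨g, hg, -⟩ := hf.2 k le_rfl ι
  refine ⟨g, hg, ?_⟩
  rw [eLpNorm_exponent_top]
  refine eLpNormEssSup_le_of_ae_enorm_bound ((ae_restrict_iff' hU.measurableSet).mpr ?_)
  have hlocal : ∀ i ∈ s, ∀ᵐ x, x ∈ V i → x ∈ U → ‖g x‖ₑ ≤ B := by
    intro i hi
    obtain ⟨g', hg', -⟩ := (hfV i hi).2 k le_rfl ι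
    have heq := (hg.mono inter_subset_left).ae_eq (hU.inter (hV i hi)) (hg'.mono inter_subset_right)
    filter_upwards [heq, hg'.ae_enorm_le_seminorm (hV i hi)] with x hx hxB hxV hxU
    rw [hx ⟨hxU, hxV⟩]
    exact (hxB hxV).trans (hB i hi)
  filter_upwards [(Filter.eventually_all_finset s).mpr hlocal, hcover] with x hx hxcover hxU
  obtain ⟨i, hi, hxV⟩ := hxcover hxU
  exact hx i hi hxV hxU

variable {K : E n → Matrix (Fin n) (Fin n) ℝ} (hn : n = 1 ∨ n = 2 ∨ n = 3)
include hn

lemma brokenSeminorm_le_of_isMacroMesh {𝒯 𝒯' : Finset (Simplex n)} (hM : IsMacroMesh Ω 𝒯)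
    (hM' : IsMacroMesh Ω 𝒯') (hK : MemBrokenSobolev K 𝒯 k) (hK' : MemBrokenSobolev K 𝒯' k) :
    brokenSeminorm K 𝒯 k ≤ brokenSeminorm K 𝒯' k :=
  iSup₂_le fun T hT => iSup₂_le fun a c =>
    sobolevInfSeminorm_le_of_ae_mem (isOpen_openSimplex T) (hK T hT a c)
      (fun T' _ => isOpen_openSimplex T') (fun T' hT' => hK' T' hT' a c)
      (fun _ hT' => seminorm_le_brokenSeminorm hT' k a c)
      ((ae_mem_openSimplex hn hM').mono fun _ hx hxT => hx (hM.subset T hT hxT))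

lemma exists_brokenSeminorm_toReal_le (Ω : Set (E n)) (K : E n → Matrix (Fin n) (Fin n) ℝ)
    (k : ℕ) :
    ∃ κ : ℝ, ∀ 𝒯, IsMacroMesh Ω 𝒯 → MemBrokenSobolev K 𝒯 k →
      (brokenSeminorm K 𝒯 k).toReal ≤ κ := by
  by_cases h : ∃ 𝒯, IsMacroMesh Ω 𝒯 ∧ MemBrokenSobolev K 𝒯 k
  · obtain ⟨𝒯₀, hM₀, hK₀⟩ := h
    exact ⟨(brokenSeminorm K 𝒯₀ k).toReal, fun 𝒯 hM hK => ENNReal.toReal_mono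
      hK₀.brokenSeminorm_ne_top (brokenSeminorm_le_of_isMacroMesh hn hM hM₀ hK hK₀)⟩
  · exact ⟨0, fun 𝒯 hM hK => absurd ⟨𝒯, hM, hK⟩ h⟩

end MeshIndependence

section Coercivity

variable {n : ℕ} {Ω : Set (E n)} {K : E n → Matrix (Fin n) (Fin n) ℝ}

lemma half_mul_h1NormSq_le_of_abs_sub_le {v : E n → ℝ} {g : E n → E n} {α ε A B : ℝ}
    (hA : α * h1NormSq Ω v g ≤ A) (hAB : |A - B| ≤ ε * ∫ x in Ω, ‖g x‖ ^ 2) (hα : 0 ≤ α)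
    (hε : ε ≤ α / 2) : α / 2 * h1NormSq Ω v g ≤ B := by
  have : 0 ≤ ∫ x in Ω, ‖g x‖ ^ 2 := integral_nonneg fun x => sq_nonneg _
  have hgrad_le : ∫ x in Ω, ‖g x‖ ^ 2 ≤ h1NormSq Ω v g :=
    le_add_of_nonneg_left (integral_nonneg fun x => sq_nonneg _)
  have herror : A - B ≤ α / 2 * h1NormSq Ω v g :=
    calc A - B ≤ ε * ∫ x in Ω, ‖g x‖ ^ 2 := (le_abs_self _).trans hAB
      _ ≤ α / 2 * h1NormSq Ω v g := by gcongr
  linarith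

theorem PoissonCoercive.exists_surrogateForm_coercive (hn : n = 1 ∨ n = 2 ∨ n = 3)
    (hΩ : IsOpen Ω) (hsym : ∀ᵐ x ∂(volume.restrict Ω), (K x).IsSymm) {q r : ℕ} (hrq : r ≤ q)
    (σ Λ : ℝ) (hcoer : PoissonCoercive Ω K) :
    ∃ H₀ > 0, ∃ α' > 0, ∀ 𝒯 m P, IsMacroMesh Ω 𝒯 → ShapeRegular σ 𝒯 →
      MemBrokenSobolev K 𝒯 (r + 1) → meshSize 𝒯 < H₀ → IsProjectionFamily K 𝒯 m q Λ P →
      ∀ v ∈ feSpace Ω (fineMesh 𝒯 m), ∀ g, IsH10 Ω v g →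
        α' * h1NormSq Ω v g ≤ surrogateForm Ω K 𝒯 m P v v := by
  obtain ⟨α, hα, hcoer⟩ := hcoer
  obtain ⟨κ, hκ⟩ := exists_brokenSeminorm_toReal_le hn Ω K (r + 1)
  set C := (n + 1) ^ 2 / 2 * offDiagErrorConst n r σ Λ
  have hC : 0 ≤ C := mul_nonneg (by positivity) (offDiagErrorConst_nonneg n r σ Λ)
  have hcont : Continuous fun H : ℝ => C * H ^ (r + 1) * κ := by fun_prop
  have hsmall : ∀ᶠ H : ℝ in nhds 0, C * H ^ (r + 1) * κ < α / 2 :=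
    hcont.continuousAt.eventually_lt continuousAt_const (by simpa using hα)
  obtain ⟨H₀, hH₀, hsmall⟩ := Metric.eventually_nhds_iff.mp hsmall
  refine ⟨H₀, hH₀, α / 2, half_pos hα, fun 𝒯 m P hM hσ hK hH hP v hv g hg => ?_⟩
  have hH_nonneg := meshSize_nonneg 𝒯
  refine half_mul_h1NormSq_le_of_abs_sub_le (hcoer v g hg)
    (abs_poissonForm_sub_surrogateForm_le hn hM hΩ hσ hrq hK hP hsym hv hg) hα.le ?_
  calc C * meshSize 𝒯 ^ (r + 1) * (brokenSeminorm K 𝒯 (r + 1)).toReal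
      ≤ C * meshSize 𝒯 ^ (r + 1) * κ := by gcongr; exact hκ 𝒯 hM hK
    _ ≤ α / 2 := (hsmall (by rwa [Real.dist_0_eq_abs, abs_of_nonneg hH_nonneg])).le

end Coercivity

end Surrogate

theorem mainTheorem4 (n : ℕ) (hn : n = 1 ∨ n = 2 ∨ n = 3) (q r : ℕ) (hrq : r ≤ q) (σ Λ : ℝ) :
    ∃ C : ℝ, 0 < C ∧
      ∀ (Ω : Set (Surrogate.E n)) (K : Surrogate.E n → Matrix (Fin n) (Fin n) ℝ),
        IsOpen Ω → (∀ᵐ x ∂(MeasureTheory.volume.restrict Ω), (K x).IsSymm) →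
        (∀ (𝒯 : Finset (Surrogate.Simplex n)) (m : ℕ)
            (P : Surrogate.Simplex n → Surrogate.E n →
              (Surrogate.E n → ℝ) → Surrogate.E n → ℝ),
            Surrogate.IsMacroMesh Ω 𝒯 → Surrogate.ShapeRegular σ 𝒯 →
            Surrogate.MemBrokenSobolev K 𝒯 (r + 1) →
            Surrogate.IsProjectionFamily K 𝒯 m q Λ P →
            ∀ v ∈ Surrogate.feSpace Ω (Surrogate.fineMesh 𝒯 m),
            ∀ g : Surrogate.E n → Surrogate.E n, Surrogate.IsH10 Ω v g →
              |Surrogate.poissonForm Ω K g g - Surrogate.surrogateForm Ω K 𝒯 m P v v| ≤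
                C * Surrogate.meshSize 𝒯 ^ (r + 1) *
                  (Surrogate.brokenSeminorm K 𝒯 (r + 1)).toReal *
                  ∫ x in Ω, ‖g x‖ ^ 2) ∧
        (Surrogate.PoissonCoercive Ω K →
          ∃ H₀ : ℝ, 0 < H₀ ∧ ∃ α' : ℝ, 0 < α' ∧
            ∀ (𝒯 : Finset (Surrogate.Simplex n)) (m : ℕ)
              (P : Surrogate.Simplex n → Surrogate.E n →
                (Surrogate.E n → ℝ) → Surrogate.E n → ℝ),
              Surrogate.IsMacroMesh Ω 𝒯 → Surrogate.ShapeRegular σ 𝒯 →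
              Surrogate.MemBrokenSobolev K 𝒯 (r + 1) →
              Surrogate.meshSize 𝒯 < H₀ →
              Surrogate.IsProjectionFamily K 𝒯 m q Λ P →
              ∀ v ∈ Surrogate.feSpace Ω (Surrogate.fineMesh 𝒯 m),
              ∀ g : Surrogate.E n → Surrogate.E n, Surrogate.IsH10 Ω v g →
                α' * Surrogate.h1NormSq Ω v g ≤ Surrogate.surrogateForm Ω K 𝒯 m P v v) := by
  refine ⟨(n + 1) ^ 2 / 2 * Surrogate.offDiagErrorConst n r σ Λ + 1, ?_, fun Ω K hΩ hsym =>
    ⟨fun 𝒯 m P hM hσ hK hP v hv g hg => ?_, fun hcoer => ?_⟩⟩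
  · have := Surrogate.offDiagErrorConst_nonneg n r σ Λ
    positivity
  · have hH := Surrogate.meshSize_nonneg 𝒯
    have : 0 ≤ ∫ x in Ω, ‖g x‖ ^ 2 := MeasureTheory.integral_nonneg fun x => sq_nonneg _
    calc _ ≤ _ := Surrogate.abs_poissonForm_sub_surrogateForm_le hn hM hΩ hσ hrq hK hP hsym hv hg
      _ ≤ _ := by gcongr; exact (lt_add_one _).le
  · exact hcoer.exists_surrogateForm_coercive hn hΩ hsym hrq σ Λ
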